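/- **Theorem 3.3 (Turing machine simulation with summarized chain-of-thought).** *Turing machines.* Let $M$ be a deterministic Turing machine with $K\ge 1$ tapes (infinite to the right), finite state set $Q$, finite input alphabet $\Sigma$, finite tape alphabet $\Gamma\supset\Sigma$ with a blank symbol in $\Gamma\setminus\Sigma$, distinct initial and halting states, and transition function $\delta:Q\times\Gamma^K\to Q\times\Gamma^K\times\{L,S,R\}^K$ (a left move on cell $0$ stays there). The input is written on tape $1$ from cell $0$ on, all other cells are blank, and all heads start on cell $0$. If $M$ halts on $w\in\Sigma^*$, let $t_M(w)$ be the number of steps, let $s_M(w)$ be the maximum of $|w|$ and of all $1+n$ with $n$ a head position on some tape at some time $0\le t\le t_M(w)$, and, if tape $1$ finally holds a word over $\Sigma$ from cell $0$ on followed only by blanks, let $f_M(w)$ be this word. *Transformers.* A hardmax transformer over a finite vocabulary $\mathcal V$ with depth $L$, dimensions $d,d_k,d_v,d_{\mathrm{ff}}$ and $H$ heads per layer maps $(\tau_0,\dots,\tau_{n-1})\in\mathcal V^n$, $n\ge1$, to a token as follows. Start with $x_i=\mathrm{emb}_{\tau_i}+\mathrm{posemb}(i)\in\mathbb R^d$,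 where $\mathrm{posemb}(i)$ has the first $d_{\mathrm{pos}}$ bits of $i$ (bit $0$ written as $-1$, bit $1$ as $1$) in $d_{\mathrm{pos}}$ fixed distinct coordinates and zeros elsewhere. Each layer replaces $x_i$ by $\tilde x_i=x_i+\sum_{h=1}^H W_O^h\sum_{j\le i}\alpha^h_{ij}W_V^hx_j$ and then by $\tilde x_i+W_2\,\mathrm{ReLU}(W_1\tilde x_i+b)$, where $(\alpha^h_{ij})_{j\le i}$ is the uniform distribution on the set of maximizers $j\le i$ of the scores $\langle W_Q^hx_i,W_K^hx_j\rangle/\sqrt{d_k}$. The output is the token $\tau$ that maximizes $\langle\mathrm{unemb}_\tau,x_{n-1}\rangle$ after the last layer. The transformer has *ternary weights* if all embeddings, unembeddings and weight matrices (not the biases) have entries in $\{-1,0,1\}$. It has *ternary activations* on a sequence if all representations before and after every attention and MLP block, all queries, keys, values, head outputs (before and after $W_O$), sums of head outputs, hidden MLP activations (after ReLU) and MLP outputs have entries in $\{-1,0,1\}$. *Summarized chain-of-thought (SCoT).* The vocabulary is $$\mathcal V_M=\{\texttt{<inp>},\texttt{</inp>},\texttt{<outp>},\texttt{</outp>},\texttt{<p>},\texttt{</p>},\texttt{<summ>},\texttt{</summ>}\}\sqcup\bigl(Q\times\Gamma^K\times\{L,S,R\}^K\bigr)\sqcup\{-1,1\}^K\sqcup\Sigma\sqcup\bigl(\Gamma\cup\{\hat\gamma\mid\gamma\in\Gamma\}\bigr)^K\sqcup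 Q .$$ A transformer $T$ over $\mathcal V_M$ is run on $w$ as follows. The first prompt is $\texttt{<inp>}\,w\,\texttt{</inp>}$. From each prompt, $T$ generates tokens autoregressively until it first generates $\texttt{</outp>}$ or $\texttt{</summ>}$; the prompt together with the generated tokens is a *segment*. If the segment is the prompt followed by $*\,\texttt{<summ>}\,s\,\texttt{</summ>}$, with $s$ a nonempty token sequence and $\texttt{<summ>}$ occurring only once after the prompt, then $\texttt{<summ>}\,s\,\texttt{</summ>}$ is the next prompt. $T$ *computes $u\in\Sigma^*$ from $w$ with SCoT* if this continues until a segment is its prompt followed by $*\,\texttt{<outp>}\,u\,\texttt{</outp>}$ with $\texttt{<outp>}$ occurring only once after the prompt. (Here $*$ stands for an arbitrary, possibly empty token sequence.) **Statement.** There is a constant $C$ such that for every Turing machine $M$ as above there is a constant $C_M$ such that for every $\hat s\in\mathbb N_0$ there is a hardmax transformer $T$ over $\mathcal V_M$ with ternary weights and $$L,\;d_k\le C\log(\hat s+2),\qquad d,\;d_v,\;d_{\mathrm{ff}}\le C_M\log(\hat s+2),\qquad H\le C_M,\qquad 2^{d_{\mathrm{pos}}}\ge 8(\hat s+3),$$ such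 that the following holds for every $w\in\Sigma^*$ on which $M$ halts with an output $f_M(w)\in\Sigma^*$ and $s_M(w)\le\hat s$. The transformer $T$ computes $f_M(w)$ from $w$ with SCoT, where every generated token is the unique maximizer of the output score; every segment has length at most $8(s_M(w)+3)$; the sum of the lengths of all segments (repeated prompts included) is at most $8t_M(w)+2|w|+4$; and $T$ has ternary activations on all sequences that it reads in this process. -/

import Mathlib

namespace SCoT

/-! ### Multi-tape Turing machines -/

/-- Head movements: left, stay, right. -/
inductive Move where
  | left
  | stay
  | right

/-- A deterministic Turing machine with `K` tapes, state set `Q`, input alphabet `A` and tape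
alphabet `Γ`. The inclusion of the input alphabet into the tape alphabet is `incl`; the blank
symbol lies outside the input alphabet. (Finiteness of `Q`, `A`, `Γ` and `K ≥ 1` are required
where machines are quantified over.) -/
structure TuringMachine (K : ℕ) (Q A Γ : Type*) where
  incl : A ↪ Γ
  blank : Γ
  incl_ne_blank : ∀ a, incl a ≠ blank
  qInit : Q
  qHalt : Q
  qHalt_ne_qInit : qHalt ≠ qInit
  δ : Q → (Fin K → Γ) → Q × (Fin K → Γ) × (Fin K → Move)

/-- Configurations: state, contents of the tapes (each infinite to the right), head positions. -/
structure Config (K : ℕ) (Q Γ : Type*) where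
  state : Q
  tape : Fin K → ℕ → Γ
  head : Fin K → ℕ

/-- New head position. Moving left from cell `0` stays on cell `0` (truncated subtraction). -/
def Move.apply : Move → ℕ → ℕ
  | .left, n => n - 1
  | .stay, n => n
  | .right, n => n + 1

namespace TuringMachine

variable {K : ℕ} {Q A Γ : Type*}

/-- Initial configuration: the input stands on the first tape (index `0`) from cell `0` on, all
other cells are blank, all heads are on cell `0`. -/
def initConfig (M : TuringMachine K Q A Γ) (w : List A) : Config K Q Γ where
  state := M.qInit
  tape := fun k i => if (k : ℕ) = 0 then (w.map M.incl).getD i M.blank else M.blank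
  head := fun _ => 0

/-- One step of the machine. -/
def step (M : TuringMachine K Q A Γ) (c : Config K Q Γ) : Config K Q Γ :=
  let r := M.δ c.state (fun k => c.tape k (c.head k))
  { state := r.1
    tape := fun k i => if i = c.head k then r.2.1 k else c.tape k i
    head := fun k => (r.2.2 k).apply (c.head k) }

/-- The configuration after `t` steps on input `w`. -/
def run (M : TuringMachine K Q A Γ) (w : List A) : ℕ → Config K Q Γ
  | 0 => M.initConfig w
  | t + 1 => M.step (M.run w t)

/-- `t` is the running time on `w`: the first time at which the halting state is reached. -/
def HaltsAt (M : TuringMachine K Q A Γ) (w : List A) (t : ℕ) : Prop :=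
  IsLeast {t | (M.run w t).state = M.qHalt} t

/-- `M` halts on `w` after exactly `t` steps, and the first tape then contains the word `u` over
the input alphabet, starting at cell `0`, followed by blanks only: `u` is the output on `w`. -/
def HaltsWithOutput [NeZero K] (M : TuringMachine K Q A Γ) (w : List A) (t : ℕ) (u : List A) :
    Prop :=
  M.HaltsAt w t ∧ ∀ i, (M.run w t).tape 0 i = (u.map M.incl).getD i M.blank

/-- Space used on `w` in the first `t` steps: the maximum of `|w|` and of all `1 + n` with `n` a
head position at some time `≤ t` on some tape. -/
def space (M : TuringMachine K Q A Γ) (w : List A) (t : ℕ) : ℕ :=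
  max w.length
    ((Finset.range (t + 1)).sup fun i => Finset.univ.sup fun k => 1 + (M.run w i).head k)

end TuringMachine

/-! ### Hardmax transformer decoders -/

/-- Parameters of an attention head. -/
structure AttentionHead (d dk dv : ℕ) where
  WQ : Matrix (Fin dk) (Fin d) ℝ
  WK : Matrix (Fin dk) (Fin d) ℝ
  WV : Matrix (Fin dv) (Fin d) ℝ
  WO : Matrix (Fin d) (Fin dv) ℝ

/-- Parameters of an MLP with a single hidden layer. -/
structure MLP (d dff : ℕ) where
  W₁ : Matrix (Fin dff) (Fin d) ℝ
  b : Fin dff → ℝ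
  W₂ : Matrix (Fin d) (Fin dff) ℝ

/-- Parameters of a transformer layer with `H` heads. -/
structure Layer (d dff dk dv H : ℕ) where
  heads : Fin H → AttentionHead d dk dv
  mlp : MLP d dff

/-- Parameters of a transformer of depth `L` over the vocabulary `V`, together with the
`posDim` pairwise distinct coordinates `posReg` that hold the binary positional embedding. -/
structure Transformer (d dff dk dv H L : ℕ) (V : Type*) where
  layers : Fin L → Layer d dff dk dv H
  emb : V → Fin d → ℝ
  unemb : V → Fin d → ℝ
  posDim : ℕ
  posReg : Fin posDim ↪ Fin d

namespace AttentionHead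

variable {d dk dv n : ℕ}

def query (a : AttentionHead d dk dv) (x : Fin n → Fin d → ℝ) (i : Fin n) : Fin dk → ℝ :=
  a.WQ.mulVec (x i)

def key (a : AttentionHead d dk dv) (x : Fin n → Fin d → ℝ) (i : Fin n) : Fin dk → ℝ :=
  a.WK.mulVec (x i)

def value (a : AttentionHead d dk dv) (x : Fin n → Fin d → ℝ) (i : Fin n) : Fin dv → ℝ :=
  a.WV.mulVec (x i)

/-- Attention scores `⟨q_i, k_j⟩ / √d_k`. -/
noncomputable def score (a : AttentionHead d dk dv) (x : Fin n → Fin d → ℝ) (i j : Fin n) : ℝ :=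
  1 / √(dk : ℝ) * dotProduct (a.query x i) (a.key x j)

open Classical in
/-- The set of positions `j ≤ i` that maximize the score among all positions `≤ i`. -/
noncomputable def maximizers (a : AttentionHead d dk dv) (x : Fin n → Fin d → ℝ) (i : Fin n) :
    Finset (Fin n) :=
  (Finset.Iic i).filter fun j => ∀ l ∈ Finset.Iic i, a.score x i l ≤ a.score x i j

open Classical in
/-- (Averaging) hardmax attention weights. -/
noncomputable def weight (a : AttentionHead d dk dv) (x : Fin n → Fin d → ℝ) (i j : Fin n) : ℝ :=
  if j ∈ a.maximizers x i then 1 / ((a.maximizers x i).card : ℝ) else 0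

/-- Attention-weighted sum of the values, before the output projection. -/
noncomputable def mix (a : AttentionHead d dk dv) (x : Fin n → Fin d → ℝ) (i : Fin n) :
    Fin dv → ℝ :=
  ∑ j ∈ Finset.Iic i, a.weight x i j • a.value x j

/-- Output of the head at position `i`. -/
noncomputable def out (a : AttentionHead d dk dv) (x : Fin n → Fin d → ℝ) (i : Fin n) :
    Fin d → ℝ :=
  a.WO.mulVec (a.mix x i)

end AttentionHead

namespace MLP

variable {d dff : ℕ}

/-- Hidden activations, after the ReLU. -/
noncomputable def hidden (f : MLP d dff) (x : Fin d → ℝ) : Fin dff → ℝ :=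
  fun s => max 0 ((f.W₁.mulVec x + f.b) s)

noncomputable def out (f : MLP d dff) (x : Fin d → ℝ) : Fin d → ℝ :=
  f.W₂.mulVec (f.hidden x)

end MLP

namespace Layer

variable {d dff dk dv H n : ℕ}

/-- Sum of the outputs of all heads of the layer. -/
noncomputable def attn (ly : Layer d dff dk dv H) (x : Fin n → Fin d → ℝ) (i : Fin n) :
    Fin d → ℝ :=
  ∑ h, (ly.heads h).out x i

/-- Representation after attention with residual connection, before the MLP. -/
noncomputable def mid (ly : Layer d dff dk dv H) (x : Fin n → Fin d → ℝ) (i : Fin n) :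
    Fin d → ℝ :=
  x i + ly.attn x i

/-- Representation after the layer. -/
noncomputable def out (ly : Layer d dff dk dv H) (x : Fin n → Fin d → ℝ) (i : Fin n) :
    Fin d → ℝ :=
  ly.mid x i + ly.mlp.out (ly.mid x i)

end Layer

/-- Bit `s` of `i` (least significant bit first), encoded by `1` and `-1` (for `0`). -/
def bin (s i : ℕ) : ℝ := if i / 2 ^ s % 2 = 1 then 1 else -1

/-- All entries lie in `{-1, 0, 1}`. -/
def Ternary {ι : Type*} (x : ι → ℝ) : Prop := ∀ i, x i = -1 ∨ x i = 0 ∨ x i = 1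

/-- All entries of the matrix lie in `{-1, 0, 1}`. -/
def TernaryMatrix {ι κ : Type*} (W : Matrix ι κ ℝ) : Prop := ∀ i, Ternary (W i)

namespace Transformer

variable {d dff dk dv H L : ℕ} {V : Type*}

open Classical in
/-- Binary positional embedding: the bits of `i` in the coordinates `posReg`, zero elsewhere. -/
noncomputable def posemb (T : Transformer d dff dk dv H L V) (i : ℕ) : Fin d → ℝ :=
  fun c => ∑ s : Fin T.posDim, if T.posReg s = c then bin s i else 0

/-- The representations after `ℓ ≤ L` layers on the token sequence `τ` (positions count from
`0`); for `ℓ > L` the final representation is repeated. -/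
noncomputable def rep (T : Transformer d dff dk dv H L V) (τ : List V) :
    ℕ → Fin τ.length → Fin d → ℝ
  | 0 => fun i => T.emb (τ.get i) + T.posemb i
  | ℓ + 1 => if h : ℓ < L then (T.layers ⟨ℓ, h⟩).out (T.rep τ ℓ) else T.rep τ ℓ

/-- Output score of the token `v` after position `i`. -/
noncomputable def logit (T : Transformer d dff dk dv H L V) (τ : List V) (i : Fin τ.length)
    (v : V) : ℝ :=
  dotProduct (T.unemb v) (T.rep τ L i)

/-- `T(τ) = v`: at the last position of the nonempty sequence `τ`, the token `v` has the largest
score. The maximum is required to be strict, so that no tie breaking is involved. -/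
def Outputs (T : Transformer d dff dk dv H L V) (τ : List V) (v : V) : Prop :=
  ∃ i : Fin τ.length, (i : ℕ) + 1 = τ.length ∧ ∀ v₂, v₂ ≠ v → T.logit τ i v₂ < T.logit τ i v

/-- `g` is the sequence generated autoregressively from `prompt` with stopping symbols `F`:
it extends the prompt, each further token is the output of `T` on the sequence before it, and
the first of these further tokens that is in `F` is the last token of `g`. -/
def Generates (T : Transformer d dff dk dv H L V) (prompt : List V) (F : Set V) (g : List V) :
    Prop :=
  (∃ (ext : List V) (v : V), g = prompt ++ ext ++ [v] ∧ v ∈ F ∧ ∀ v₂ ∈ ext, v₂ ∉ F) ∧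
  ∀ (k : ℕ) (hk : k < g.length), prompt.length ≤ k → T.Outputs (g.take k) g[k]

/-- All weights (embeddings, unembeddings and all matrices; not the MLP biases) are ternary. -/
def TernaryWeights (T : Transformer d dff dk dv H L V) : Prop :=
  (∀ v, Ternary (T.emb v)) ∧ (∀ v, Ternary (T.unemb v)) ∧
  ∀ ℓ, TernaryMatrix (T.layers ℓ).mlp.W₁ ∧ TernaryMatrix (T.layers ℓ).mlp.W₂ ∧
    ∀ h, TernaryMatrix ((T.layers ℓ).heads h).WQ ∧ TernaryMatrix ((T.layers ℓ).heads h).WK ∧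
      TernaryMatrix ((T.layers ℓ).heads h).WV ∧ TernaryMatrix ((T.layers ℓ).heads h).WO

/-- All activations on the token sequence `τ` are ternary: the representations before, inside
and after each layer, the queries, keys, values and outputs of all heads (before and after the
output projection), the sums of the head outputs, and the hidden activations and outputs of the MLPs. -/
def TernaryActivations (T : Transformer d dff dk dv H L V) (τ : List V) : Prop :=
  ∀ i : Fin τ.length, (∀ ℓ ≤ L, Ternary (T.rep τ ℓ i)) ∧
    ∀ ℓ : Fin L,
      Ternary ((T.layers ℓ).mid (T.rep τ ℓ) i) ∧
      Ternary ((T.layers ℓ).attn (T.rep τ ℓ) i) ∧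
      Ternary ((T.layers ℓ).mlp.hidden ((T.layers ℓ).mid (T.rep τ ℓ) i)) ∧
      Ternary ((T.layers ℓ).mlp.out ((T.layers ℓ).mid (T.rep τ ℓ) i)) ∧
      ∀ h : Fin H,
        Ternary (((T.layers ℓ).heads h).query (T.rep τ ℓ) i) ∧
        Ternary (((T.layers ℓ).heads h).key (T.rep τ ℓ) i) ∧
        Ternary (((T.layers ℓ).heads h).value (T.rep τ ℓ) i) ∧
        Ternary (((T.layers ℓ).heads h).mix (T.rep τ ℓ) i) ∧
        Ternary (((T.layers ℓ).heads h).out (T.rep τ ℓ) i)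

end Transformer

/-! ### Summarized chain-of-thought -/

/-- The vocabulary: eight delimiters (`<inp>`, `</inp>`, `<outp>`, `</outp>`, `<p>`, `</p>`,
`<summ>`, `</summ>`), run tokens `Q × Γ^K × {L,S,R}^K`, position tokens `{-1,1}^K`, input
symbols, tape tokens (`K` symbols of `Γ`, each with or without a head mark) and states. -/
inductive Token (K : ℕ) (Q A Γ : Type*) where
  | inp
  | endInp
  | outp
  | endOutp
  | pos
  | endPos
  | summ
  | endSumm
  | runTok (q : Q) (y : Fin K → Γ) (m : Fin K → Move)
  | posTok (b : Fin K → Bool)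
  | sym (a : A)
  | tapeTok (c : Fin K → Γ × Bool)
  | stateTok (q : Q)

/-- `T.ComputesFrom prompt segs u`: running `T` from `prompt` with summaries produces exactly
the segments `segs` (each one including its prompt), and the last segment ends in the block
`<outp> u </outp>`. A segment is generated until the first `</outp>` or `</summ>`; if it ends in
a nonempty block `<summ> … </summ>`, this block is the next prompt. -/
inductive Transformer.ComputesFrom {d dff dk dv H L K : ℕ} {Q A Γ : Type*}
    (T : Transformer d dff dk dv H L (Token K Q A Γ)) :
    List (Token K Q A Γ) → List (List (Token K Q A Γ)) → List A → Prop
  | output (prompt g mid : List (Token K Q A Γ)) (u : List A)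
      (hgen : T.Generates prompt {Token.endOutp, Token.endSumm} g)
      (hform : g = prompt ++ mid ++ [Token.outp] ++ u.map Token.sym ++ [Token.endOutp])
      (honce : Token.outp ∉ mid) :
      T.ComputesFrom prompt [g] u
  | summary (prompt g mid s : List (Token K Q A Γ)) (segs : List (List (Token K Q A Γ)))
      (u : List A)
      (hgen : T.Generates prompt {Token.endOutp, Token.endSumm} g)
      (hform : g = prompt ++ mid ++ [Token.summ] ++ s ++ [Token.endSumm])
      (hne : s ≠ []) (honce : Token.summ ∉ mid ∧ Token.summ ∉ s)
      (hrest : T.ComputesFrom ([Token.summ] ++ s ++ [Token.endSumm]) segs u) :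
      T.ComputesFrom prompt (g :: segs) u

/-- `T` computes `u` from `w` with summarized chain-of-thought, producing the segments `segs`. -/
def Transformer.ComputesSCoT {d dff dk dv H L K : ℕ} {Q A Γ : Type*}
    (T : Transformer d dff dk dv H L (Token K Q A Γ)) (w : List A)
    (segs : List (List (Token K Q A Γ))) (u : List A) : Prop :=
  T.ComputesFrom ([Token.inp] ++ w.map Token.sym ++ [Token.endInp]) segs u

end SCoT

/-! ### Boolean registers as ternary reals. -/

namespace SCoT

/-! The proof treats a transformer as a parallel machine on Boolean registers. Each position holds
boundedly many flags and boundedly many vectors of `B` bits, where `2 ^ B ≥ 8 * (s + 3)`. An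
attention head copies registers from the positions `j ≤ i` whose key bits equal the query bits of
`i`, with position `0` as the fallback (`exists_head`). An MLP performs any update in which a
register depends on few registers (`exists_mlp`). Since lookups only switch on registers that are
off, all activations stay ternary, and `Block.exists_transformer` compiles a list of such blocks.
What remains is a program of `4 * B + 3` blocks (`steps_program`) and an analysis of the tokens it
generates.

The program rests on two devices. First, head positions, the number of listed cells, the number of
steps left and a pointer to the last position before a list are prefix sums of amounts fixed by the
tokens. They are computed by pointer doubling in carry-save form: four summands become two, and each
new digit depends on three adjacent digits (`pairVal_compress`). After `B` rounds all earlier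
positions are covered, and `B` further rounds resolve the carries (`partialSum_fst`). Second, the
symbol in a cell is given by the last position that describes the cell. The binary digits of this
position are found from the top, one lookup per digit (`testBit_findGreatest`), so hardmax never
averages different values.

A segment consists of a prompt that describes a configuration, of run tokens, and of a list. A run
token describes the cell that its step has rewritten, so the last description of a cell is its
current content, and a cell without description is blank (`written_run`). Heads do not jump, so the
cells that are described or under a head form an initial segment (`lt_cellCount_iff_seen`); the list
can stop at the first other cell.

A counter stops the run after as many steps as the prompt has tokens. This keeps segments linear in
the space used. The next prompt is at most about twice as long as the present one, and its cost is
paid by the steps just made, which gives a total length linear in the time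
(`Simulates.computesFrom`). -/

open Classical in
/-- Real encoding of Boolean registers: `1` for true; false is `-1` on the registers in `sg`, and
`0` elsewhere. -/
noncomputable def encode {D : Type*} (sg : Set D) (x : D → Bool) (c : D) : ℝ :=
  if x c = true then 1 else if c ∈ sg then -1 else 0

section Encode

variable {D : Type*} {sg : Set D}

lemma ternary_encode (x : D → Bool) : Ternary (encode sg x) := by
  intro c; unfold encode; split_ifs <;> simp

lemma encode_of_notMem (x : D → Bool) {c : D} (h : c ∉ sg) :
    encode sg x c = if x c = true then 1 else 0 := by
  simp [encode, h]

lemma encode_congr {x y : D → Bool} {c : D} (h : x c = y c) : encode sg x c = encode sg y c := by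
  simp [encode, h]

end Encode

/-! ### Local Boolean updates as MLPs -/

section LocalUpdate

open Classical

variable {D : Type*} (sg : Set D) (S : D → Finset D)

/-- Input weight of the gate that recognizes the pattern `v` on the support `T`. -/
noncomputable def gateWeight (T v : Finset D) (b : D) : ℝ :=
  if b ∈ T then if b ∈ v then 1 else -1 else 0

/-- Bias of the gate that recognizes the pattern `v` on the support `T`. -/
noncomputable def gateBias (T v : Finset D) : ℝ :=
  1 - ∑ b ∈ T, if b ∈ v then (1 : ℝ) else if b ∈ sg then 1 else 0

/-- The bias subtracts the largest possible weighted sum, in which a register outside the pattern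
counts `1` if it is signed (false is `-1`) and `0` otherwise. Full agreement leaves `1`, and each
disagreement costs at least `1`, so the ReLU is an indicator. -/
lemma gate_fires [Fintype D] (T v : Finset D) (hv : v ⊆ T) (x : D → Bool) :
    max 0 (∑ b, gateWeight T v b * encode sg x b + gateBias sg T v) =
      if T.filter (fun b => x b = true) = v then 1 else 0 := by
  have h1 : ∑ b, gateWeight T v b * encode sg x b + gateBias sg T v =
      1 + ∑ b ∈ T, ((if b ∈ v then (1 : ℝ) else -1) * encode sg x b -
        if b ∈ v then (1 : ℝ) else if b ∈ sg then 1 else 0) := by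
    rw [Finset.sum_sub_distrib, gateBias]
    have : ∑ b, gateWeight T v b * encode sg x b =
        ∑ b ∈ T, (if b ∈ v then (1 : ℝ) else -1) * encode sg x b := by
      rw [← Finset.sum_filter_add_sum_filter_not Finset.univ (fun b => b ∈ T)]
      rw [Finset.sum_eq_zero (s := Finset.univ.filter fun b => ¬ b ∈ T), add_zero]
      · rw [Finset.filter_mem_eq_inter, Finset.univ_inter]
        refine Finset.sum_congr rfl fun b hb => ?_
        simp [gateWeight, hb]
      · intro b hb
        simp only [Finset.mem_filter, Finset.mem_univ, true_and] at hb
        simp [gateWeight, hb]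
    rw [this]; ring
  rw [h1]
  have key : ∀ b, ((if b ∈ v then (1 : ℝ) else -1) * encode sg x b -
        if b ∈ v then (1 : ℝ) else if b ∈ sg then 1 else 0) ≤
        if (x b = true ↔ b ∈ v) then 0 else -1 := by
    intro b
    unfold encode
    by_cases h1 : b ∈ v <;> by_cases h2 : x b = true <;> by_cases h3 : b ∈ sg <;>
      simp [h1, h2, h3]
  split_ifs with h
  · have : ∑ b ∈ T, ((if b ∈ v then (1 : ℝ) else -1) * encode sg x b -
        if b ∈ v then (1 : ℝ) else if b ∈ sg then 1 else 0) = 0 := by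
      refine Finset.sum_eq_zero fun b hb => ?_
      have hb' : b ∈ v ↔ x b = true := by rw [← h]; simp [hb]
      unfold encode
      by_cases h2 : x b = true <;> by_cases h3 : b ∈ sg <;> simp [hb', h2, h3]
    rw [this]; norm_num
  · have hex : ∃ b ∈ T, ¬ (x b = true ↔ b ∈ v) := by
      by_contra hcon
      push Not at hcon
      apply h
      ext b
      simp only [Finset.mem_filter]
      constructor
      · rintro ⟨hb, hx⟩; exact (hcon b hb).1 hx
      · intro hb; exact ⟨hv hb, (hcon b (hv hb)).2 hb⟩
    obtain ⟨b, hb, hne⟩ := hex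
    have : ∑ b ∈ T, ((if b ∈ v then (1 : ℝ) else -1) * encode sg x b -
        if b ∈ v then (1 : ℝ) else if b ∈ sg then 1 else 0) ≤ -1 := by
      rw [← Finset.add_sum_erase T _ hb]
      have h2 := key b
      rw [if_neg hne] at h2
      have h3 : ∑ b ∈ T.erase b, ((if b ∈ v then (1 : ℝ) else -1) * encode sg x b -
        if b ∈ v then (1 : ℝ) else if b ∈ sg then 1 else 0) ≤ 0 := by
        refine Finset.sum_nonpos fun b' _ => (key b').trans ?_
        split_ifs <;> norm_num
      linarith
    exact max_eq_left (by linarith)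

/-- A local update of Boolean registers is computed by an MLP with ternary weights. -/
lemma exists_mlp [Fintype D] {d dff : ℕ} (e : D ≃ Fin d) (upd : (D → Bool) → D → Bool)
    (hself : ∀ c, c ∈ S c)
    (hloc : ∀ c x y, (∀ b ∈ S c, x b = y b) → upd x c = upd y c)
    (hsg : ∀ x, ∀ c ∈ sg, upd x c = x c)
    (hcard : ∑ c, 2 ^ (S c).card ≤ dff) :
    ∃ f : MLP d dff, TernaryMatrix f.W₁ ∧ TernaryMatrix f.W₂ ∧ ∀ x : D → Bool,
      Ternary (f.hidden (encode sg x ∘ e.symm)) ∧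
      f.out (encode sg x ∘ e.symm) =
        fun k => encode sg (upd x) (e.symm k) - encode sg x (e.symm k) := by
  -- One hidden unit for each register and each pattern on its support. For each register exactly
  -- one unit fires, and its output weight is the change of that register.
  let ι := Σ c : D, {v : Finset D // v ∈ (S c).powerset}
  have hι : Fintype.card ι ≤ dff := by
    have : ∀ c, Fintype.card {v : Finset D // v ∈ (S c).powerset} = 2 ^ (S c).card := fun c => by
      rw [Fintype.card_coe, Finset.card_powerset]
    simpa only [ι, Fintype.card_sigma, this] using hcard
  let φ : ι ↪ Fin dff := (Fintype.equivFin ι).toEmbedding.trans (Fin.castLEEmb hι)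
  -- Registers outside `S c` count as false here, which is harmless by `hloc`; the old value of `c`
  -- is part of the pattern by `hself`. A signed register that flipped would change by `2`, hence
  -- `hsg`.
  let δ : D → Finset D → ℝ := fun c v =>
    encode sg (upd fun b => decide (b ∈ v)) c - encode sg (fun b => decide (b ∈ v)) c
  have hδ : ∀ c v, δ c v = -1 ∨ δ c v = 0 ∨ δ c v = 1 := by
    intro c v
    by_cases hc : c ∈ sg
    · right; left
      simp only [δ]
      rw [encode_congr (hsg _ c hc), sub_self]
    · simp only [δ, encode_of_notMem _ hc]
      split_ifs <;> norm_num
  refine ⟨⟨fun s => Function.extend φ (fun g k => gateWeight (S g.1) g.2 (e.symm k)) 0 s,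
    Function.extend φ (fun g => gateBias sg (S g.1) g.2) 0,
    fun k => Function.extend φ (fun g => if g.1 = e.symm k then δ g.1 g.2 else 0) 0⟩, ?_, ?_, ?_⟩
  · intro s k
    by_cases hs : ∃ g, φ g = s
    · obtain ⟨g, rfl⟩ := hs
      simp only [φ.injective.extend_apply, gateWeight]
      split_ifs <;> simp
    · simp [Function.extend_apply' _ _ _ hs]
  · intro k s
    by_cases hs : ∃ g, φ g = s
    · obtain ⟨g, rfl⟩ := hs
      simp only [φ.injective.extend_apply]
      split_ifs
      · exact hδ _ _
      · simp
    · simp [Function.extend_apply' _ _ _ hs]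
  intro x
  have hin : ∀ g : ι, MLP.hidden ⟨fun s => Function.extend φ
      (fun g k => gateWeight (S g.1) g.2 (e.symm k)) 0 s,
      Function.extend φ (fun g => gateBias sg (S g.1) g.2) 0,
      fun k => Function.extend φ (fun g => if g.1 = e.symm k then δ g.1 g.2 else 0) 0⟩
      (encode sg x ∘ e.symm) (φ g) =
      if (S g.1).filter (fun b => x b = true) = g.2 then 1 else 0 := by
    intro g
    rw [← gate_fires sg (S g.1) g.2 (Finset.mem_powerset.1 g.2.2) x]
    simp only [MLP.hidden, Matrix.mulVec, dotProduct, Pi.add_apply, φ.injective.extend_apply,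
      Function.comp]
    rw [e.symm.sum_comp (fun b => gateWeight (S g.1) g.2 b * encode sg x b)]
  have hout : ∀ s, (¬ ∃ g, φ g = s) → MLP.hidden ⟨fun s => Function.extend φ
      (fun g k => gateWeight (S g.1) g.2 (e.symm k)) 0 s,
      Function.extend φ (fun g => gateBias sg (S g.1) g.2) 0,
      fun k => Function.extend φ (fun g => if g.1 = e.symm k then δ g.1 g.2 else 0) 0⟩
      (encode sg x ∘ e.symm) s = 0 := by
    intro s hs
    simp [MLP.hidden, Matrix.mulVec, dotProduct, Function.extend_apply' _ _ _ hs]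
  refine ⟨?_, ?_⟩
  · intro s
    by_cases hs : ∃ g, φ g = s
    · obtain ⟨g, rfl⟩ := hs
      rw [hin]; split_ifs <;> simp
    · rw [hout s hs]; simp
  · funext k
    rw [MLP.out, Matrix.mulVec, dotProduct]
    rw [← Fintype.sum_of_injective φ φ.injective
      (fun g : ι => (if g.1 = e.symm k then δ g.1 g.2 else 0) *
        if (S g.1).filter (fun b => x b = true) = g.2 then 1 else 0)]
    · rw [Fintype.sum_sigma, Finset.sum_eq_single (e.symm k)]
      · have hm : (S (e.symm k)).filter (fun b => x b = true) ∈ (S (e.symm k)).powerset := by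
          simp
        rw [Finset.sum_eq_single ⟨_, hm⟩]
        · simp only [if_true, mul_one, δ]
          have h1 : ∀ b ∈ S (e.symm k), decide (b ∈ (S (e.symm k)).filter
              (fun b => x b = true)) = x b := by
            intro b hb; simp [hb]
          rw [encode_congr (hloc (e.symm k) _ x h1),
            encode_congr (x := fun b => decide (b ∈ (S (e.symm k)).filter
              (fun b => x b = true))) (y := x) (h1 _ (hself _))]
        · rintro v - hv
          rw [if_neg (c := _ = (v : Finset D)), mul_zero]
          intro h; exact hv (Subtype.ext h.symm)
        · simp
      · intro c _ hc
        exact Finset.sum_eq_zero fun v _ => by simp [hc]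
      · simp
    · intro s hs
      rw [hout s (by simpa using hs), mul_zero]
    · intro g
      rw [hin]
      simp only [φ.injective.extend_apply]

end LocalUpdate

end SCoT

namespace SCoT

/-! ### Lookups as attention heads -/

/-- Allows a list of query and key rows to be padded with zero rows up to the common dimension `dk`.
-/
lemma sum_getD {α : Type*} (g : α → ℝ) (l : List α) (a : α) (ha : g a = 0) {m : ℕ}
    (hm : l.length ≤ m) : ∑ s : Fin m, g (l.getD s a) = (l.map g).sum := by
  rw [Fin.sum_univ_eq_sum_range (fun s => g (l.getD s a)) m]
  induction l generalizing m with
  | nil => simp [ha]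
  | cons b l ih =>
    obtain ⟨m, rfl⟩ : ∃ m', m = m' + 1 := ⟨m - 1, by simp at hm; omega⟩
    rw [Finset.sum_range_succ']
    simp only [List.getD_cons_succ, List.getD_cons_zero, List.map_cons, List.sum_cons]
    rw [ih (by simpa using hm), add_comm]

section Lookup

open Classical

variable {D : Type*} {sg : Set D}

/-- Position `j` satisfies all equalities `eqs` between registers at `i` and registers at `j`. -/
def Matches (eqs : List (D × D)) (X : ℕ → D → Bool) (i j : ℕ) : Prop :=
  ∀ p ∈ eqs, X i p.1 = X j p.2

/-- A lookup at position `i` yields `v`: all matching positions `0 < j ≤ i` agree on the source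
registers, and position `0` is read if there is no matching position. -/
def Reads (eqs : List (D × D)) (src : D → Option D) (X : ℕ → D → Bool) (i : ℕ) (v : D → Bool) :
    Prop :=
  ∀ t, (src t = none → v t = false) ∧ ∀ s, src t = some s →
    (∀ j, 0 < j → j ≤ i → Matches eqs X i j → X j s = v t) ∧
    ((∀ j, 0 < j → j ≤ i → ¬ Matches eqs X i j) → X 0 s = v t)

/-- Pairs of a query row and a key row; they penalize every violated equality by `2` and
position `0` by `1`. -/
noncomputable def lookupRows (one z : D) (eqs : List (D × D)) : List ((D → ℝ) × (D → ℝ)) :=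
  (fun b => if b = one then 1 else 0, fun b => if b = z then -1 else 0) ::
  -- For a query bit `x` and a key bit `y` away from position `0`, `on` gives `x * (y - 1)` and
  -- `off` gives `(x - 1) * y`, in total `-1` exactly if `x ≠ y`. The weights cannot hold a factor
  -- `2`, so each pair occurs twice. At position `0` the term with `z` cancels `one`, and both
  -- products vanish if the key bits are off there.
  eqs.flatMap fun p =>
    let on : (D → ℝ) × (D → ℝ) := (fun b => if b = p.1 then 1 else 0,
      fun b => (if b = p.2 then 1 else 0) + (if b = z then 1 else 0) - if b = one then 1 else 0)
    let off : (D → ℝ) × (D → ℝ) := (fun b => (if b = p.1 then 1 else 0) - if b = one then 1 else 0,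
      fun b => if b = p.2 then 1 else 0)
    [on, on, off, off]

lemma length_lookupRows (one z : D) (eqs : List (D × D)) :
    (lookupRows one z eqs).length = 4 * eqs.length + 1 := by
  simp [lookupRows, List.length_flatMap]; ring

lemma forall_lookupRows {one z : D} {eqs : List (D × D)} {P : (D → ℝ) × (D → ℝ) → Prop}
    (h0 : P (fun b => if b = one then 1 else 0, fun b => if b = z then -1 else 0))
    (h1 : ∀ p ∈ eqs, P (fun b => if b = p.1 then 1 else 0,
      fun b => (if b = p.2 then 1 else 0) + (if b = z then 1 else 0) - if b = one then 1 else 0) ∧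
      P (fun b => (if b = p.1 then 1 else 0) - if b = one then 1 else 0,
      fun b => if b = p.2 then 1 else 0)) : ∀ r ∈ lookupRows one z eqs, P r := by
  intro r hr
  simp only [lookupRows, List.mem_cons, List.mem_flatMap] at hr
  rcases hr with rfl | ⟨p, hp, rfl | rfl | rfl | rfl | hr⟩
  · exact h0
  · exact (h1 p hp).1
  · exact (h1 p hp).1
  · exact (h1 p hp).2
  · exact (h1 p hp).2
  · simp at hr

variable [Fintype D]

lemma sum_ite_encode {c : D} (hc : c ∉ sg) (x : D → Bool) :
    ∑ b, (if b = c then (1 : ℝ) else 0) * encode sg x b = if x c = true then 1 else 0 := by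
  simp [encode_of_notMem _ hc]

/-- The score of position `j` for a query at position `i`, up to the positive factor. -/
noncomputable def rawScore (sg : Set D) (one z : D) (eqs : List (D × D)) (x y : D → Bool) : ℝ :=
  ((lookupRows one z eqs).map fun r =>
    (∑ b, r.1 b * encode sg x b) * ∑ b, r.2 b * encode sg y b).sum

lemma rawScore_eq {one z : D} (hone : one ∉ sg) (hz : z ∉ sg) {eqs : List (D × D)}
    (heqs : ∀ p ∈ eqs, p.1 ∉ sg ∧ p.2 ∉ sg) {x y : D → Bool} (hx : x one = true)
    (hy : y one = true) : rawScore sg one z eqs x y =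
      (if y z = true then -1 else 0) + (eqs.map fun p =>
        2 * ((if x p.1 = true then (1 : ℝ) else 0) *
          ((if y p.2 = true then 1 else 0) + (if y z = true then 1 else 0) - 1) +
        ((if x p.1 = true then (1 : ℝ) else 0) - 1) * (if y p.2 = true then 1 else 0))).sum := by
  have hneg : ∑ b, (if b = z then (-1 : ℝ) else 0) * encode sg y b =
      if y z = true then -1 else 0 := by
    have h := sum_ite_encode hz y
    simp only [ite_mul, zero_mul, Finset.sum_ite_eq', Finset.mem_univ, if_true] at h ⊢
    rw [one_mul] at h; rw [h]; split_ifs <;> norm_num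
  rw [rawScore, lookupRows, List.map_cons, List.sum_cons]
  congr 1
  · simp only [hneg]
    rw [sum_ite_encode hone, hx]; simp
  · induction eqs with
    | nil => simp
    | cons p l ih =>
      rw [List.flatMap_cons, List.map_append, List.sum_append, ih fun p hp => heqs p (by simp [hp]),
        List.map_cons, List.sum_cons]
      congr 1
      obtain ⟨h1, h2⟩ := heqs p (by simp)
      simp only [List.map_cons, List.map_nil, List.sum_cons, List.sum_nil, sub_mul, add_mul,
        Finset.sum_sub_distrib, Finset.sum_add_distrib, sum_ite_encode h1, sum_ite_encode h2,
        sum_ite_encode hone, sum_ite_encode hz, hx, hy, if_true]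
      ring

/-- The scores `0` of a match, `-1` of position `0` and at most `-2` of a mismatch are in the right
order: position `0` wins exactly if no other visible position matches. -/
lemma rawScore_zero {one z : D} (hone : one ∉ sg) (hz : z ∉ sg) {eqs : List (D × D)}
    (heqs : ∀ p ∈ eqs, p.1 ∉ sg ∧ p.2 ∉ sg) {x y : D → Bool} (hx : x one = true)
    (hy : y one = true) (hyz : y z = true) (hk : ∀ p ∈ eqs, y p.2 = false) :
    rawScore sg one z eqs x y = -1 := by
  rw [rawScore_eq hone hz heqs hx hy, List.sum_eq_zero]
  · simp [hyz]
  · intro r hr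
    obtain ⟨p, hp, rfl⟩ := List.mem_map.1 hr
    simp [hyz, hk p hp]

lemma rawScore_match {one z : D} (hone : one ∉ sg) (hz : z ∉ sg) {eqs : List (D × D)}
    (heqs : ∀ p ∈ eqs, p.1 ∉ sg ∧ p.2 ∉ sg) {x y : D → Bool} (hx : x one = true)
    (hy : y one = true) (hyz : y z = false) (hk : ∀ p ∈ eqs, x p.1 = y p.2) :
    rawScore sg one z eqs x y = 0 := by
  rw [rawScore_eq hone hz heqs hx hy, List.sum_eq_zero]
  · simp [hyz]
  · intro r hr
    obtain ⟨p, hp, rfl⟩ := List.mem_map.1 hr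
    cases h : y p.2 <;> simp [hyz, hk p hp, h]

lemma rawScore_mismatch {one z : D} (hone : one ∉ sg) (hz : z ∉ sg) {eqs : List (D × D)}
    (heqs : ∀ p ∈ eqs, p.1 ∉ sg ∧ p.2 ∉ sg) {x y : D → Bool} (hx : x one = true)
    (hy : y one = true) (hyz : y z = false) (hk : ¬ ∀ p ∈ eqs, x p.1 = y p.2) :
    rawScore sg one z eqs x y ≤ -2 := by
  rw [rawScore_eq hone hz heqs hx hy]
  simp only [hyz, Bool.false_eq_true, if_false, zero_add, add_zero]
  clear heqs
  have hnp : ∀ l : List (D × D), (l.map fun p =>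
        2 * ((if x p.1 = true then (1 : ℝ) else 0) * ((if y p.2 = true then 1 else 0) - 1) +
        ((if x p.1 = true then (1 : ℝ) else 0) - 1) * (if y p.2 = true then 1 else 0))).sum ≤ 0 := by
    intro l
    induction l with
    | nil => simp
    | cons p l ih =>
      rw [List.map_cons, List.sum_cons]
      refine add_nonpos ?_ ih
      cases x p.1 <;> cases y p.2 <;> norm_num
  induction eqs with
  | nil => simp at hk
  | cons p l ih =>
    rw [List.map_cons, List.sum_cons]
    by_cases h : x p.1 = y p.2
    · have : ¬ ∀ p ∈ l, x p.1 = y p.2 := fun hl => hk (by simpa [h] using hl)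
      have h2 := ih this
      have h3 : 2 * ((if x p.1 = true then (1 : ℝ) else 0) * ((if y p.2 = true then 1 else 0) - 1) +
        ((if x p.1 = true then (1 : ℝ) else 0) - 1) * (if y p.2 = true then 1 else 0)) ≤ 0 := by
        cases x p.1 <;> cases y p.2 <;> norm_num
      linarith
    · have h3 : 2 * ((if x p.1 = true then (1 : ℝ) else 0) * ((if y p.2 = true then 1 else 0) - 1) +
        ((if x p.1 = true then (1 : ℝ) else 0) - 1) * (if y p.2 = true then 1 else 0)) ≤ -2 := by
        revert h
        cases x p.1 <;> cases y p.2 <;> norm_num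
      have := hnp l
      linarith

end Lookup

section Mix

variable {d dk dv n : ℕ} (a : AttentionHead d dk dv) (x : Fin n → Fin d → ℝ) (i : Fin n)

open Classical in
lemma maximizers_nonempty : (a.maximizers x i).Nonempty := by
  obtain ⟨j, hj, hmax⟩ := Finset.exists_max_image (Finset.Iic i) (fun j => a.score x i j)
    ⟨i, by simp⟩
  exact ⟨j, by simp only [AttentionHead.maximizers, Finset.mem_filter]; exact ⟨hj, hmax⟩⟩

/-- Averaging does no harm if all maximizers carry the same value. Lookups thus need agreement of
the matching positions, not uniqueness. -/
lemma mix_apply_of_forall (t : Fin dv) (u : ℝ)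
    (h : ∀ j ∈ a.maximizers x i, a.value x j t = u) : a.mix x i t = u := by
  have hne := maximizers_nonempty a x i
  have hsub : a.maximizers x i ⊆ Finset.Iic i := by
    intro j hj
    simp only [AttentionHead.maximizers, Finset.mem_filter] at hj
    exact hj.1
  rw [AttentionHead.mix, Finset.sum_apply, ← Finset.sum_subset hsub]
  · rw [Finset.sum_congr rfl (g := fun _ => 1 / ((a.maximizers x i).card : ℝ) * u)]
    · rw [Finset.sum_const, nsmul_eq_mul]
      have : ((a.maximizers x i).card : ℝ) ≠ 0 := by
        exact_mod_cast hne.card_pos.ne'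
      field_simp
    · intro j hj
      simp [AttentionHead.weight, hj, h j hj]
  · intro j _ hj
    simp [AttentionHead.weight, hj]

end Mix

section LookupHead

open Classical

variable {D : Type*} [Fintype D] {sg : Set D}

/-- A lookup is carried out by an attention head with ternary weights. -/
lemma exists_head {d dk : ℕ} (e : D ≃ Fin d) {one z : D} (hone : one ∉ sg) (hz : z ∉ sg)
    (eqs : List (D × D)) (src : D → Option D)
    (heqs : ∀ p ∈ eqs, p.1 ∉ sg ∧ p.2 ∉ sg ∧ p.2 ≠ z) (hsrc : ∀ t s, src t = some s → s ∉ sg)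
    (hact : eqs = [] → ∀ t, src t = none) (hdk : 4 * eqs.length + 1 ≤ dk) :
    ∃ a : AttentionHead d dk d, (TernaryMatrix a.WQ ∧ TernaryMatrix a.WK ∧ TernaryMatrix a.WV ∧
      TernaryMatrix a.WO) ∧ ∀ (n : ℕ) (X : ℕ → D → Bool) (_ : ∀ i < n, X i one = true)
      (_ : eqs ≠ [] → ∀ i < n, (X i z = true ↔ i = 0) ∧ ∀ p ∈ eqs, X 0 p.2 = false) (i : Fin n),
      Ternary (a.query (fun i : Fin n => encode sg (X i) ∘ e.symm) i) ∧
      Ternary (a.key (fun i : Fin n => encode sg (X i) ∘ e.symm) i) ∧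
      Ternary (a.value (fun i : Fin n => encode sg (X i) ∘ e.symm) i) ∧
      ∀ v, Reads eqs src X i v →
        (a.mix (fun i : Fin n => encode sg (X i) ∘ e.symm) i =
          fun k => if v (e.symm k) = true then 1 else 0) ∧
        a.out (fun i : Fin n => encode sg (X i) ∘ e.symm) i =
          fun k => if v (e.symm k) = true then 1 else 0 := by
  have hlen := length_lookupRows one z eqs
  have hdk0 : 0 < dk := by omega
  let rows := lookupRows one z eqs
  have htern : ∀ r ∈ rows, Ternary r.1 ∧ Ternary r.2 := by
    refine forall_lookupRows ⟨?_, ?_⟩ fun p hp => ⟨⟨?_, ?_⟩, ?_, ?_⟩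
    · intro b; dsimp only; split_ifs <;> simp
    · intro b; dsimp only; split_ifs <;> simp
    · intro b; dsimp only; split_ifs <;> simp
    · intro b
      have h := (heqs p hp).2.2
      dsimp only
      by_cases h1 : b = p.2
      · subst h1; simp only [if_true, h, if_false]; split_ifs <;> simp
      · simp only [h1, if_false]; split_ifs <;> simp
    · intro b; dsimp only; split_ifs <;> simp
    · intro b; dsimp only; split_ifs <;> simp
  have hget : ∀ s : ℕ, rows.getD s (0, 0) ∈ rows ∨ rows.getD s (0, 0) = (0, 0) := by
    intro s
    by_cases hs : s < rows.length
    · left; rw [List.getD_eq_getElem _ _ hs]; exact List.getElem_mem hs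
    · right; rw [List.getD_eq_default _ _ (by omega)]
  -- The value matrix already routes each source register to its target, so the output projection is
  -- the identity.
  let a : AttentionHead d dk d :=
    { WQ := fun s k => (rows.getD s (0, 0)).1 (e.symm k)
      WK := fun s k => (rows.getD s (0, 0)).2 (e.symm k)
      WV := fun t k => if src (e.symm t) = some (e.symm k) then 1 else 0
      WO := 1 }
  refine ⟨a, ⟨?_, ?_, ?_, ?_⟩, ?_⟩
  · intro s k
    rcases hget s with h | h
    · exact (htern _ h).1 _
    · simp only [a, h]; simp
  · intro s k
    rcases hget s with h | h
    · exact (htern _ h).2 _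
    · simp only [a, h]; simp
  · intro s k; simp only [a]; split_ifs <;> simp
  · intro s k; simp only [a, Matrix.one_apply]; split_ifs <;> simp
  intro n X hX1 hX2 i
  set x : Fin n → Fin d → ℝ := fun i => encode sg (X i) ∘ e.symm with hx
  have hquery : ∀ (j : Fin n) s, a.query x j s =
      ∑ b, (rows.getD s (0, 0)).1 b * encode sg (X j) b := by
    intro j s
    simp only [AttentionHead.query, Matrix.mulVec, dotProduct, a, hx, Function.comp]
    exact e.symm.sum_comp (fun b => (rows.getD s (0, 0)).1 b * encode sg (X j) b)
  have hkey : ∀ (j : Fin n) s, a.key x j s =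
      ∑ b, (rows.getD s (0, 0)).2 b * encode sg (X j) b := by
    intro j s
    simp only [AttentionHead.key, Matrix.mulVec, dotProduct, a, hx, Function.comp]
    exact e.symm.sum_comp (fun b => (rows.getD s (0, 0)).2 b * encode sg (X j) b)
  have hvalue : ∀ (j : Fin n) t, a.value x j t = match src (e.symm t) with
      | none => 0
      | some s => if X j s = true then 1 else 0 := by
    intro j t
    simp only [AttentionHead.value, Matrix.mulVec, dotProduct, a, hx, Function.comp]
    rw [e.symm.sum_comp (fun b => (if src (e.symm t) = some b then 1 else 0) * encode sg (X j) b)]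
    rcases hs : src (e.symm t) with _ | s
    · simp
    · simp [encode_of_notMem _ (hsrc _ _ hs)]
  have hrow : ∀ j : Fin n, ∀ r ∈ rows, ((∑ b, r.1 b * encode sg (X j) b = -1 ∨
      ∑ b, r.1 b * encode sg (X j) b = 0 ∨ ∑ b, r.1 b * encode sg (X j) b = 1)) ∧
      (∑ b, r.2 b * encode sg (X j) b = -1 ∨
      ∑ b, r.2 b * encode sg (X j) b = 0 ∨ ∑ b, r.2 b * encode sg (X j) b = 1) := by
    intro j
    refine forall_lookupRows ⟨?_, ?_⟩ fun p hp => ⟨⟨?_, ?_⟩, ?_, ?_⟩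
    · rw [sum_ite_encode hone]; split_ifs <;> simp
    · have h := sum_ite_encode hz (X j)
      simp only [ite_mul, zero_mul, Finset.sum_ite_eq', Finset.mem_univ, if_true] at h ⊢
      rw [one_mul] at h; rw [h]; split_ifs <;> simp
    · rw [sum_ite_encode (heqs p hp).1]; split_ifs <;> simp
    · obtain ⟨h1, h2⟩ := hX2 (List.ne_nil_of_mem hp) j j.2
      simp only [sub_mul, add_mul, Finset.sum_sub_distrib, Finset.sum_add_distrib,
        sum_ite_encode (heqs p hp).2.1, sum_ite_encode hone, sum_ite_encode hz, hX1 j j.2, if_true]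
      by_cases hj : (j : ℕ) = 0
      · rw [hj] at h1 ⊢; simp [h1, h2 p hp]
      · have h3 : X j z = false := by simpa [hj] using h1
        cases X j p.2 <;> simp [h3]
    · simp only [sub_mul, Finset.sum_sub_distrib,
        sum_ite_encode (heqs p hp).1, sum_ite_encode hone, hX1 j j.2, if_true]
      split_ifs <;> simp
    · rw [sum_ite_encode (heqs p hp).2.1]; split_ifs <;> simp
  refine ⟨?_, ?_, ?_, ?_⟩
  · intro s
    rw [hquery]
    rcases hget s with h | h
    · exact (hrow i _ h).1
    · rw [h]; simp
  · intro s
    rw [hkey]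
    rcases hget s with h | h
    · exact (hrow i _ h).2
    · rw [h]; simp
  · intro t
    rw [hvalue]
    cases src (e.symm t)
    · simp
    · dsimp only; split_ifs <;> simp
  intro v hv
  have hscore : ∀ j : Fin n, a.score x i j =
      1 / √(dk : ℝ) * rawScore sg one z eqs (X i) (X j) := by
    intro j
    rw [AttentionHead.score, dotProduct]
    simp only [hquery, hkey]
    rw [sum_getD (fun r : (D → ℝ) × (D → ℝ) => (∑ b, r.1 b * encode sg (X i) b) *
      ∑ b, r.2 b * encode sg (X j) b) rows (0, 0) (by simp) (hlen.trans_le hdk)]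
    rfl
  have hpos : 0 < 1 / √(dk : ℝ) := by
    have : (0 : ℝ) < dk := by exact_mod_cast hdk0
    positivity
  have hmix : a.mix x i = fun k => if v (e.symm k) = true then 1 else 0 := by
    funext t
    refine mix_apply_of_forall _ _ _ _ _ fun j hj => ?_
    rw [hvalue]
    obtain ⟨hnone, hsome⟩ := hv (e.symm t)
    rcases hs : src (e.symm t) with _ | s
    · simp [hnone hs]
    obtain ⟨hm, hnm⟩ := hsome s hs
    -- A head without equalities copies nothing. An actual source therefore makes the assumptions on
    -- position `0` available.
    have hne : eqs ≠ [] := fun h => by simp [hact h] at hs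
    simp only [AttentionHead.maximizers, Finset.mem_filter, Finset.mem_Iic, hscore,
      mul_le_mul_iff_right₀ hpos] at hj
    obtain ⟨hji, hmax⟩ := hj
    have hz' : ∀ l : Fin n, (X l z = true ↔ (l : ℕ) = 0) := fun l => (hX2 hne l l.2).1
    have heqs' : ∀ p ∈ eqs, p.1 ∉ sg ∧ p.2 ∉ sg := fun p hp => ⟨(heqs p hp).1, (heqs p hp).2.1⟩
    have hXj : X j s = v (e.symm t) := by
      by_cases hex : ∃ l, 0 < l ∧ l ≤ (i : ℕ) ∧ Matches eqs X i l
      · obtain ⟨l, hl0, hli, hl⟩ := hex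
        have hln : l < n := by omega
        have h1 := hmax ⟨l, hln⟩ (by simpa [Fin.le_def] using hli)
        rw [rawScore_match hone hz heqs' (hX1 i i.2) (hX1 l hln)
          (by have := hz' ⟨l, hln⟩; simp only [] at this; simpa [hl0.ne'] using this) hl] at h1
        by_cases hj0 : (j : ℕ) = 0
        · rw [rawScore_zero hone hz heqs' (hX1 i i.2) (hX1 j j.2) ((hz' j).2 hj0)
            (by rw [hj0]; exact (hX2 hne i i.2).2)] at h1
          norm_num at h1
        · refine hm j (by omega) hji ?_
          by_contra hcon
          have h2 := rawScore_mismatch hone hz heqs' (hX1 i i.2) (hX1 j j.2)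
            (by simpa [hj0] using hz' j) hcon
          linarith
      · push Not at hex
        by_cases hj0 : (j : ℕ) = 0
        · rw [hj0]; exact hnm hex
        · have h2 := rawScore_mismatch hone hz heqs' (hX1 i i.2) (hX1 j j.2)
            (by simpa [hj0] using hz' j) (hex j (by omega) hji)
          have hn0 : 0 < n := by have := i.2; omega
          have h1 := hmax ⟨0, hn0⟩ (by simp [Fin.le_def])
          rw [rawScore_zero hone hz heqs' (hX1 i i.2) (hX1 0 hn0) ((hz' ⟨0, hn0⟩).2 rfl)
            (hX2 hne i i.2).2] at h1
          linarith
    simp [hXj]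
  exact ⟨hmix, by rw [AttentionHead.out, hmix]; simp [a]⟩

end LookupHead

end SCoT

namespace SCoT

/-! ### Programs of lookups and local updates, compiled to transformers -/

/-- One layer of a program: parallel lookups, followed by an update of the registers. -/
structure Block (D : Type*) (H : ℕ) where
  eqs : Fin H → List (D × D)
  src : Fin H → D → Option D
  upd : (D → Bool) → D → Bool

namespace Block

open Classical

variable {D : Type*} {H : ℕ}

/-- The block fits into a transformer layer with the given dimensions; `sg` are the read-only
signed registers. -/
structure WellFormed [Fintype D] (b : Block D H) (sg : Set D) (z : D) (dk dff : ℕ) : Prop where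
  eqs : ∀ h, ∀ p ∈ b.eqs h, p.1 ∉ sg ∧ p.2 ∉ sg ∧ p.2 ≠ z
  src : ∀ h t s, b.src h t = some s → t ∉ sg ∧ s ∉ sg
  active : ∀ h, b.eqs h = [] → ∀ t, b.src h t = none
  length : ∀ h, 4 * (b.eqs h).length + 1 ≤ dk
  local_upd : ∃ S : D → Finset D, (∀ c, c ∈ S c) ∧
    (∀ c x y, (∀ a ∈ S c, x a = y a) → b.upd x c = b.upd y c) ∧ ∑ c, 2 ^ (S c).card ≤ dff
  upd_sg : ∀ x, ∀ c ∈ sg, b.upd x c = x c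

/-- The block transforms the registers `X` of all positions `< N` into `Y`. -/
def Step (b : Block D H) (one z : D) (N : ℕ) (X Y : ℕ → D → Bool) : Prop :=
  (∀ i < N, X i one = true) ∧
  (∀ h, b.eqs h ≠ [] → ∀ i < N, (X i z = true ↔ i = 0) ∧ ∀ p ∈ b.eqs h, X 0 p.2 = false) ∧
  ∀ i < N, ∃ v : Fin H → D → Bool, (∀ h, Reads (b.eqs h) (b.src h) X i (v h)) ∧
    -- A register is switched on by at most one head and only if it is off, so that the residual sum
    -- is a Boolean disjunction with ternary values.
    (∀ h c, v h c = true → X i c = false ∧ ∀ h', v h' c = true → h' = h) ∧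
    Y i = b.upd fun c => X i c || decide (∃ h, v h c = true)

/-- The blocks, applied one after the other, transform `X` into `Y`. -/
def Steps (one z : D) (N : ℕ) : List (Block D H) → (ℕ → D → Bool) → (ℕ → D → Bool) → Prop
  | [], X, Y => X = Y
  | b :: bs, X, Y => ∃ Z, b.Step one z N X Z ∧ Steps one z N bs Z Y

lemma Steps.append {one z : D} {N : ℕ} {bs bs' : List (Block D H)} {X Y Z : ℕ → D → Bool}
    (h : Steps one z N bs X Y) (h' : Steps one z N bs' Y Z) : Steps one z N (bs ++ bs') X Z := by
  induction bs generalizing X with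
  | nil => cases h; exact h'
  | cons b bs ih =>
    obtain ⟨W, h1, h2⟩ := h
    exact ⟨W, h1, ih h2⟩

lemma steps_range {one z : D} {N : ℕ} (f : ℕ → Block D H) (X : ℕ → ℕ → D → Bool) (m : ℕ)
    (h : ∀ r < m, (f r).Step one z N (X r) (X (r + 1))) :
    Steps one z N ((List.range m).map f) (X 0) (X m) := by
  induction m with
  | zero => rfl
  | succ m ih =>
    rw [List.range_succ, List.map_append]
    exact (ih fun r hr => h r (by omega)).append ⟨_, h m (by omega), rfl⟩

lemma Steps.exists_states {one z : D} {N : ℕ} {bs : List (Block D H)} {X Y : ℕ → D → Bool}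
    (h : Steps one z N bs X Y) : ∃ st : ℕ → ℕ → D → Bool, st 0 = X ∧ st bs.length = Y ∧
      ∀ (l : ℕ) (hl : l < bs.length), bs[l].Step one z N (st l) (st (l + 1)) := by
  induction bs generalizing X with
  | nil => exact ⟨fun _ => X, rfl, h, by simp⟩
  | cons b bs ih =>
    obtain ⟨Z, h1, h2⟩ := h
    obtain ⟨st, h3, h4, h5⟩ := ih h2
    refine ⟨fun l => l.casesOn X st, rfl, h4, ?_⟩
    rintro (_ | l) hl
    · simpa [h3] using h1
    · exact h5 l (by simpa using hl)

variable [Fintype D] {sg : Set D} {one z : D} {d dk dff : ℕ}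

/-- Attention realizes the disjunction in `Block.Step`, and the MLP adds the difference to the
updated registers. As attention is causal, states fixed once for `N` positions serve every sequence
of length `n ≤ N`. -/
lemma exists_layer (e : D ≃ Fin d) (hone : one ∉ sg) (hz : z ∉ sg) (b : Block D H)
    (hb : b.WellFormed sg z dk dff) :
    ∃ ly : Layer d dff dk d H, (TernaryMatrix ly.mlp.W₁ ∧ TernaryMatrix ly.mlp.W₂ ∧
      ∀ h, TernaryMatrix (ly.heads h).WQ ∧ TernaryMatrix (ly.heads h).WK ∧
        TernaryMatrix (ly.heads h).WV ∧ TernaryMatrix (ly.heads h).WO) ∧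
      ∀ (n N : ℕ) (X Y : ℕ → D → Bool) (x : Fin n → Fin d → ℝ), n ≤ N → b.Step one z N X Y →
      (x = fun i : Fin n => encode sg (X i) ∘ e.symm) → ∀ i : Fin n,
        ly.out x i = encode sg (Y i) ∘ e.symm ∧
        Ternary (ly.mid x i) ∧ Ternary (ly.attn x i) ∧ Ternary (ly.mlp.hidden (ly.mid x i)) ∧
        Ternary (ly.mlp.out (ly.mid x i)) ∧ ∀ h,
          Ternary ((ly.heads h).query x i) ∧ Ternary ((ly.heads h).key x i) ∧
          Ternary ((ly.heads h).value x i) ∧ Ternary ((ly.heads h).mix x i) ∧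
          Ternary ((ly.heads h).out x i) := by
  obtain ⟨S, hself, hloc, hcard⟩ := hb.local_upd
  obtain ⟨f, hf1, hf2, hf⟩ := exists_mlp sg S e b.upd hself hloc hb.upd_sg hcard
  choose a ha1 ha2 using fun h => exists_head e hone hz (b.eqs h) (b.src h) (hb.eqs h)
    (fun t s hs => (hb.src h t s hs).2) (hb.active h) (hb.length h)
  refine ⟨⟨a, f⟩, ⟨hf1, hf2, ha1⟩, ?_⟩
  rintro n N X Y x hn ⟨hX1, hX2, hY⟩ rfl i
  obtain ⟨v, hv, hdisj, hYi⟩ := hY i (by omega)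
  have hheads := fun h => ha2 h n X (fun j hj => hX1 j (by omega))
    (fun hne j hj => hX2 h hne j (by omega)) i
  have hvt : ∀ h, Ternary (fun k : Fin d => if v h (e.symm k) = true then (1 : ℝ) else 0) := by
    intro h k; dsimp only; split_ifs <;> simp
  have hout := fun h => (hheads h).2.2.2 (v h) (hv h)
  have hattn : (⟨a, f⟩ : Layer d dff dk d H).attn (fun i : Fin n => encode sg (X i) ∘ e.symm) i =
      fun k => if ∃ h, v h (e.symm k) = true then 1 else 0 := by
    funext k
    rw [Layer.attn, Finset.sum_apply]
    rw [Finset.sum_congr rfl (g := fun h => if v h (e.symm k) = true then (1 : ℝ) else 0)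
      (fun h _ => by rw [(hout h).2])]
    split_ifs with hex
    · obtain ⟨h, hh⟩ := hex
      rw [Finset.sum_eq_single h]
      · simp [hh]
      · intro h' _ hne
        rw [if_neg]
        exact fun h2 => hne ((hdisj h _ hh).2 h' h2)
      · simp
    · push Not at hex
      exact Finset.sum_eq_zero fun h _ => by simp [hex h]
  have hmid : (⟨a, f⟩ : Layer d dff dk d H).mid (fun i : Fin n => encode sg (X i) ∘ e.symm) i =
      encode sg (fun c => X i c || decide (∃ h, v h c = true)) ∘ e.symm := by
    funext k
    rw [Layer.mid, Pi.add_apply, hattn]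
    simp only [Function.comp, encode, Bool.or_eq_true, decide_eq_true_eq]
    by_cases hex : ∃ h, v h (e.symm k) = true
    · obtain ⟨h, hh⟩ := hex
      have hsg : e.symm k ∉ sg := by
        rcases hs : b.src h (e.symm k) with _ | s
        · rw [(hv h (e.symm k)).1 hs] at hh; simp at hh
        · exact (hb.src h _ s hs).1
      have hex : ∃ h, v h (e.symm k) = true := ⟨h, hh⟩
      simp [hsg, hex, (hdisj h _ hh).1]
    · simp [hex]
  have hmlp := hf (fun c => X i c || decide (∃ h, v h c = true))
  refine ⟨?_, ?_, ?_, ?_, ?_, fun h => ?_⟩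
  · rw [Layer.out, hmid, hmlp.2, hYi]
    funext k; simp
  · rw [hmid]; exact fun k => ternary_encode _ _
  · rw [hattn]; intro k; dsimp only; split_ifs <;> simp
  · rw [hmid]; exact hmlp.1
  · rw [hmid]
    change Ternary (f.out _)
    rw [hmlp.2]
    intro k
    dsimp only
    by_cases hk : e.symm k ∈ sg
    · rw [encode_congr (hb.upd_sg _ _ hk)]; simp
    · rw [encode_of_notMem _ hk, encode_of_notMem _ hk]; split_ifs <;> simp
  · exact ⟨(hheads h).1, (hheads h).2.1, (hheads h).2.2.1, by rw [(hout h).1]; exact hvt h,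
      by rw [(hout h).2]; exact hvt h⟩

/-- A list of blocks is carried out by a transformer with ternary weights, whose activations are
ternary. The registers `pos` hold the positional embedding, the others start with `init`. -/
lemma exists_transformer {V : Type*} {B : ℕ} (pos : Fin B ↪ D) (init : V → D → Bool)
    (res : V ↪ D) (bs : List (Block D H)) (hone : one ∉ Set.range pos) (hz : z ∉ Set.range pos)
    (hres : ∀ v, res v ∉ Set.range pos)
    (hbs : ∀ b ∈ bs, b.WellFormed (Set.range pos) z dk dff) :
    ∃ T : Transformer (Fintype.card D) dff dk (Fintype.card D) H bs.length V,
      T.TernaryWeights ∧ T.posDim = B ∧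
      ∀ (N : ℕ) (τ : List V) (X Y : ℕ → D → Bool), τ.length ≤ N → Steps one z N bs X Y →
      (∀ i (hi : i < τ.length) c, c ∉ Set.range pos → X i c = init τ[i] c) →
      (∀ i < τ.length, ∀ r, X i (pos r) = i.testBit r) →
        T.TernaryActivations τ ∧
        ∀ (i : Fin τ.length) v, T.logit τ i v = if Y i (res v) = true then 1 else 0 := by
  let e := Fintype.equivFin D
  choose ly hly1 hly2 using fun l : Fin bs.length =>
    exists_layer e hone hz bs[l] (hbs _ (List.getElem_mem _))
  let T : Transformer (Fintype.card D) dff dk (Fintype.card D) H bs.length V :=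
    -- The embeddings vanish on the positional registers, which the positional embedding fills. An
    -- unembedding reads a single register, so every logit is `0` or `1`.
    { layers := ly
      emb := fun v k => if e.symm k ∈ Set.range pos then 0 else
        if init v (e.symm k) = true then 1 else 0
      unemb := fun v k => if e.symm k = res v then 1 else 0
      posDim := B
      posReg := pos.trans e.toEmbedding }
  refine ⟨T, ⟨?_, ?_, hly1⟩, rfl, ?_⟩
  · intro v k; simp only [T]; split_ifs <;> simp
  · intro v k; simp only [T]; split_ifs <;> simp
  intro N τ X Y hN hsteps hX hpos
  obtain ⟨st, hst0, hstL, hst⟩ := hsteps.exists_states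
  have hrep : ∀ l ≤ bs.length, T.rep τ l =
      fun i : Fin τ.length => encode (Set.range pos) (st l i) ∘ e.symm := by
    intro l hl
    induction l with
    | zero =>
      funext i k
      simp only [Transformer.rep, Pi.add_apply, hst0, Function.comp, Transformer.posemb]
      by_cases hk : e.symm k ∈ Set.range pos
      · obtain ⟨r, hr⟩ := hk
        have hk' : k = e (pos r) := by rw [hr]; simp
        subst hk'
        rw [Finset.sum_eq_single r]
        · simp only [T, encode, bin, Function.Embedding.trans_apply, Equiv.coe_toEmbedding,
            Equiv.symm_apply_apply, Set.mem_range_self, if_true, hpos i i.2 r, zero_add,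
            Nat.testBit_eq_decide_div_mod_eq, decide_eq_true_eq]
        · intro r' _ hne
          simp [T, hne]
        · simp
      · rw [Finset.sum_eq_zero]
        · rw [add_zero, encode_of_notMem _ hk, hX i i.2 _ hk]
          simp only [T, hk, if_false, List.get_eq_getElem]
        · intro r _
          rw [if_neg]
          rintro rfl
          exact hk ⟨r, by simp [T]⟩
    | succ l ih =>
      have hl' : l < bs.length := hl
      funext i
      simp only [Transformer.rep, hl', dif_pos]
      exact (hly2 ⟨l, hl'⟩ τ.length N (st l) (st (l + 1)) _ hN (hst l hl') (ih hl'.le) i).1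
  refine ⟨fun i => ⟨fun l hl => ?_, fun l => ?_⟩, fun i v => ?_⟩
  · rw [hrep l hl]; exact fun k => ternary_encode _ _
  · exact (hly2 l τ.length N (st l) (st (l + 1)) _ hN (hst l l.2) (hrep l l.2.le) i).2
  · rw [Transformer.logit, hrep _ le_rfl, hstL, dotProduct]
    simp only [T, Function.comp]
    rw [e.symm.sum_comp (fun b => (if b = res v then 1 else 0) * encode (Set.range pos) (Y i) b),
      sum_ite_encode (hres v)]

end Block

end SCoT

namespace SCoT

/-! ### Carry-save addition of bit sequences -/

section CarrySave

/-- Majority of three bits. -/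
def maj (x y z : Bool) : Bool := (x && y) || (x && z) || (y && z)

/-- Shift of a bit sequence to the more significant side. -/
def shiftBits (f : ℕ → Bool) : ℕ → Bool
  | 0 => false
  | r + 1 => f r

/-- Four bit sequences (two pairs) are replaced by two with the same sum. -/
def compress (p q : (ℕ → Bool) × (ℕ → Bool)) : (ℕ → Bool) × (ℕ → Bool) :=
  let x := fun r => p.1 r ^^ p.2 r ^^ q.1 r
  let y := shiftBits fun r => maj (p.1 r) (p.2 r) (q.1 r)
  (fun r => x r ^^ y r ^^ q.2 r, shiftBits fun r => maj (x r) (y r) (q.2 r))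

/-- The number with the binary digits `f 0, …, f (B - 1)`. -/
def bitsVal (B : ℕ) (f : ℕ → Bool) : ℕ := ∑ r ∈ Finset.range B, if f r then 2 ^ r else 0

/-- The digit that is shifted out at the top has weight `2 ^ B` and vanishes modulo `2 ^ B`. -/
lemma bitsVal_shiftBits (B : ℕ) (f : ℕ → Bool) :
    (bitsVal B (shiftBits f) : ZMod (2 ^ B)) = 2 * bitsVal B f := by
  cases B with
  | zero => exact Subsingleton.elim (α := ZMod 1) _ _
  | succ B =>
    have h1 : bitsVal (B + 1) (shiftBits f) = 2 * bitsVal B f := by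
      rw [bitsVal, Finset.sum_range_succ', bitsVal, Finset.mul_sum]
      simp only [shiftBits, Bool.false_eq_true, if_false, add_zero]
      refine Finset.sum_congr rfl fun r _ => ?_
      by_cases hf : f r = true <;> simp [hf, pow_succ, mul_comm]
    have h2 : bitsVal (B + 1) f = bitsVal B f + if f B then 2 ^ B else 0 := by
      rw [bitsVal, Finset.sum_range_succ, ← bitsVal]
    rw [h1, h2]
    push_cast
    rw [mul_add]
    split_ifs
    · have : (2 : ZMod (2 ^ (B + 1))) * 2 ^ B = 0 := by
        have := ZMod.natCast_self (2 ^ (B + 1))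
        push_cast at this
        rw [← this]; ring
      rw [this, add_zero]
    · simp

lemma bitsVal_fullAdder (B : ℕ) (f g h : ℕ → Bool) :
    (bitsVal B (fun r => f r ^^ g r ^^ h r) : ZMod (2 ^ B)) +
      bitsVal B (shiftBits fun r => maj (f r) (g r) (h r)) =
      bitsVal B f + bitsVal B g + bitsVal B h := by
  rw [bitsVal_shiftBits]
  norm_cast
  congr 1
  simp only [bitsVal, Finset.mul_sum, ← Finset.sum_add_distrib]
  refine Finset.sum_congr rfl fun r _ => ?_
  by_cases h1 : f r = true <;> by_cases h2 : g r = true <;> by_cases h3 : h r = true <;>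
    simp [maj, h1, h2, h3] <;> ring

/-- The sum of a pair of bit sequences modulo `2 ^ B`. -/
def pairVal (B : ℕ) (p : (ℕ → Bool) × (ℕ → Bool)) : ZMod (2 ^ B) :=
  bitsVal B p.1 + bitsVal B p.2

/-- Two full adders lead from four summands to three and then to two. No carry travels further than
two digits, which keeps the supports of the update bounded. -/
lemma pairVal_compress (B : ℕ) (p q : (ℕ → Bool) × (ℕ → Bool)) :
    pairVal B (compress p q) = pairVal B p + pairVal B q := by
  unfold pairVal compress
  rw [bitsVal_fullAdder, bitsVal_fullAdder]
  ring

/-- The pair of zero sequences. -/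
def zeroPair : (ℕ → Bool) × (ℕ → Bool) := (fun _ => false, fun _ => false)

/-- When zero is added, a carry out of a digit needs the second sequence at that digit. The carries
therefore move up by at least one digit per round, and after `B` rounds the first sequence alone is
the sum modulo `2 ^ B`. -/
lemma compress_zeroPair_snd {p : (ℕ → Bool) × (ℕ → Bool)} {t : ℕ}
    (h : ∀ r < t, p.2 r = false) : ∀ r < t + 1, (compress p zeroPair).2 r = false := by
  have hy : ∀ r < t + 1, shiftBits (fun r => maj (p.1 r) (p.2 r) false) r = false := by
    rintro (_ | r) hr
    · rfl
    · simp [shiftBits, maj, h r (by omega)]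
  rintro (_ | r) hr
  · rfl
  · have := hy r (by omega)
    simp only [compress, zeroPair, shiftBits] at this ⊢
    rw [this]; simp [maj]

lemma compress_zeroPair_zeroPair : compress zeroPair zeroPair = zeroPair := by
  ext r <;> rcases r with _ | _ | r <;> simp [compress, zeroPair, shiftBits, maj]

lemma bitsVal_succ (B : ℕ) (f : ℕ → Bool) :
    bitsVal (B + 1) f = Nat.bit (f 0) (bitsVal B fun r => f (r + 1)) := by
  rw [bitsVal, Finset.sum_range_succ', bitsVal, Nat.bit_val, Finset.mul_sum]
  congr 1
  · refine Finset.sum_congr rfl fun r _ => ?_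
    by_cases hf : f (r + 1) = true <;> simp [hf, pow_succ, mul_comm]
  · cases f 0 <;> simp

lemma testBit_bitsVal (B : ℕ) (f : ℕ → Bool) : ∀ r < B, (bitsVal B f).testBit r = f r := by
  induction B generalizing f with
  | zero => simp
  | succ B ih =>
    rintro (_ | r) hr
    · rw [bitsVal_succ, Nat.testBit_bit_zero]
    · rw [bitsVal_succ, Nat.testBit_bit_succ, ih _ r (by omega)]

lemma bitsVal_lt (B : ℕ) (f : ℕ → Bool) : bitsVal B f < 2 ^ B := by
  induction B generalizing f with
  | zero => simp [bitsVal]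
  | succ B ih =>
    have := ih fun r => f (r + 1)
    rw [bitsVal_succ, Nat.bit_val, pow_succ]
    have h2 := Bool.toNat_le (f 0)
    omega

lemma bitsVal_eq_val (B : ℕ) (f : ℕ → Bool) : (bitsVal B f : ZMod (2 ^ B)).val = bitsVal B f :=
  ZMod.val_natCast_of_lt (bitsVal_lt B f)

lemma bitsVal_testBit {B n : ℕ} (hn : n < 2 ^ B) : bitsVal B n.testBit = n := by
  refine Nat.eq_of_testBit_eq fun r => ?_
  by_cases hr : r < B
  · exact testBit_bitsVal B _ r hr
  · have h2 : 2 ^ B ≤ 2 ^ r := Nat.pow_le_pow_right (by norm_num) (by omega)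
    rw [Nat.testBit_lt_two_pow ((bitsVal_lt B _).trans_le h2),
      Nat.testBit_lt_two_pow (hn.trans_le h2)]

lemma eq_of_testBit_lt {B m n : ℕ} (hm : m < 2 ^ B) (hn : n < 2 ^ B)
    (h : ∀ r < B, m.testBit r = n.testBit r) : m = n := by
  rw [← bitsVal_testBit hm, ← bitsVal_testBit hn]
  exact Finset.sum_congr rfl fun r hr => by rw [h r (Finset.mem_range.1 hr)]

end CarrySave

/-! ### Information carried by tokens -/

namespace Token

variable {K : ℕ} {Q A Γ : Type*}

/-- End of a prompt. -/
def isEnd : Token K Q A Γ → Bool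
  | endInp => true
  | endSumm => true
  | _ => false

/-- Run tokens. -/
def isRun : Token K Q A Γ → Bool
  | runTok .. => true
  | _ => false

/-- Tokens that describe a cell. -/
def isCell : Token K Q A Γ → Bool
  | sym _ => true
  | tapeTok _ => true
  | _ => false

/-- Tokens after which a cell is described, if generated. -/
def isList : Token K Q A Γ → Bool
  | summ => true
  | outp => true
  | sym _ => true
  | tapeTok _ => true
  | _ => false

/-- The symbol on tape `k` given by a token. -/
def written (M : TuringMachine K Q A Γ) (k : Fin K) : Token K Q A Γ → Option Γ
  | sym a => some (if (k : ℕ) = 0 then M.incl a else M.blank)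
  | tapeTok c => some (c k).1
  | runTok _ y _ => some (y k)
  | _ => none

/-- The state of a state token. -/
def stored : Token K Q A Γ → Option Q
  | stateTok q => some q
  | _ => none

/-- The state of the machine after a run token, and at the start. -/
def current (M : TuringMachine K Q A Γ) : Token K Q A Γ → Option Q
  | endInp => some M.qInit
  | runTok q _ _ => some q
  | _ => none

end Token

/-- Counters: head addresses, cells listed so far, steps left, last position without list. -/
inductive Chan (K : ℕ) where
  | tape (k : Fin K)
  | cnt
  | thr
  | clk

/-- Amounts added to a counter at one position. -/
inductive Amount where
  | zero
  | one
  | two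
  | neg
  | index

/-- Binary digits of an amount, modulo a power of two. -/
def Amount.bit : Amount → ℕ → Bool → Bool
  | zero, _, _ => false
  | one, r, _ => r == 0
  | two, r, _ => r == 1
  | neg, _, _ => true
  | index, _, x => x

/-! ### Counters as prefix sums, by pointer doubling. -/

section Counters

variable {K : ℕ} {Q A Γ : Type*}

/-- Amount added to a counter by a token; `gen` tells that the prompt is complete. -/
def amount : Chan K → Token K Q A Γ → Bool → Amount
  -- Tape counters hold the head position plus one. Cell `l` of a prompt stands at position `l + 1`,
  -- so a head mark contributes its own position.
  | .tape k, .tapeTok c, gen => if (c k).2 && !gen then .index else .zero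
  | .tape _, .endInp, _ => .one
  | .tape k, .runTok _ _ m, _ => match m k with
    | .left => .neg
    | .stay => .zero
    | .right => .one
  | .tape _, _, _ => .zero
  | .cnt, t, gen => if gen && t.isList then .one else .zero
  -- At the end of a prompt this is the length of the prompt: position `0` adds nothing, so the end
  -- token adds `2`. Every run token takes `1` away.
  | .thr, t, gen => if t.isRun then .neg else if t.isEnd then .two else if gen then .zero else .one
  -- Equal to the position up to the last run token, and frozen there while a list is generated.
  | .clk, t, gen => if gen && t.isList then .zero else .one

variable (τ : ℕ → Token K Q A Γ)

/-- The prompt is complete at position `i`. -/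
def gen (i : ℕ) : Prop := ∃ j, 0 < j ∧ j ≤ i ∧ (τ j).isEnd = true

open Classical in
/-- Amount added to a counter at position `i`. -/
noncomputable def amountAt (ch : Chan K) (i : ℕ) : Amount :=
  if i = 0 then .zero else amount ch (τ i) (decide (gen τ i))

/-- Digits of the amount added to a counter at position `i`. -/
noncomputable def amountBits (ch : Chan K) (i r : ℕ) : Bool :=
  (amountAt τ ch i).bit r (i.testBit r)

/-- Carry-save representation of the sum over the last `2 ^ l` positions. -/
noncomputable def partialSum (ch : Chan K) : ℕ → ℕ → (ℕ → Bool) × (ℕ → Bool)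
  | 0, i => (amountBits τ ch i, fun _ => false)
  | l + 1, i => compress (partialSum ch l i) (partialSum ch l (i - 2 ^ l))

/-- Value of a counter at position `i`, modulo `2 ^ B`. -/
noncomputable def counter (B : ℕ) (ch : Chan K) (i : ℕ) : ZMod (2 ^ B) :=
  ∑ j ∈ Finset.Ioc 0 i, (bitsVal B (amountBits τ ch j) : ZMod (2 ^ B))

lemma amountBits_zero (ch : Chan K) : amountBits τ ch 0 = fun _ => false := by
  funext r; simp [amountBits, amountAt, Amount.bit]

lemma partialSum_zero (ch : Chan K) (l : ℕ) : partialSum τ ch l 0 = zeroPair := by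
  induction l with
  | zero => rw [partialSum, amountBits_zero]; rfl
  | succ l ih => rw [partialSum, Nat.zero_sub, ih, compress_zeroPair_zeroPair]

/-- Two adjacent windows of length `2 ^ l` are joined. A window that is cut off stops at position
`0`, which contributes nothing, so truncated subtraction causes no double counting. -/
lemma pairVal_partialSum (B : ℕ) (ch : Chan K) (l i : ℕ) : pairVal B (partialSum τ ch l i) =
    ∑ j ∈ Finset.Ioc (i - 2 ^ l) i, (bitsVal B (amountBits τ ch j) : ZMod (2 ^ B)) := by
  induction l generalizing i with
  | zero =>
    have h0 : bitsVal B (fun _ => false) = 0 := by simp [bitsVal]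
    rw [partialSum, pairVal, h0, Nat.cast_zero, add_zero, pow_zero]
    cases i with
    | zero => simp [amountBits_zero, h0]
    | succ i => simp
  | succ l ih =>
    rw [partialSum, pairVal_compress, ih, ih, add_comm, pow_succ, mul_two, ← Nat.sub_sub]
    exact Finset.sum_Ioc_consecutive _ (Nat.sub_le _ _) (Nat.sub_le _ _)

lemma partialSum_snd {B : ℕ} (ch : Chan K) {i : ℕ} (hi : i < 2 ^ B) (t : ℕ) :
    ∀ r < t, (partialSum τ ch (B + t) i).2 r = false := by
  induction t with
  | zero => simp
  | succ t ih =>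
    have : i - 2 ^ (B + t) = 0 := by
      have : 2 ^ B ≤ 2 ^ (B + t) := Nat.pow_le_pow_right (by norm_num) (by omega)
      omega
    rw [← add_assoc, partialSum, this, partialSum_zero]
    exact compress_zeroPair_snd ih

/-- After `B` rounds the pointer has reached position `0` and the window covers everything; the next
`B` rounds add zero and only clear the carry sequence. -/
lemma partialSum_fst {B : ℕ} (ch : Chan K) {i : ℕ} (hi : i < 2 ^ B) :
    ∀ r < B, (partialSum τ ch (2 * B) i).1 r = (counter τ B ch i).val.testBit r := by
  have h1 := pairVal_partialSum τ B ch (2 * B) i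
  have h2 := partialSum_snd τ ch hi B
  have h3 : i - 2 ^ (2 * B) = 0 := by
    have : 2 ^ B ≤ 2 ^ (2 * B) := Nat.pow_le_pow_right (by norm_num) (by omega)
    omega
  rw [two_mul] at h1 h3 ⊢
  have h4 : bitsVal B (partialSum τ ch (B + B) i).2 = 0 :=
    Finset.sum_eq_zero fun r hr => by simp [h2 r (Finset.mem_range.1 hr)]
  rw [h3, ← counter, pairVal, h4, Nat.cast_zero, add_zero] at h1
  intro r hr
  rw [← h1, bitsVal_eq_val, testBit_bitsVal B _ r hr]

/-- The digits of `neg` are all on, which is `-1` modulo `2 ^ B`; `2 ≤ B` provides the digit used by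
`two`. -/
lemma bitsVal_amountBits {B : ℕ} (ch : Chan K) {i : ℕ} (hi : i < 2 ^ B) (hB : 2 ≤ B) :
    (bitsVal B (amountBits τ ch i) : ZMod (2 ^ B)) = match amountAt τ ch i with
      | .zero => 0
      | .one => 1
      | .two => 2
      | .neg => -1
      | .index => i := by
  unfold amountBits
  cases amountAt τ ch i with
  | zero => simp [Amount.bit, bitsVal]
  | one =>
    simp only [Amount.bit, bitsVal]
    rw [Finset.sum_eq_single 0]
    · simp
    · intro r _ hr; simp [hr]
    · intro h; simp only [Finset.mem_range, not_lt] at h; omega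
  | two =>
    simp only [Amount.bit, bitsVal]
    rw [Finset.sum_eq_single 1]
    · simp
    · intro r _ hr; simp [hr]
    · intro h; simp only [Finset.mem_range, not_lt] at h; omega
  | neg =>
    simp only [Amount.bit, bitsVal, if_true]
    have h := Nat.geomSum_eq (le_refl 2) B
    have h2 : ∑ r ∈ Finset.range B, 2 ^ r + 1 = 2 ^ B := by
      rw [h]; have := Nat.one_le_two_pow (n := B); simp; omega
    have h3 := ZMod.natCast_self (2 ^ B)
    rw [← h2] at h3
    rw [Nat.cast_add, Nat.cast_one] at h3
    have h4 : (2 : ℕ) ^ B = ∑ r ∈ Finset.range B, 2 ^ r + 1 := h2.symm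
    rw [h4] at *
    exact eq_neg_of_add_eq_zero_left h3
  | index =>
    simp only [Amount.bit]
    rw [bitsVal_testBit hi]

end Counters

end SCoT

namespace SCoT

open Classical

/-! ### The simulating program -/

/-- Names of the registers with one bit per binary digit. -/
inductive Vec (K : ℕ) where
  | pos
  | idx
  | prv
  | ptr
  | tptr
  | a (c : Chan K)
  | b (c : Chan K)
  | ta (c : Chan K)
  | tb (c : Chan K)
  | wad (k : Fin K)
  | qry (k : Fin K)
  | fd (k : Fin K)

/-- Names of the registers with a single bit. -/
inductive Flag (K : ℕ) (Q A Γ : Type*) where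
  | one
  | z
  | gen
  | tok (t : Token K Q A Γ)
  | isEnd
  | wr
  | thr
  | at0 (k : Fin K)
  | mk (k : Fin K)
  | sq (q : Q)
  | pst (q : Q)
  | st (q : Q)
  | lq (q : Q)
  | sy (k : Fin K) (c : Γ)
  | g (k : Fin K) (c : Γ)
  | out (t : Token K Q A Γ)

/-- Registers. -/
abbrev Reg (K : ℕ) (Q A Γ : Type*) (B : ℕ) := Flag K Q A Γ ⊕ Vec K × Fin B

/-! ### Updates with supports of bounded size. -/

section Generic

variable {F W : Type*} {B : ℕ}

/-- The digits number `r` of all vectors. -/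
def digit (x : F ⊕ W × Fin B → Bool) (r : ℕ) (w : W) : Bool :=
  if h : r < B then x (.inr (w, ⟨r, h⟩)) else false

/-- An update where the flags depend on the flags and on digit `ρ` of the vectors, and a digit of
a vector depends on the flags and on this and the two preceding digits of all vectors. -/
def localUpd (ρ : ℕ) (uF : (F → Bool) → (W → Bool) → F → Bool)
    (uW : ℕ → (F → Bool) → (ℕ → W → Bool) → W → Bool) (x : F ⊕ W × Fin B → Bool) :
    F ⊕ W × Fin B → Bool
  | .inl f => uF (fun f => x (.inl f)) (digit x ρ) f
  | .inr (w, r) => uW r (fun f => x (.inl f))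
      (fun j w => if j ≤ 2 ∧ j ≤ (r : ℕ) then digit x (r - j) w else false) w

/-- A support consists of all flags and at most three digits of each vector. Its size does not
depend on `B`, so the number of gates is linear in `B`. -/
lemma local_localUpd [Fintype F] [Fintype W] (ρ : ℕ) (uF : (F → Bool) → (W → Bool) → F → Bool)
    (uW : ℕ → (F → Bool) → (ℕ → W → Bool) → W → Bool) :
    ∃ S : F ⊕ W × Fin B → Finset (F ⊕ W × Fin B), (∀ c, c ∈ S c) ∧
      (∀ c x y, (∀ a ∈ S c, x a = y a) → localUpd ρ uF uW x c = localUpd ρ uF uW y c) ∧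
      ∑ c, 2 ^ (S c).card ≤ Fintype.card (F ⊕ W × Fin B) *
        2 ^ (Fintype.card F + Fintype.card W * 3) := by
  let near : F ⊕ W × Fin B → Finset (Fin B) := fun c => match c with
    | .inl _ => Finset.univ.filter fun r => (r : ℕ) = ρ
    | .inr (_, r) => Finset.univ.filter fun r' => (r' : ℕ) ≤ r ∧ (r : ℕ) ≤ r' + 2
  refine ⟨fun c => Finset.univ.disjSum (Finset.univ ×ˢ near c), ?_, ?_, ?_⟩
  · rintro (f | ⟨w, r⟩) <;> simp [near]
  · rintro (f | ⟨w, r⟩) x y h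
    · have h1 : (fun f => x (.inl f)) = fun f => y (.inl f) := by
        funext f'; exact h _ (by simp)
      have h2 : digit x ρ = digit y ρ := by
        funext w
        unfold digit
        split_ifs with hρ
        · exact h _ (by simp [near])
        · rfl
      simp only [localUpd, h1, h2]
    · have h1 : (fun f => x (.inl f)) = fun f => y (.inl f) := by
        funext f'; exact h _ (by simp)
      have h2 : (fun j w => if j ≤ 2 ∧ j ≤ (r : ℕ) then digit x (r - j) w else false) =
          fun j w => if j ≤ 2 ∧ j ≤ (r : ℕ) then digit y (r - j) w else false := by
        funext j w
        split_ifs with hj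
        · unfold digit
          split_ifs with hr
          · refine h _ (Finset.inr_mem_disjSum.2 (Finset.mem_product.2 ⟨Finset.mem_univ _,
              Finset.mem_filter.2 ⟨Finset.mem_univ _, ?_, ?_⟩⟩))
            · exact Nat.sub_le _ _
            · change (r : ℕ) ≤ (r - j) + 2; omega
          · rfl
        · rfl
      simp only [localUpd, h1, h2]
  · have hnear : ∀ c, (near c).card ≤ 3 := by
      rintro (f | ⟨w, r⟩)
      · refine (Finset.card_le_card_of_injOn (fun r : Fin B => (r : ℕ)) (t := {ρ}) ?_
          fun _ _ _ _ h => Fin.ext h).trans (by simp)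
        intro r hr; simpa [near] using hr
      · refine (Finset.card_le_card_of_injOn (fun r : Fin B => (r : ℕ))
          (t := Finset.Icc ((r : ℕ) - 2) r) ?_ fun _ _ _ _ h => Fin.ext h).trans ?_
        · intro r' hr
          simp only [near, Finset.coe_filter, Finset.mem_univ, true_and, Set.mem_ofPred_eq] at hr
          simp only [Finset.coe_Icc, Set.mem_Icc]; omega
        · simp; omega
    rw [Fintype.card, ← smul_eq_mul]
    refine Finset.sum_le_card_nsmul _ _ _ fun c _ => Nat.pow_le_pow_right (by norm_num) ?_
    rw [Finset.card_disjSum, Finset.card_product, Finset.card_univ, Finset.card_univ]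
    have := hnear c
    gcongr

end Generic

/-! ### Blocks with one common lookup and one lookup per tape. -/

section Heads

variable {D : Type*} {K N : ℕ} {one z : D}

/-- A block with one common lookup and one lookup for each tape. -/
def mkBlock (e₀ : List (D × D)) (s₀ : D → Option D) (e : Fin K → List (D × D))
    (s : Fin K → D → Option D) (upd : (D → Bool) → D → Bool) : Block D (K + 1) where
  eqs := Fin.cases e₀ e
  src := Fin.cases s₀ s
  upd := upd

lemma step_mkBlock {e₀ : List (D × D)} {s₀ : D → Option D} {e : Fin K → List (D × D)}
    {s : Fin K → D → Option D} {upd : (D → Bool) → D → Bool} {X Y : ℕ → D → Bool}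
    (hone : ∀ i < N, X i one = true)
    (h₀ : e₀ ≠ [] → ∀ i < N, (X i z = true ↔ i = 0) ∧ ∀ p ∈ e₀, X 0 p.2 = false)
    (h : ∀ k, e k ≠ [] → ∀ i < N, (X i z = true ↔ i = 0) ∧ ∀ p ∈ e k, X 0 p.2 = false)
    (v₀ : ℕ → D → Bool) (v : ℕ → Fin K → D → Bool) (hv₀ : ∀ i < N, Reads e₀ s₀ X i (v₀ i))
    (hv : ∀ i < N, ∀ k, Reads (e k) (s k) X i (v i k))
    (hd₀ : ∀ i < N, ∀ c, v₀ i c = true → X i c = false ∧ ∀ k, v i k c = false)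
    (hd : ∀ i < N, ∀ k c, v i k c = true → X i c = false ∧ ∀ k', v i k' c = true → k' = k)
    (hY : ∀ i < N, Y i = upd fun c => X i c || (v₀ i c || decide (∃ k, v i k c = true))) :
    (mkBlock e₀ s₀ e s upd).Step one z N X Y := by
  refine ⟨hone, fun h' => ?_, fun i hi => ⟨Fin.cases (v₀ i) (v i), fun h' => ?_, fun h' c => ?_,
    ?_⟩⟩
  · refine Fin.cases h₀ h h'
  · refine Fin.cases (hv₀ i hi) (hv i hi) h'
  · refine Fin.cases (fun hc => ⟨(hd₀ i hi c hc).1, ?_⟩) (fun k hc => ⟨(hd i hi k c hc).1, ?_⟩) h'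
    · refine Fin.cases (fun _ => rfl) fun k hk => ?_
      have := (hd₀ i hi c hc).2 k
      simp [this] at hk
    · refine Fin.cases (fun h0 => ?_) fun k' hk' => ?_
      · have := (hd₀ i hi c h0).2 k
        simp [this] at hc
      · rw [(hd i hi k c hc).2 k' hk']
  · rw [hY i hi]
    congr 1
    funext c
    simp [Fin.exists_fin_succ]

lemma reads_none (eqs : List (D × D)) (X : ℕ → D → Bool) (i : ℕ) :
    Reads eqs (fun _ => none) X i fun _ => false :=
  fun t => ⟨fun _ => rfl, fun s hs => by simp at hs⟩

/-- The values of the source registers at a position. -/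
def copied (src : D → Option D) (x : D → Bool) (t : D) : Bool :=
  match src t with
  | none => false
  | some s => x s

/-- A pointer to position `0` matches no positive position, and then the fallback reads position `0`
anyway. -/
lemma reads_pointer {eqs : List (D × D)} (src : D → Option D) {X : ℕ → D → Bool} {i n : ℕ}
    (hn : n ≤ i) (h : ∀ j, 0 < j → j ≤ i → (Matches eqs X i j ↔ j = n)) :
    Reads eqs src X i (copied src (X n)) := by
  refine fun t => ⟨fun ht => by simp [copied, ht], fun s hs => ⟨fun j h0 hj hm => ?_, fun hno => ?_⟩⟩
  · rw [(h j h0 hj).1 hm]; simp [copied, hs]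
  · rcases Nat.eq_zero_or_pos n with rfl | hpos
    · simp [copied, hs]
    · exact absurd ((h n hpos hn).2 rfl) (hno n hpos hn)

end Heads

/-! ### What the program is meant to compute. -/

section Semantics

variable {K : ℕ} {Q A Γ : Type*} (M : TuringMachine K Q A Γ) (B : ℕ)
  (τ : ℕ → Token K Q A Γ)

/-- Counter value as a natural number. -/
noncomputable def count (ch : Chan K) (i : ℕ) : ℕ := (counter τ B ch i).val

/-- The token at position `i` describes the contents of a cell. -/
def Writes (i : ℕ) : Prop :=
  0 < i ∧ ((τ i).isRun = true ∨ ((τ i).isCell = true ∧ ¬ gen τ i))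

/-- The address of the cell on tape `k` described at position `i`. -/
noncomputable def writeAddr (k : Fin K) (i : ℕ) : ℕ :=
  if i = 0 then 0 else if (τ i).isRun = true then count B τ (.tape k) (i - 1) else i

/-- The address of the cell on tape `k` needed at position `i`. -/
noncomputable def readAddr (k : Fin K) (i : ℕ) : ℕ :=
  if (τ i).isList = true ∧ gen τ i then count B τ .cnt i else count B τ (.tape k) i

/-- The last position up to `i` that describes the cell needed at position `i`, or `0`. -/
noncomputable def lastWrite (k : Fin K) (i : ℕ) : ℕ :=
  Nat.findGreatest (fun j => Writes τ j ∧ writeAddr B τ k j = readAddr B τ k i) i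

/-- The state of the machine at the position `i` of a run token or of the end of a prompt. -/
noncomputable def stateAt (i : ℕ) : Option Q :=
  if τ i = .endSumm then (τ (i - 1)).stored else (τ i).current M

/-- The next token, as a function of the last token, of the test whether a summary is due, of the
tests which heads are on cell `0` and on the cell listed now, of the symbols on the current cells,
and of the state. -/
noncomputable def nextToken [NeZero K] (t : Token K Q A Γ) (thr : Bool) (at0 mk : Fin K → Bool)
    (g : Fin K → Option Γ) (lq : Option Q) : Token K Q A Γ :=
  let y : Fin K → Γ := fun k => (g k).getD M.blank
  match t with
  | .summ | .tapeTok _ =>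
    -- The list continues as long as the cell has a description or a head on some tape; the first
    -- cell with neither ends it.
    if (∃ k, g k ≠ none ∨ mk k = true) then .tapeTok fun k => (y k, mk k)
    else .stateTok (lq.getD M.qInit)
  | .stateTok _ => .endSumm
  | .outp | .sym _ => if h : ∃ a, M.incl a = y 0 then .sym h.choose else .endOutp
  | _ =>
    if lq = some M.qHalt then .outp
    else if thr = true then .summ
    else
      let r := M.δ (lq.getD M.qInit) y
      .runTok r.1 r.2.1 fun k => match r.2.2 k with
        -- The token records the true displacement, so head positions are plain sums without
        -- truncation.
        | .left => if at0 k = true then .stay else .left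
        | m => m

/-- The token generated after position `i`. -/
noncomputable def generated [NeZero K] (i : ℕ) : Token K Q A Γ :=
  nextToken M (τ i) (decide ((τ i).isRun = true ∧ count B τ .thr i = 0))
    (fun k => decide (count B τ (.tape k) i = 1))
    (fun k => decide (count B τ (.tape k) i = count B τ .cnt i))
    (fun k => (τ (lastWrite B τ k i)).written M k)
    (stateAt M τ (count B τ .clk i))

lemma count_lt (ch : Chan K) (i : ℕ) : count B τ ch i < 2 ^ B := ZMod.val_lt _

lemma writeAddr_lt (k : Fin K) {i : ℕ} (hi : i < 2 ^ B) : writeAddr B τ k i < 2 ^ B := by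
  unfold writeAddr; split_ifs
  · omega
  · exact count_lt _ _ _ _
  · exact hi

lemma readAddr_lt (k : Fin K) (i : ℕ) : readAddr B τ k i < 2 ^ B := by
  unfold readAddr; split_ifs <;> exact count_lt _ _ _ _

lemma lastWrite_le (k : Fin K) (i : ℕ) : lastWrite B τ k i ≤ i := Nat.findGreatest_le _

/-- Each position adds at most `1`. The clock can thus be used as a pointer under the causal mask.
-/
lemma count_clk_le {B : ℕ} (hB : 2 ≤ B) {i : ℕ} (hi : i < 2 ^ B) : count B τ .clk i ≤ i := by
  have : ∃ n ≤ i, counter τ B .clk i = (n : ZMod (2 ^ B)) := by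
    induction i with
    | zero => exact ⟨0, le_rfl, by simp [counter]⟩
    | succ i ih =>
      obtain ⟨n, hn, h⟩ := ih (by omega)
      have h1 : counter τ B .clk (i + 1) = counter τ B .clk i +
          bitsVal B (amountBits τ .clk (i + 1)) := Finset.sum_Ioc_succ_top (by omega) _
      rw [h, bitsVal_amountBits τ _ hi hB] at h1
      simp only [amountAt, amount, Nat.succ_ne_zero, if_false] at h1
      split_ifs at h1
      · exact ⟨n, by omega, by simpa using h1⟩
      · exact ⟨n + 1, by omega, by simpa using h1⟩
  obtain ⟨n, hn, h⟩ := this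
  rw [count, h, ZMod.val_natCast_of_lt (by omega)]
  exact hn

/-- The binary digits of the last position with a property can be found one after the other. -/
lemma testBit_findGreatest {B i : ℕ} (hi : i < 2 ^ B) (P : ℕ → Prop)
    [DecidablePred P] (r : ℕ) :
    (Nat.findGreatest P i).testBit r = true ↔ ∃ j, 0 < j ∧ j ≤ i ∧ P j ∧ j.testBit r = true ∧
      ∀ r', r < r' → r' < B → j.testBit r' = (Nat.findGreatest P i).testBit r' := by
  constructor
  · intro h
    have h0 : Nat.findGreatest P i ≠ 0 := by intro h0; simp [h0] at h
    exact ⟨_, Nat.pos_of_ne_zero h0, Nat.findGreatest_le _, Nat.findGreatest_of_ne_zero rfl h0, h,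
      fun _ _ _ => rfl⟩
  · rintro ⟨j, -, hj, hPj, hjr, hhigh⟩
    -- If the maximum had digit `r` off, a candidate with the same higher digits and digit `r` on
    -- would exceed it.
    by_contra hcon
    have hle : j ≤ Nat.findGreatest P i := Nat.le_findGreatest hj hPj
    refine absurd hle (not_le.2 (Nat.lt_of_testBit r (by simpa using hcon) hjr fun r' hr' => ?_))
    by_cases hB : r' < B
    · exact (hhigh r' hr' hB).symm
    · have h2 : 2 ^ B ≤ 2 ^ r' := Nat.pow_le_pow_right (by norm_num) (by omega)
      rw [Nat.testBit_lt_two_pow ((hj.trans_lt hi).trans_le h2),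
        Nat.testBit_lt_two_pow (((Nat.findGreatest_le i).trans_lt hi).trans_le h2)]

end Semantics

end SCoT

namespace SCoT

open Classical

/-! ### The blocks of the program and their dimensions. -/

section Program

variable {K : ℕ} {Q A Γ : Type*} {B : ℕ} (M : TuringMachine K Q A Γ)

/-- The register with the digit `r` of the vector `w`. -/
abbrev vreg (w : Vec K) (r : Fin B) : Reg K Q A Γ B := .inr (w, r)

/-- The register of a flag. -/
abbrev freg (f : Flag K Q A Γ) : Reg K Q A Γ B := .inl f

/-- Condition that two vectors are equal. -/
def eqVec (w w' : Vec K) : List (Reg K Q A Γ B × Reg K Q A Γ B) :=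
  (List.finRange B).map fun r => (vreg w r, vreg w' r)

/-- Digit `r` of the position and of its predecessor. -/
def indexBlock (r : ℕ) : Block (Reg K Q A Γ B) (K + 1) :=
  mkBlock [] (fun _ => none) (fun _ => []) (fun _ _ => none) <| localUpd r
    (fun fl d => fun
      -- Before digit `r` is treated, `z` says that all lower digits vanish. Exactly then does
      -- subtracting one change this digit.
      | .z => fl .z && !d .pos
      | f => fl f)
    (fun r' fl d => fun
      -- Lookups must not use the signed positional registers, so the digits are copied to unsigned
      -- ones.
      | .idx => if r' = r then d 0 .pos else d 0 .idx
      | .prv => if r' = r then d 0 .pos ^^ fl .z else d 0 .prv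
      | w => d 0 w)

/-- Test for the end of the prompt, and the amounts added to the counters. -/
noncomputable def amountBlock : Block (Reg K Q A Γ B) (K + 1) :=
  mkBlock [(freg .one, freg .isEnd)] (fun
      | .inl .gen => some (freg .isEnd)
      | _ => none)
    (fun _ => []) (fun _ _ => none) <| localUpd 0
    (fun fl _ f => fl f)
    (fun r fl d => fun
      -- At position `0` the borrow never ends and all digits of the predecessor came out on; they
      -- are reset to zero.
      | .prv => d 0 .prv && !fl .z
      | .ptr => d 0 .prv && !fl .z
      | .a ch => !fl .z && decide (∃ t, fl (.tok t) = true ∧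
          (amount ch t (fl .gen)).bit r (d 0 .idx) = true)
      | w => d 0 w)

/-- One round of pointer doubling for all counters. -/
def doublingBlock : Block (Reg K Q A Γ B) (K + 1) :=
  mkBlock (eqVec .ptr .idx) (fun
      | .inr (.tptr, r) => some (vreg .ptr r)
      | .inr (.ta ch, r) => some (vreg (.a ch) r)
      | .inr (.tb ch, r) => some (vreg (.b ch) r)
      | _ => none)
    (fun _ => []) (fun _ _ => none) <| localUpd 0
    (fun fl _ f => fl f)
    (fun _ _ d =>
      let x := fun j ch => d j (.a ch) ^^ d j (.b ch) ^^ d j (.ta ch)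
      let y := fun j ch => maj (d (j + 1) (.a ch)) (d (j + 1) (.b ch)) (d (j + 1) (.ta ch))
      fun
      | .ptr => d 0 .tptr
      | .tptr => false
      | .ta _ => false
      | .tb _ => false
      | .a ch => x 0 ch ^^ y 0 ch ^^ d 0 (.tb ch)
      | .b ch => maj (x 1 ch) (y 1 ch) (d 1 (.tb ch))
      | w => d 0 w)

/-- Head addresses before the last move, and all data for reading the tapes. -/
noncomputable def addressBlock : Block (Reg K Q A Γ B) (K + 1) :=
  mkBlock (eqVec .prv .idx) (fun
      | .inr (.wad k, r) => some (vreg (.a (.tape k)) r)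
      | .inl (.pst q) => some (freg (.sq q))
      | _ => none)
    (fun _ => []) (fun _ _ => none) <| localUpd 0
    (fun fl _ => fun
      | .wr => decide (∃ t, fl (.tok t) = true ∧ fl .z = false ∧
          (t.isRun = true ∨ (t.isCell = true ∧ fl .gen = false)))
      | .st q => decide (∃ t, fl (.tok t) = true ∧
          if t = .endSumm then fl (.pst q) = true else t.current M = some q)
      | f => fl f)
    (fun _ fl d => fun
      | .wad k => !fl .z && if ∃ t, fl (.tok t) = true ∧ t.isRun = true then d 0 (.wad k)
          else d 0 .idx
      | .qry k => if ∃ t, fl (.tok t) = true ∧ t.isList = true ∧ fl .gen = true then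
          d 0 (.a .cnt) else d 0 (.a (.tape k))
      | w => d 0 w)

/-- One step of the search for the last description of a cell. -/
def searchBlock (r : Fin B) : Block (Reg K Q A Γ B) (K + 1) :=
  mkBlock [] (fun _ => none)
    -- A match describes the required cell, agrees with the higher digits found so far and has digit
    -- `r` on. If there is none, position `0` returns an off digit.
    (fun k => eqVec (.qry k) (.wad k) ++
      (((List.finRange B).filter fun r' => r < r').map fun r' => (vreg (.fd k) r', vreg .idx r')) ++
      [(freg .one, vreg .idx r), (freg .one, freg .wr)])
    (fun k => fun
      | .inr (.fd k', r') => if k' = k ∧ r' = r then some (vreg .idx r) else none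
      | _ => none) <| localUpd r
    (fun fl d => fun
      -- Flags see one digit of the vectors per block, so the comparisons of counters are
      -- accumulated along with the search.
      | .thr => fl .thr && !d (.a .thr)
      | .at0 k => fl (.at0 k) && (d (.a (.tape k)) == ((r : ℕ) == 0))
      | .mk k => fl (.mk k) && (d (.a (.tape k)) == d (.a .cnt))
      | f => fl f)
    (fun _ _ d w => d 0 w)

/-- The object described by a family of tests. -/
noncomputable def decode {α : Type*} (p : α → Bool) : Option α :=
  if h : ∃ x, p x = true then some h.choose else none

lemma decode_eq {α : Type*} (o : Option α) : decode (fun x => decide (o = some x)) = o := by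
  unfold decode
  split_ifs with h
  · have := h.choose_spec
    rw [decide_eq_true_eq] at this
    exact this.symm
  · cases o with
    | none => rfl
    | some x => exact absurd ⟨x, by simp⟩ h

/-- The symbol on tape `k` is copied from the position that describes the cell. -/
def symbolSrc (k : Fin K) : Reg K Q A Γ B → Option (Reg K Q A Γ B)
  | .inl (.g k' c) => if k' = k then some (freg (.sy k c)) else none
  | _ => none

/-- The state is copied from the last position without list. -/
def stateSrc : Reg K Q A Γ B → Option (Reg K Q A Γ B)
  | .inl (.lq q) => some (freg (.st q))
  | _ => none

/-- Reading of the tapes and of the state, and choice of the next token. -/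
noncomputable def outputBlock [NeZero K] : Block (Reg K Q A Γ B) (K + 1) :=
  mkBlock (eqVec (.a .clk) .idx) stateSrc (fun k => eqVec (.fd k) .idx) symbolSrc <| localUpd 0
    (fun fl _ => fun
      | .out t => decide (∃ t₀, fl (.tok t₀) = true ∧ nextToken M t₀ (fl .thr) (fun k => fl (.at0 k))
          (fun k => fl (.mk k)) (fun k => decode fun c => fl (.g k c))
          (decode fun q => fl (.lq q)) = t)
      | f => fl f)
    (fun _ _ d w => d 0 w)

/-- The simulating program. -/
noncomputable def program [NeZero K] (hB : 0 < B) : List (Block (Reg K Q A Γ B) (K + 1)) :=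
  (List.range B).map indexBlock ++ ([amountBlock] ++
  ((List.range (2 * B)).map (fun _ => doublingBlock) ++ ([addressBlock M] ++
  -- The search runs from the most significant digit downwards.
  ((List.range B).map (fun m => searchBlock ⟨B - 1 - m, by omega⟩) ++ [outputBlock M]))))

lemma length_program [NeZero K] (hB : 0 < B) :
    (program M hB : List (Block (Reg K Q A Γ B) (K + 1))).length = 4 * B + 3 := by
  simp [program]; ring

lemma length_eqVec (w w' : Vec K) :
    (eqVec w w' : List (Reg K Q A Γ B × Reg K Q A Γ B)).length = B := by simp [eqVec]

/-- The registers that hold the positional embedding. -/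
def posReg : Fin B ↪ Reg K Q A Γ B := ⟨fun r => vreg .pos r, fun r r' h => by
  simpa using h⟩

@[simp]
lemma posReg_apply (r : Fin B) : (posReg r : Reg K Q A Γ B) = vreg .pos r := rfl

section WellFormed

variable [Fintype (Flag K Q A Γ)] [Fintype (Vec K)]

lemma wellFormed_mkBlock {dk dff : ℕ} {e₀ : List (Reg K Q A Γ B × Reg K Q A Γ B)}
    {s₀ : Reg K Q A Γ B → Option (Reg K Q A Γ B)}
    {e : Fin K → List (Reg K Q A Γ B × Reg K Q A Γ B)}
    {s : Fin K → Reg K Q A Γ B → Option (Reg K Q A Γ B)} {ρ : ℕ}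
    {uF : (Flag K Q A Γ → Bool) → (Vec K → Bool) → Flag K Q A Γ → Bool}
    {uW : ℕ → (Flag K Q A Γ → Bool) → (ℕ → Vec K → Bool) → Vec K → Bool}
    (he₀ : ∀ p ∈ e₀, p.1 ∉ Set.range posReg ∧ p.2 ∉ Set.range posReg ∧ p.2 ≠ freg .z)
    (he : ∀ k, ∀ p ∈ e k, p.1 ∉ Set.range posReg ∧ p.2 ∉ Set.range posReg ∧ p.2 ≠ freg .z)
    (hs₀ : ∀ t s, s₀ t = some s → t ∉ Set.range posReg ∧ s ∉ Set.range posReg)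
    (hs : ∀ k t s', s k t = some s' → t ∉ Set.range posReg ∧ s' ∉ Set.range posReg)
    (ha₀ : e₀ = [] → ∀ t, s₀ t = none) (ha : ∀ k, e k = [] → ∀ t, s k t = none)
    (hl₀ : 4 * e₀.length + 1 ≤ dk) (hl : ∀ k, 4 * (e k).length + 1 ≤ dk)
    (hpos : ∀ r fl d, uW r fl d .pos = d 0 .pos)
    (hdff : Fintype.card (Reg K Q A Γ B) *
      2 ^ (Fintype.card (Flag K Q A Γ) + Fintype.card (Vec K) * 3) ≤ dff) :
    (mkBlock e₀ s₀ e s (localUpd ρ uF uW)).WellFormed (Set.range posReg) (freg .z) dk dff where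
  eqs := Fin.cases he₀ he
  src := Fin.cases hs₀ hs
  active := Fin.cases ha₀ ha
  length := Fin.cases hl₀ hl
  local_upd := by
    obtain ⟨S, h1, h2, h3⟩ := local_localUpd (B := B) ρ uF uW
    exact ⟨S, h1, h2, h3.trans hdff⟩
  upd_sg := by
    intro x c hc
    obtain ⟨r, rfl⟩ := hc
    simp [mkBlock, localUpd, hpos, digit]

/-- The search has the largest lookups, with at most `2 * B + 2` equalities; four rows for each of
them and one more make `8 * B + 9`. -/
lemma wellFormed_program [NeZero K] (hB : 0 < B) {dk dff : ℕ} (hdk : 8 * B + 9 ≤ dk)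
    (hdff : Fintype.card (Reg K Q A Γ B) *
      2 ^ (Fintype.card (Flag K Q A Γ) + Fintype.card (Vec K) * 3) ≤ dff) :
    ∀ b ∈ (program M hB : List (Block (Reg K Q A Γ B) (K + 1))),
      b.WellFormed (Set.range posReg) (freg .z) dk dff := by
  have hlen : ∀ w w', 4 * (eqVec w w' : List (Reg K Q A Γ B × Reg K Q A Γ B)).length + 1 ≤ dk := by
    intro w w'; rw [length_eqVec]; omega
  have hne : ∀ w w', (eqVec w w' : List (Reg K Q A Γ B × Reg K Q A Γ B)) ≠ [] := by
    intro w w' h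
    have := length_eqVec (Q := Q) (A := A) (Γ := Γ) (B := B) w w'
    rw [h] at this; simp at this; omega
  have hvec : ∀ w w', w ≠ .pos → w' ≠ .pos → ∀ p ∈ (eqVec w w' :
      List (Reg K Q A Γ B × Reg K Q A Γ B)),
      p.1 ∉ Set.range posReg ∧ p.2 ∉ Set.range posReg ∧ p.2 ≠ freg .z := by
    intro w w' h h' p hp
    obtain ⟨r, -, rfl⟩ := List.mem_map.1 hp
    simp [h.symm, h'.symm]
  simp only [program, List.mem_append, List.mem_map, List.mem_singleton]
  rintro b (⟨r, -, rfl⟩ | rfl | ⟨_, -, rfl⟩ | rfl | ⟨m, -, rfl⟩ | rfl)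
  · exact wellFormed_mkBlock (by simp) (by simp) (by simp) (by simp) (by simp) (by simp)
      (by simp; omega) (by simp; omega) (by simp) hdff
  · refine wellFormed_mkBlock (by simp) (by simp) ?_ (by simp) (by simp)
      (by simp) (by simp; omega) (by simp; omega) (by simp) hdff
    rintro (f | ⟨w, r⟩) s hs
    · cases f <;> simp at hs
      subst hs; simp
    · simp at hs
  · refine wellFormed_mkBlock (hvec _ _ (by simp) (by simp)) (by simp) ?_ (by simp)
      (fun h => absurd h (hne _ _)) (by simp) (hlen _ _) (by simp; omega) (by simp) hdff
    rintro (f | ⟨w, r⟩) s hs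
    · simp at hs
    · cases w <;> simp at hs <;> subst hs <;> simp
  · refine wellFormed_mkBlock (hvec _ _ (by simp) (by simp)) (by simp) ?_ (by simp)
      (fun h => absurd h (hne _ _)) (by simp) (hlen _ _) (by simp; omega) (by simp) hdff
    rintro (f | ⟨w, r⟩) s hs
    · cases f <;> simp at hs
      subst hs; simp
    · cases w <;> simp at hs
      subst hs; simp
  · refine wellFormed_mkBlock (by simp) ?_ (by simp) ?_ (by simp) (by simp) (by simp; omega) ?_
      (by simp) hdff
    · intro k p hp
      simp only [List.mem_append, List.mem_map, List.mem_cons, List.not_mem_nil, or_false] at hp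
      rcases hp with (hp | ⟨r', -, rfl⟩) | rfl | rfl
      · exact hvec _ _ (by simp) (by simp) p hp
      all_goals simp
    · rintro k (f | ⟨w, r⟩) s hs
      · simp at hs
      · cases w <;> simp at hs
        obtain ⟨-, rfl⟩ := hs; simp
    · intro k
      have h1 : (List.filter (fun r' : Fin B => decide (⟨B - 1 - m, by omega⟩ < r'))
        (List.finRange B)).length ≤ B := (List.length_filter_le _ _).trans (by simp)
      simp only [List.length_append, length_eqVec, List.length_map, List.length_cons,
        List.length_nil]
      omega
  · refine wellFormed_mkBlock (hvec _ _ (by simp) (by simp)) (fun k => hvec _ _ (by simp) (by simp))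
      ?_ ?_ (fun h => absurd h (hne _ _)) (fun k h => absurd h (hne _ _)) (hlen _ _)
      (fun k => hlen _ _) (by simp) hdff
    · rintro (f | ⟨w, r⟩) s hs
      · cases f <;> simp [stateSrc] at hs
        subst hs; simp
      · simp [stateSrc] at hs
    · rintro k (f | ⟨w, r⟩) s hs
      · cases f <;> simp [symbolSrc] at hs
        obtain ⟨-, rfl⟩ := hs; simp
      · simp [symbolSrc] at hs

end WellFormed

end Program

end SCoT

namespace SCoT

open Classical

/-! ### Correctness of the program -/

section States

variable {K : ℕ} {Q A Γ : Type*} {B : ℕ} (M : TuringMachine K Q A Γ)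

/-- Contents of the registers at one position, apart from those that hold the token itself. -/
structure Snapshot (K : ℕ) (Q A Γ : Type*) where
  z : Bool := false
  gen : Bool := false
  wr : Bool := false
  thr : Bool := false
  -- Comparisons are conjunctions over the digits and start as true.
  at0 : Fin K → Bool := fun _ => true
  mark : Fin K → Bool := fun _ => true
  pst : Q → Bool := fun _ => false
  st : Q → Bool := fun _ => false
  lq : Q → Bool := fun _ => false
  g : Fin K → Γ → Bool := fun _ _ => false
  out : Token K Q A Γ → Bool := fun _ => false
  idx : ℕ → Bool := fun _ => false
  prv : ℕ → Bool := fun _ => false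
  ptr : ℕ → Bool := fun _ => false
  sum : Chan K → (ℕ → Bool) × (ℕ → Bool) := fun _ => zeroPair
  wad : Fin K → ℕ → Bool := fun _ _ => false
  qry : Fin K → ℕ → Bool := fun _ _ => false
  fd : Fin K → ℕ → Bool := fun _ _ => false

/-- The registers at position `i` with token `t`. -/
noncomputable def Snapshot.reg (s : Snapshot K Q A Γ) (t : Token K Q A Γ) (i : ℕ) :
    Reg K Q A Γ B → Bool
  | .inl f => match f with
    | .one => true
    | .z => s.z
    | .gen => s.gen
    | .tok t' => decide (t = t')
    | .isEnd => t.isEnd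
    | .wr => s.wr
    | .thr => s.thr
    | .at0 k => s.at0 k
    | .mk k => s.mark k
    | .sq q => decide (t.stored = some q)
    | .pst q => s.pst q
    | .st q => s.st q
    | .lq q => s.lq q
    | .sy k c => decide (t.written M k = some c)
    | .g k c => s.g k c
    | .out t' => s.out t'
  | .inr (w, r) => match w with
    | .pos => i.testBit r
    | .idx => s.idx r
    | .prv => s.prv r
    | .ptr => s.ptr r
    | .tptr => false
    | .a ch => (s.sum ch).1 r
    | .b ch => (s.sum ch).2 r
    | .ta _ => false
    | .tb _ => false
    | .wad k => s.wad k r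
    | .qry k => s.qry k r
    | .fd k => s.fd k r

/-- Initial contents of the registers, apart from the positional embedding. -/
noncomputable def initReg (t : Token K Q A Γ) : Reg K Q A Γ B → Bool :=
  Snapshot.reg M { z := true, thr := t.isRun } t 0

variable (τ : ℕ → Token K Q A Γ)

/-- After `m` digits of the position and of its predecessor have been computed. -/
noncomputable def indexState (m i : ℕ) : Reg K Q A Γ B → Bool :=
  Snapshot.reg M { z := decide (i % 2 ^ m = 0), thr := (τ i).isRun,
                   idx := fun r => decide (r < m) && i.testBit r
                   prv := fun r => decide (r < m) && (i.testBit r ^^ decide (i % 2 ^ r = 0)) }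
    (τ i) i

/-- After `l` rounds of pointer doubling. -/
noncomputable def sumState (l i : ℕ) : Snapshot K Q A Γ :=
  { z := decide (i = 0), thr := (τ i).isRun, gen := decide (gen τ i)
    idx := i.testBit, prv := (i - 1).testBit, ptr := (i - 2 ^ l).testBit
    sum := fun ch => partialSum τ ch l i }

/-- After `m` steps of the search for the last description of a cell. -/
noncomputable def searchState (B m i : ℕ) : Snapshot K Q A Γ :=
  { sumState τ (2 * B) i with
    wr := decide (Writes τ i)
    pst := fun q => decide ((τ (i - 1)).stored = some q)
    st := fun q => decide (stateAt M τ i = some q)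
    wad := fun k => (writeAddr B τ k i).testBit
    qry := fun k => (readAddr B τ k i).testBit
    fd := fun k r => decide (B - m ≤ r) && (lastWrite B τ k i).testBit r
    thr := (τ i).isRun && decide (∀ r < B, B - m ≤ r → (count B τ .thr i).testBit r = false)
    at0 := fun k => decide (∀ r < B, B - m ≤ r → (count B τ (.tape k) i).testBit r = (r == 0))
    mark := fun k => decide (∀ r < B, B - m ≤ r →
      (count B τ (.tape k) i).testBit r = (count B τ .cnt i).testBit r) }

/-- At the end. -/
noncomputable def finalState [NeZero K] (B i : ℕ) : Snapshot K Q A Γ :=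
  { searchState M τ B B i with
    g := fun k c => decide ((τ (lastWrite B τ k i)).written M k = some c)
    lq := fun q => decide (stateAt M τ (count B τ .clk i) = some q)
    out := fun t => decide (generated M B τ i = t) }

/-- The borrow reaches digit `r` exactly if all lower digits are zero. -/
lemma testBit_pred {i : ℕ} (hi : 0 < i) (r : ℕ) :
    (i - 1).testBit r = (i.testBit r ^^ decide (i % 2 ^ r = 0)) := by
  induction r generalizing i with
  | zero =>
    obtain ⟨n, rfl⟩ : ∃ n, i = n + 1 := ⟨i - 1, by omega⟩
    simp [Nat.testBit_zero, Nat.mod_one]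
    rcases Nat.mod_two_eq_zero_or_one n with h | h <;> simp [Nat.add_mod, h]
  | succ r ih =>
    rw [Nat.testBit_succ, Nat.testBit_succ]
    rcases Nat.mod_two_eq_zero_or_one i with h | h
    · have h1 : (i - 1) / 2 = i / 2 - 1 := by omega
      rw [h1, ih (by omega)]
      congr 2
      rw [pow_succ, mul_comm, Nat.mod_mul, h]
      simp
    · have h1 : (i - 1) / 2 = i / 2 := by omega
      have h2 : i % 2 ^ (r + 1) ≠ 0 := by
        rw [pow_succ, mul_comm, Nat.mod_mul, h]; omega
      rw [h1]; simp [h2]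

lemma mod_two_pow_succ_eq_zero (i r : ℕ) :
    i % 2 ^ (r + 1) = 0 ↔ i % 2 ^ r = 0 ∧ i.testBit r = false := by
  rw [pow_succ, Nat.mod_mul, Nat.testBit_eq_decide_div_mod_eq]
  have := Nat.mod_two_eq_zero_or_one (i / 2 ^ r)
  have h2 : 0 < 2 ^ r := by positivity
  rcases this with h | h <;> simp [h]

lemma matches_eqVec {w w' : Vec K} {X : ℕ → Reg K Q A Γ B → Bool} {i j : ℕ} :
    Matches (eqVec w w') X i j ↔ ∀ r, X i (vreg w r) = X j (vreg w' r) := by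
  simp [Matches, eqVec]

lemma matches_eqVec_testBit {w w' : Vec K} {X : ℕ → Reg K Q A Γ B → Bool} {i j m n : ℕ}
    (hm : m < 2 ^ B) (hn : n < 2 ^ B) (hw : ∀ r : Fin B, X i (vreg w r) = m.testBit r)
    (hw' : ∀ r : Fin B, X j (vreg w' r) = n.testBit r) : Matches (eqVec w w') X i j ↔ n = m := by
  rw [matches_eqVec]
  constructor
  · intro h
    refine eq_of_testBit_lt hn hm fun r hr => ?_
    have := h ⟨r, hr⟩
    rw [hw, hw'] at this
    exact this.symm
  · rintro rfl r
    rw [hw, hw']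

lemma digit_val {F W : Type*} (x : F ⊕ W × Fin B → Bool) (r : Fin B) (w : W) :
    digit x r w = x (.inr (w, r)) := by
  simp [digit]

/-- No lookup takes place in these blocks, so it does not matter that `z` singles out position `0`
only after all of them. -/
lemma step_indexBlock {N : ℕ} {m : ℕ} (hm : m < B) :
    (indexBlock m : Block (Reg K Q A Γ B) (K + 1)).Step (freg .one) (freg .z) N
      (indexState M τ m) (indexState M τ (m + 1)) := by
  refine step_mkBlock (fun i _ => rfl) (by simp) (by simp) (fun _ _ => false) (fun _ _ _ => false)
    (fun i _ => reads_none _ _ _) (fun i _ k => reads_none _ _ _) (by simp) (by simp) fun i _ => ?_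
  funext c
  simp only [Bool.false_eq_true, exists_false, decide_false, Bool.or_false]
  rcases c with f | ⟨w, r⟩
  · cases f <;> simp [localUpd, indexState, Snapshot.reg, digit, hm, mod_two_pow_succ_eq_zero]
  · by_cases hr : (r : ℕ) = m
    · subst hr
      cases w <;> simp [localUpd, indexState, Snapshot.reg, digit_val]
    · have : (r : ℕ) < m + 1 ↔ (r : ℕ) < m := by omega
      cases w <;> simp [localUpd, indexState, Snapshot.reg, digit_val, hr, this]

/-- The fallback at position `0` gives the answer "prompt not complete", which is where `h0` enters.
-/
lemma step_amountBlock (h0 : (τ 0).isEnd = false) :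
    (amountBlock : Block (Reg K Q A Γ B) (K + 1)).Step (freg .one) (freg .z) (2 ^ B)
      (indexState M τ B) (fun i => (sumState τ 0 i).reg M (τ i) i) := by
  refine step_mkBlock (fun i _ => rfl) (fun _ i hi => ⟨?_, ?_⟩) (by simp)
    (fun i c => decide (c = freg .gen) && decide (gen τ i)) (fun _ _ _ => false)
    (fun i _ => ?_) (fun i _ k => reads_none _ _ _) (fun i _ c => ?_) (by simp) fun i hi => ?_
  · simp [indexState, Snapshot.reg, Nat.mod_eq_of_lt hi]
  · simp [indexState, Snapshot.reg, h0]
  · have hm : ∀ j, Matches [(freg .one, freg .isEnd)]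
        (indexState M τ B : ℕ → Reg K Q A Γ B → Bool) i j ↔
        (τ j).isEnd = true := by
      intro j
      simp only [Matches, List.mem_singleton, forall_eq]
      exact eq_comm
    rintro (f | ⟨w, r⟩)
    · cases f with
      | gen =>
        refine ⟨fun h => by simp at h, fun s hs => ?_⟩
        simp only [Option.some.injEq] at hs
        subst hs
        constructor
        · intro j hj0 hj hj'
          have h1 : gen τ i := ⟨j, hj0, hj, (hm j).1 hj'⟩
          change (τ j).isEnd = _
          simp [(hm j).1 hj', h1]
        · intro hno
          have : ¬ gen τ i := fun ⟨j, hj0, hj, hj'⟩ => hno j hj0 hj ((hm j).2 hj')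
          change (τ 0).isEnd = _
          simp [h0, this]
      | _ => exact ⟨fun _ => by simp, fun s hs => by simp at hs⟩
    · simp
  · rcases c with f | ⟨w, r⟩
    · cases f <;> simp [indexState, Snapshot.reg]
    · simp
  · funext c
    rcases c with f | ⟨w, r⟩
    · cases f <;> simp [localUpd, indexState, sumState, Snapshot.reg, Nat.mod_eq_of_lt hi]
    · rcases Nat.eq_zero_or_pos i with rfl | hpos
      · cases w <;> simp [localUpd, indexState, sumState, Snapshot.reg, digit_val, partialSum,
          amountBits_zero, zeroPair]
      · cases w <;> simp [localUpd, indexState, sumState, Snapshot.reg, digit_val, partialSum,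
          amountBits, amountAt, zeroPair, Nat.mod_eq_of_lt hi, hpos.ne', testBit_pred hpos]

/-- The pointer holds `i - 2 ^ l`, so the lookup fetches the sum over the adjoining window together
with the next pointer. -/
lemma step_doublingBlock (l : ℕ) :
    (doublingBlock : Block (Reg K Q A Γ B) (K + 1)).Step (freg .one) (freg .z) (2 ^ B)
      (fun i => (sumState τ l i).reg M (τ i) i) (fun i => (sumState τ (l + 1) i).reg M (τ i) i) := by
  refine step_mkBlock (fun i _ => rfl) (fun _ i hi => ⟨?_, ?_⟩) (by simp)
    (fun i => copied _ ((sumState τ l (i - 2 ^ l)).reg M (τ (i - 2 ^ l)) (i - 2 ^ l)))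
    (fun _ _ _ => false)
    (fun i hi => reads_pointer _ (Nat.sub_le _ _) fun j h0 hj => ?_) (fun i _ k => reads_none _ _ _)
    (fun i _ c => ?_) (by simp) fun i hi => ?_
  · simp [sumState, Snapshot.reg]
  · intro p hp
    obtain ⟨r, -, rfl⟩ := List.mem_map.1 hp
    simp [sumState, Snapshot.reg]
  · exact matches_eqVec_testBit ((Nat.sub_le _ _).trans_lt hi) (hj.trans_lt hi) (fun r => rfl) (fun r => rfl)
  · rcases c with f | ⟨w, r⟩
    · simp [copied]
    · cases w <;> simp [copied, sumState, Snapshot.reg]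
  · funext c
    rcases c with f | ⟨w, r⟩
    · cases f <;> simp [localUpd, sumState, Snapshot.reg, copied]
    · cases w with
      | a ch =>
        -- Digits below the lowest one are read as false, in accordance with `shiftBits`.
        rcases r with ⟨_ | r, hr⟩
        · simp [localUpd, digit, sumState, Snapshot.reg, copied, partialSum, compress, shiftBits,
            hr, maj]
        · simp [localUpd, digit, sumState, Snapshot.reg, copied, partialSum, compress, shiftBits,
            hr, show r < B by omega]
      | b ch =>
        rcases r with ⟨_ | _ | r, hr⟩
        · simp [localUpd, sumState, Snapshot.reg, partialSum, compress, shiftBits, maj]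
        · simp [localUpd, digit, sumState, Snapshot.reg, copied, partialSum, compress, shiftBits,
            maj, show 0 < B by omega]
        · simp [localUpd, digit, sumState, Snapshot.reg, copied, partialSum, compress, shiftBits,
            show r + 1 < B by omega, show r < B by omega]
      | ptr => simp [localUpd, digit_val, sumState, Snapshot.reg, copied, pow_succ, mul_two,
          Nat.sub_sub]
      | _ => simp [localUpd, digit_val, sumState, Snapshot.reg, copied]

end States

end SCoT

namespace SCoT

open Classical

section Correctness

variable {K : ℕ} {Q A Γ : Type*} {B : ℕ} (M : TuringMachine K Q A Γ)
  (τ : ℕ → Token K Q A Γ)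

lemma step_addressBlock :
    (addressBlock M : Block (Reg K Q A Γ B) (K + 1)).Step (freg .one) (freg .z) (2 ^ B)
      (fun i => (sumState τ (2 * B) i).reg M (τ i) i)
      (fun i => (searchState M τ B 0 i).reg M (τ i) i) := by
  refine step_mkBlock (fun i _ => rfl) (fun _ i hi => ⟨?_, ?_⟩) (by simp)
    (fun i => copied _ ((sumState τ (2 * B) (i - 1)).reg M (τ (i - 1)) (i - 1)))
    (fun _ _ _ => false)
    (fun i hi => reads_pointer _ (Nat.sub_le _ _) fun j h0 hj => ?_) (fun i _ k => reads_none _ _ _)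
    (fun i _ c => ?_) (by simp) fun i hi => ?_
  · simp [sumState, Snapshot.reg]
  · intro p hp
    obtain ⟨r, -, rfl⟩ := List.mem_map.1 hp
    simp [sumState, Snapshot.reg]
  · exact matches_eqVec_testBit ((Nat.sub_le _ _).trans_lt hi) (hj.trans_lt hi) (fun r => rfl)
      (fun r => rfl)
  · rcases c with f | ⟨w, r⟩
    · cases f <;> simp [copied, sumState, Snapshot.reg]
    · cases w <;> simp [copied, sumState, Snapshot.reg]
  · have hi' : i - 1 < 2 ^ B := (Nat.sub_le _ _).trans_lt hi
    funext c
    rcases c with f | ⟨w, r⟩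
    · cases f with
      | wr =>
        simp [localUpd, sumState, searchState, Snapshot.reg, copied, Writes, Nat.pos_iff_ne_zero]
      | st q =>
        simp [localUpd, sumState, searchState, Snapshot.reg, copied, stateAt]
        split_ifs <;> rfl
      | _ =>
        simp +contextual [localUpd, sumState, searchState, Snapshot.reg,
          copied, Nat.not_le.2]
    · cases w with
      | wad k =>
        have h1 := partialSum_fst τ (.tape k) hi' r r.2
        simp only [localUpd, sumState, searchState, Snapshot.reg, copied, writeAddr]
        simp only [Nat.zero_le, and_self, if_true, Nat.sub_zero, digit_val]
        rcases Nat.eq_zero_or_pos i with rfl | hpos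
        · simp
        · simp only [hpos.ne', decide_false, if_false]
          by_cases hrun : (τ i).isRun = true
          · simp [hrun, h1, count]
          · simp [hrun]
      | qry k =>
        have h1 := partialSum_fst τ (.tape k) hi r r.2
        have h2 := partialSum_fst τ .cnt hi r r.2
        simp only [localUpd, sumState, searchState, Snapshot.reg, copied, readAddr]
        simp only [Nat.zero_le, and_self, if_true, Nat.sub_zero, digit_val]
        by_cases hl : (τ i).isList = true ∧ gen τ i
        · simp [hl, h2, count]
        · simp [hl, h1, count]
      | fd k =>
        have := r.2
        simp [localUpd, sumState, searchState, Snapshot.reg, digit_val, copied, Nat.not_le.2 this]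
      | _ => simp [localUpd, sumState, searchState, Snapshot.reg, digit_val, copied]

lemma forall_digit_succ {m : ℕ} (hm : m < B) (P : ℕ → Prop) :
    (∀ r < B, B - (m + 1) ≤ r → P r) ↔ (∀ r < B, B - m ≤ r → P r) ∧ P (B - 1 - m) := by
  constructor
  · exact fun h => ⟨fun r hr h' => h r hr (by omega), h _ (by omega) (by omega)⟩
  · rintro ⟨h1, h2⟩ r hr h'
    rcases Nat.lt_or_ge r (B - m) with h | h
    · have : r = B - 1 - m := by omega
      rwa [this]
    · exact h1 r hr h

lemma step_searchBlock {m : ℕ} (hm : m < B) :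
    (searchBlock ⟨B - 1 - m, by omega⟩ : Block (Reg K Q A Γ B) (K + 1)).Step
      (freg .one) (freg .z) (2 ^ B)
      (fun i => (searchState M τ B m i).reg M (τ i) i)
      (fun i => (searchState M τ B (m + 1) i).reg M (τ i) i) := by
  set ρ : Fin B := ⟨B - 1 - m, by omega⟩ with hρ
  have hρv : (ρ : ℕ) = B - 1 - m := rfl
  refine step_mkBlock (fun i _ => rfl) (by simp) (fun k _ i hi => ⟨?_, ?_⟩)
    (fun _ _ => false)
    (fun i k c => match c with
      | .inr (.fd k', r') => decide (k' = k ∧ r' = ρ) && (lastWrite B τ k i).testBit ρ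
      | _ => false)
    (fun i _ => reads_none _ _ _) (fun i hi k => ?_)
    (by simp) (fun i _ k c => ?_) fun i hi => ?_
  · simp [searchState, sumState, Snapshot.reg]
  · simp only [List.mem_append, List.mem_map, List.mem_cons, List.not_mem_nil, or_false, eqVec]
    rintro p ((⟨r, -, rfl⟩ | ⟨r, -, rfl⟩) | rfl | rfl) <;>
      simp [searchState, sumState, Snapshot.reg, writeAddr, Writes]
  -- Matching is made to coincide with the condition in `testBit_findGreatest`.
  · have hmatch : ∀ j ≤ i, Matches (eqVec (.qry k) (.wad k) ++
        (((List.finRange B).filter fun r' => ρ < r').map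
          fun r' => (vreg (.fd k) r', vreg .idx r')) ++
        [(freg .one, vreg .idx ρ), (freg .one, freg .wr)])
        (fun i => ((searchState M τ B m i).reg M (τ i) i : Reg K Q A Γ B → Bool)) i j ↔
        (Writes τ j ∧ writeAddr B τ k j = readAddr B τ k i) ∧ j.testBit ρ = true ∧
        ∀ r', (ρ : ℕ) < r' → r' < B → j.testBit r' = (lastWrite B τ k i).testBit r' := by
      intro j hj
      have h1 := matches_eqVec_testBit (B := B) (w := .qry k) (w' := .wad k)
        (X := fun i => ((searchState M τ B m i).reg M (τ i) i : Reg K Q A Γ B → Bool))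
        (i := i) (j := j) (readAddr_lt B τ k i) (writeAddr_lt B τ k (hj.trans_lt hi))
        (fun r => rfl) (fun r => rfl)
      rw [← h1]
      simp only [Matches, List.forall_mem_append, List.forall_mem_map, List.mem_filter,
        List.mem_finRange, true_and, List.forall_mem_cons, decide_eq_true_eq, List.not_mem_nil,
        false_implies, implies_true, and_true]
      have h2 : (∀ r' : Fin B, ρ < r' →
          ((searchState M τ B m i).reg M (τ i) i : Reg K Q A Γ B → Bool) (vreg (.fd k) r') =
          ((searchState M τ B m j).reg M (τ j) j : Reg K Q A Γ B → Bool) (vreg .idx r')) ↔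
          ∀ r', (ρ : ℕ) < r' → r' < B → j.testBit r' = (lastWrite B τ k i).testBit r' := by
        constructor
        · intro h r' h3 h4
          have := h ⟨r', h4⟩ (by simpa [Fin.lt_def] using h3)
          have h5 : B ≤ r' + m := by omega
          simp only [searchState, sumState, Snapshot.reg] at this
          rw [← this, decide_eq_true (by omega), Bool.true_and]
        · intro h r' h3
          have h3' : (ρ : ℕ) < r' := h3
          have h5 : B ≤ (r' : ℕ) + m := by omega
          simp only [searchState, sumState, Snapshot.reg]
          rw [h r' h3' r'.2, decide_eq_true (by omega), Bool.true_and]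
      rw [h2]
      simp only [Snapshot.reg, searchState, sumState, eq_comm (a := true), decide_eq_true_eq]
      tauto
    rintro (f | ⟨w, r'⟩)
    · simp
    · cases w with
      | fd k' =>
        dsimp only
        split_ifs with hk
        · obtain ⟨rfl, rfl⟩ := hk
          refine ⟨by simp, fun s hs => ?_⟩
          simp only [Option.some.injEq] at hs
          subst hs
          have h3 : (lastWrite B τ k' i).testBit ρ = true ↔ ∃ j, 0 < j ∧ j ≤ i ∧
              (Writes τ j ∧ writeAddr B τ k' j = readAddr B τ k' i) ∧ j.testBit ρ = true ∧
              ∀ r', (ρ : ℕ) < r' → r' < B → j.testBit r' = (lastWrite B τ k' i).testBit r' :=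
            testBit_findGreatest hi
              (fun j => Writes τ j ∧ writeAddr B τ k' j = readAddr B τ k' i) ρ
          constructor
          · intro j hj0 hj hj'
            have h4 := (hmatch j hj).1 hj'
            have h5 := h3.2 ⟨j, hj0, hj, h4.1, h4.2.1, h4.2.2⟩
            simp only [true_and, decide_true, Bool.true_and, h5]
            exact h4.2.1
          · intro hno
            have h5 : (lastWrite B τ k' i).testBit ρ = false := by
              rw [← Bool.not_eq_true, h3]
              rintro ⟨j, hj0, hj, h6, h7, h8⟩
              exact hno j hj0 hj ((hmatch j hj).2 ⟨h6, h7, h8⟩)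
            simp [h5, searchState, sumState, Snapshot.reg]
        · exact ⟨by simp [hk], by simp⟩
      | _ => simp
  · rcases c with f | ⟨w, r⟩
    · simp
    · cases w with
      | fd k' =>
        simp only [Bool.and_eq_true, decide_eq_true_eq]
        rintro ⟨⟨rfl, rfl⟩, h⟩
        refine ⟨?_, fun k'' h' => h'.1.1.symm⟩
        have : ¬ B ≤ B - 1 - m + m := by omega
        simp [searchState, Snapshot.reg, hρv, this]
      | _ => simp
  · funext c
    have hfst : ∀ ch, (partialSum τ ch (2 * B) i).1 ρ = (count B τ ch i).testBit ρ :=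
      fun ch => partialSum_fst τ ch hi ρ ρ.2
    rcases c with f | ⟨w, r⟩
    · cases f with
      | thr =>
        simp only [localUpd, digit_val, searchState, sumState, Snapshot.reg, hfst,
          forall_digit_succ hm, Bool.decide_and, ← hρv, beq_eq_decide, Bool.false_eq_true,
          exists_false, decide_false, Bool.or_false, Bool.and_assoc, Bool.decide_eq_false]
      | at0 k =>
        simp only [localUpd, digit_val, searchState, sumState, Snapshot.reg, hfst,
          forall_digit_succ hm, Bool.decide_and, ← hρv, beq_eq_decide, Bool.false_eq_true,
          exists_false, decide_false, Bool.or_false, Bool.and_assoc, Bool.decide_eq_false]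
      | mk k =>
        simp only [localUpd, digit_val, searchState, sumState, Snapshot.reg, hfst,
          forall_digit_succ hm, Bool.decide_and, ← hρv, beq_eq_decide, Bool.false_eq_true,
          exists_false, decide_false, Bool.or_false, Bool.and_assoc, Bool.decide_eq_false]
      | _ => simp [localUpd, searchState, sumState, Snapshot.reg]
    · simp only [localUpd, Nat.zero_le, and_self, if_true, Nat.sub_zero, digit_val]
      cases w with
      | fd k =>
        by_cases hr : r = ρ
        · have hrv : (r : ℕ) = B - 1 - m := by rw [hr]
          simp only [searchState, sumState, Snapshot.reg]
          rw [decide_eq_true (show B - (m + 1) ≤ (r : ℕ) by omega),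
            decide_eq_false (show ¬ B - m ≤ (r : ℕ) by omega)]
          simp [hr]
        · have hr' : (r : ℕ) ≠ B - 1 - m := fun h => hr (Fin.ext h)
          have h1 : B - (m + 1) ≤ (r : ℕ) ↔ B - m ≤ (r : ℕ) := by omega
          simp only [searchState, sumState, Snapshot.reg, hr, h1, and_false, decide_false,
            Bool.false_and, Bool.false_eq_true, exists_false, Bool.or_false]
      | _ =>
        simp only [Bool.false_eq_true, exists_false, decide_false, Bool.or_false]
        rfl

lemma step_outputBlock [NeZero K] (hB : 2 ≤ B) :
    (outputBlock M : Block (Reg K Q A Γ B) (K + 1)).Step (freg .one) (freg .z) (2 ^ B)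
      (fun i => (searchState M τ B B i).reg M (τ i) i)
      (fun i => (finalState M τ B i).reg M (τ i) i) := by
  refine step_mkBlock (fun i _ => rfl) (fun _ i hi => ⟨?_, ?_⟩) (fun k _ i hi => ⟨?_, ?_⟩)
    (fun i => copied _ ((searchState M τ B B (count B τ .clk i)).reg M (τ (count B τ .clk i))
      (count B τ .clk i)))
    (fun i k => copied _ ((searchState M τ B B (lastWrite B τ k i)).reg M
      (τ (lastWrite B τ k i)) (lastWrite B τ k i)))
    (fun i hi => reads_pointer _ (count_clk_le τ hB hi) fun j h0 hj => ?_)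
    (fun i hi k => reads_pointer _ (lastWrite_le B τ k i) fun j h0 hj => ?_)
    (fun i _ c => ?_) (fun i _ k c => ?_) fun i hi => ?_
  · simp [searchState, sumState, Snapshot.reg]
  · intro p hp
    obtain ⟨r, -, rfl⟩ := List.mem_map.1 hp
    simp [searchState, sumState, Snapshot.reg]
  · simp [searchState, sumState, Snapshot.reg]
  · intro p hp
    obtain ⟨r, -, rfl⟩ := List.mem_map.1 hp
    simp [searchState, sumState, Snapshot.reg]
  · exact matches_eqVec_testBit (count_lt _ _ _ _) (hj.trans_lt hi)
      (fun r => partialSum_fst τ .clk hi r r.2) (fun r => rfl)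
  · exact matches_eqVec_testBit ((lastWrite_le B τ k i).trans_lt hi) (hj.trans_lt hi)
      (fun r => by simp [searchState, Snapshot.reg]) (fun r => rfl)
  · rcases c with f | ⟨w, r⟩
    · cases f <;> simp [copied, stateSrc, symbolSrc, searchState, sumState, Snapshot.reg]
    · simp [copied, stateSrc]
  · rcases c with f | ⟨w, r⟩
    · cases f with
      | g k' c =>
        by_cases hk : k' = k
        · subst hk
          intro _
          refine ⟨rfl, fun k'' h => ?_⟩
          by_contra hne
          simp [copied, symbolSrc, Ne.symm hne] at h
        · simp [copied, symbolSrc, hk]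
      | _ => simp [copied, symbolSrc]
    · simp [copied, symbolSrc]
  · have hmid : (fun c => ((searchState M τ B B i).reg M (τ i) i : Reg K Q A Γ B → Bool) c ||
        (copied stateSrc ((searchState M τ B B (count B τ .clk i)).reg M (τ (count B τ .clk i))
          (count B τ .clk i)) c ||
        decide (∃ k, copied (symbolSrc k) ((searchState M τ B B (lastWrite B τ k i)).reg M
          (τ (lastWrite B τ k i)) (lastWrite B τ k i)) c = true))) =
        Snapshot.reg M { searchState M τ B B i with
          g := fun k c => decide ((τ (lastWrite B τ k i)).written M k = some c)
          lq := fun q => decide (stateAt M τ (count B τ .clk i) = some q) } (τ i) i := by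
      funext c
      rcases c with f | ⟨w, r⟩
      · cases f with
        | g k c =>
          have hg : (∃ k', copied (symbolSrc k')
              ((searchState M τ B B (lastWrite B τ k' i)).reg M (τ (lastWrite B τ k' i))
              (lastWrite B τ k' i) : Reg K Q A Γ B → Bool) (.inl (.g k c)) = true) ↔
              (τ (lastWrite B τ k i)).written M k = some c := by
            constructor
            · rintro ⟨k', h⟩
              by_cases hk : k = k'
              · subst hk
                simpa [copied, symbolSrc, Snapshot.reg] using h
              · simp [copied, symbolSrc, hk] at h
            · exact fun h => ⟨k, by simpa [copied, symbolSrc, Snapshot.reg] using h⟩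
          simp only [hg]
          simp [copied, stateSrc, searchState, sumState, Snapshot.reg]
        | lq q => simp [copied, stateSrc, symbolSrc, searchState, sumState, Snapshot.reg]
        | _ => simp [copied, stateSrc, symbolSrc, Snapshot.reg]
      · simp [copied, stateSrc, symbolSrc, Snapshot.reg]
    rw [hmid]
    -- After all `B` digits the accumulated comparisons are equalities of numbers below `2 ^ B`.
    have hthr : (searchState M τ B B i).thr =
        decide ((τ i).isRun = true ∧ count B τ .thr i = 0) := by
      have : (∀ r < B, B - B ≤ r → (count B τ .thr i).testBit r = false) ↔
          count B τ .thr i = 0 := by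
        constructor
        · exact fun h => eq_of_testBit_lt (count_lt _ _ _ _) (by positivity)
            fun r hr => by simpa using h r hr (by omega)
        · intro h; simp [h]
      simp only [searchState, this, Bool.decide_and, Bool.decide_eq_true]
    have hat0 : (searchState M τ B B i).at0 =
        fun k => decide (count B τ (.tape k) i = 1) := by
      funext k
      have : (∀ r < B, B - B ≤ r → (count B τ (.tape k) i).testBit r = (r == 0)) ↔
          count B τ (.tape k) i = 1 := by
        have h1 : ∀ r, (1 : ℕ).testBit r = (r == 0) := fun r => by
          cases r <;> simp [Nat.testBit_succ]
        constructor
        · exact fun h => eq_of_testBit_lt (count_lt _ _ _ _)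
            (Nat.one_lt_two_pow (by omega)) fun r hr => by rw [h r hr (by omega), h1]
        · intro h; simp [h, h1]
      simp only [searchState, this]
    have hmk : (searchState M τ B B i).mark =
        fun k => decide (count B τ (.tape k) i = count B τ .cnt i) := by
      funext k
      have : (∀ r < B, B - B ≤ r → (count B τ (.tape k) i).testBit r =
          (count B τ .cnt i).testBit r) ↔ count B τ (.tape k) i = count B τ .cnt i := by
        constructor
        · exact fun h => eq_of_testBit_lt (count_lt _ _ _ _) (count_lt _ _ _ _)
            fun r hr => h r hr (by omega)
        · intro h; simp [h]
      simp only [searchState, this]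
    funext c
    rcases c with f | ⟨w, r⟩
    · cases f with
      | out t =>
        simp only [localUpd, Snapshot.reg, finalState, hthr, hat0, hmk, decode_eq,
          decide_eq_true_eq, exists_eq_left', generated]
        congr!
      | _ => rfl
    · simp only [localUpd, Nat.zero_le, and_self, if_true, Nat.sub_zero, digit_val]
      rfl

/-- The program computes the generated token. -/
lemma steps_program [NeZero K] (hB : 2 ≤ B) (h0 : (τ 0).isEnd = false) :
    Block.Steps (freg .one) (freg .z) (2 ^ B) (program M (by omega))
      (indexState M τ 0 : ℕ → Reg K Q A Γ B → Bool)
      (fun i => (finalState M τ B i).reg M (τ i) i) := by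
  refine (Block.steps_range indexBlock (fun m => indexState M τ m) B
    fun r hr => step_indexBlock M τ hr).append ?_
  refine Block.Steps.append ⟨_, step_amountBlock M τ h0, rfl⟩ ?_
  refine (Block.steps_range (fun _ => doublingBlock)
    (fun l i => (sumState τ l i).reg M (τ i) i) (2 * B)
    fun r hr => step_doublingBlock M τ r).append ?_
  refine Block.Steps.append ⟨_, step_addressBlock M τ, rfl⟩ ?_
  refine (Block.steps_range _
    (fun m i => (searchState M τ B m i).reg M (τ i) i) B
    fun m hm => step_searchBlock M τ hm).append ?_
  exact ⟨_, step_outputBlock M τ hB, rfl⟩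

end Correctness

end SCoT

namespace SCoT

open Classical

/-! ### Finiteness of the sets of register names. -/

section Finiteness

variable {K : ℕ} {Q A Γ : Type*}

lemma finite_move : Finite Move :=
  Finite.of_injective (β := Fin 3) (fun
    | .left => 0
    | .stay => 1
    | .right => 2) (by rintro (_ | _ | _) (_ | _ | _) h <;> simp at h <;> rfl)

lemma finite_token [Finite Q] [Finite A] [Finite Γ] : Finite (Token K Q A Γ) := by
  have := finite_move
  refine Finite.of_injective (β := Fin 8 ⊕ (Q × (Fin K → Γ) × (Fin K → Move)) ⊕ (Fin K → Bool) ⊕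
    A ⊕ (Fin K → Γ × Bool) ⊕ Q) (fun
    | .inp => .inl 0
    | .endInp => .inl 1
    | .outp => .inl 2
    | .endOutp => .inl 3
    | .pos => .inl 4
    | .endPos => .inl 5
    | .summ => .inl 6
    | .endSumm => .inl 7
    | .runTok q y m => .inr (.inl (q, y, m))
    | .posTok b => .inr (.inr (.inl b))
    | .sym a => .inr (.inr (.inr (.inl a)))
    | .tapeTok c => .inr (.inr (.inr (.inr (.inl c))))
    | .stateTok q => .inr (.inr (.inr (.inr (.inr q))))) ?_
  intro t t' h
  cases t <;> cases t' <;> simp_all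

lemma finite_chan : Finite (Chan K) := by
  refine Finite.of_injective (β := Fin K ⊕ Fin 3) (fun
    | .tape k => .inl k
    | .cnt => .inr 0
    | .thr => .inr 1
    | .clk => .inr 2) ?_
  intro t t' h
  cases t <;> cases t' <;> simp_all

lemma finite_vec : Finite (Vec K) := by
  have : Finite (Chan K) := finite_chan
  refine Finite.of_injective (β := Fin 5 ⊕ (Fin 4 × Chan K) ⊕ Fin 3 × Fin K) (fun
    | .pos => .inl 0
    | .idx => .inl 1
    | .prv => .inl 2
    | .ptr => .inl 3
    | .tptr => .inl 4
    | .a c => .inr (.inl (0, c))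
    | .b c => .inr (.inl (1, c))
    | .ta c => .inr (.inl (2, c))
    | .tb c => .inr (.inl (3, c))
    | .wad k => .inr (.inr (0, k))
    | .qry k => .inr (.inr (1, k))
    | .fd k => .inr (.inr (2, k))) ?_
  intro t t' h
  cases t <;> cases t' <;> simp_all

lemma finite_flag [Finite Q] [Finite A] [Finite Γ] : Finite (Flag K Q A Γ) := by
  have : Finite (Token K Q A Γ) := finite_token
  refine Finite.of_injective (β := Fin 6 ⊕ (Fin 2 × Token K Q A Γ) ⊕ (Fin 2 × Fin K) ⊕
    (Fin 4 × Q) ⊕ Fin 2 × Fin K × Γ) (fun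
    | .one => .inl 0
    | .z => .inl 1
    | .gen => .inl 2
    | .isEnd => .inl 3
    | .wr => .inl 4
    | .thr => .inl 5
    | .tok t => .inr (.inl (0, t))
    | .out t => .inr (.inl (1, t))
    | .at0 k => .inr (.inr (.inl (0, k)))
    | .mk k => .inr (.inr (.inl (1, k)))
    | .sq q => .inr (.inr (.inr (.inl (0, q))))
    | .pst q => .inr (.inr (.inr (.inl (1, q))))
    | .st q => .inr (.inr (.inr (.inl (2, q))))
    | .lq q => .inr (.inr (.inr (.inl (3, q))))
    | .sy k c => .inr (.inr (.inr (.inr (0, k, c))))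
    | .g k c => .inr (.inr (.inr (.inr (1, k, c))))) ?_
  intro t t' h
  cases t <;> cases t' <;> simp_all

end Finiteness

/-- A transformer with ternary weights and activations that generates the tokens of the
simulation. -/
lemma exists_simulator {K : ℕ} [NeZero K] {Q A Γ : Type*} [Finite Q] [Finite A] [Finite Γ]
    (M : TuringMachine K Q A Γ) : ∃ c : ℕ, ∀ B, 2 ≤ B →
    ∃ (d dff L : ℕ) (T : Transformer d dff (8 * B + 9) d (K + 1) L (Token K Q A Γ)),
      d ≤ c * B ∧ dff ≤ c * B ∧ L = 4 * B + 3 ∧ T.TernaryWeights ∧ T.posDim = B ∧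
      ∀ τ : ℕ → Token K Q A Γ, (τ 0).isEnd = false → ∀ n ≤ 2 ^ B,
        T.TernaryActivations ((List.range n).map τ) ∧
        (0 < n → T.Outputs ((List.range n).map τ) (generated M B τ (n - 1))) := by
  have : Finite (Flag K Q A Γ) := finite_flag
  have : Finite (Vec K) := finite_vec
  have : Fintype (Flag K Q A Γ) := Fintype.ofFinite _
  have : Fintype (Vec K) := Fintype.ofFinite _
  set F := Fintype.card (Flag K Q A Γ)
  set W := Fintype.card (Vec K)
  -- There are `F + W * B ≤ (F + W) * B` registers, with at most `2 ^ (F + W * 3)` gates for each.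
  refine ⟨(F + W) * 2 ^ (F + W * 3), fun B hB => ?_⟩
  have hd : Fintype.card (Reg K Q A Γ B) ≤ (F + W) * B := by
    rw [Fintype.card_sum, Fintype.card_prod, Fintype.card_fin, add_mul]
    exact Nat.add_le_add_right (Nat.le_mul_of_pos_right _ (by omega)) _
  let res : Token K Q A Γ ↪ Reg K Q A Γ B := ⟨fun t => .inl (.out t), fun t t' h => by simpa using h⟩
  obtain ⟨T, hT1, hT2, hT3⟩ := Block.exists_transformer (one := freg .one) (z := freg .z)
    (dk := 8 * B + 9) (dff := Fintype.card (Reg K Q A Γ B) * 2 ^ (F + W * 3)) posReg (initReg M)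
    res (program M (show 0 < B by omega)) (by simp) (by simp) (by simp [res])
    (wellFormed_program M _ le_rfl le_rfl)
  refine ⟨_, _, _, T, ?_, ?_, length_program M _, hT1, hT2, fun τ h0 n hn => ?_⟩
  · refine hd.trans (Nat.mul_le_mul_right _ (Nat.le_mul_of_pos_right _ (by positivity)))
  · rw [mul_right_comm]
    exact Nat.mul_le_mul_right _ hd
  · obtain ⟨h1, h2⟩ := hT3 (2 ^ B) ((List.range n).map τ) _ _ (by simpa using hn)
      (steps_program M τ hB h0) (by
        intro i hi c hc
        simp only [List.getElem_map, List.getElem_range]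
        rcases c with f | ⟨w, r⟩
        · cases f <;> simp [indexState, initReg, Snapshot.reg, Nat.mod_one]
        · cases w with
          | pos => exact absurd ⟨r, rfl⟩ hc
          | _ => simp [indexState, initReg, Snapshot.reg]) (fun i _ r => rfl)
    refine ⟨h1, fun hpos => ⟨⟨n - 1, by simp; omega⟩, by simp; omega, fun t ht => ?_⟩⟩
    have h3 : ∀ v, (Snapshot.reg M (finalState M τ B (n - 1)) (τ (n - 1)) (n - 1) :
        Reg K Q A Γ B → Bool) (res v) = decide (generated M B τ (n - 1) = v) := fun v => rfl
    rw [h2, h2, h3, h3]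
    simp [ht.symm]

end SCoT

namespace SCoT

open Classical

/-! ### Segments of the simulation -/

section Segments

variable {K : ℕ} {Q A Γ : Type*} (M : TuringMachine K Q A Γ) {B : ℕ} {τ : ℕ → Token K Q A Γ}

/-- The run token of the next step of the machine. -/
def runToken (c : Config K Q Γ) : Token K Q A Γ :=
  let r := M.δ c.state fun k => c.tape k (c.head k)
  .runTok r.1 r.2.1 fun k => match r.2.2 k with
    | .left => if c.head k = 0 then .stay else .left
    | m => m

/-- The token that describes cell `l` of all tapes. -/
def cellToken (c : Config K Q Γ) (l : ℕ) : Token K Q A Γ :=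
  .tapeTok fun k => (c.tape k l, decide (c.head k = l))

variable (B τ) in
/-- The positions `0, …, e` hold a description of the configuration `c` with `S` cells. -/
structure IsPrompt (e S : ℕ) (c : Config K Q Γ) : Prop where
  lt : S < e
  le : e ≤ S + 2
  -- A search without result ends at position `0`, which must not supply a symbol.
  start : ∀ k, (τ 0).written M k = none
  isEnd : (τ e).isEnd = true
  inner : ∀ j < e, (τ j).isEnd = false ∧ (τ j).isRun = false
  cell : ∀ j, 0 < j → j ≤ S → (τ j).isCell = true ∧
    ∀ k, (τ j).written M k = some (c.tape k (j - 1))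
  rest : ∀ j, S < j → j ≤ e → (τ j).isCell = false
  tape : ∀ k, counter τ B (.tape k) e = ((c.head k + 1 : ℕ) : ZMod (2 ^ B))
  -- Not strict: on empty input `S` is `0` and the heads are on cell `0`.
  head : ∀ k, c.head k ≤ S
  blank : ∀ k l, S ≤ l → c.tape k l = M.blank
  state : stateAt M τ e = some c.state

variable (τ) in
/-- After position `e` there are the tokens of `r` steps of the machine. -/
structure IsRun (e r : ℕ) (c : ℕ → Config K Q Γ) : Prop where
  step : ∀ m, c (m + 1) = M.step (c m)
  tok : ∀ m < r, τ (e + (m + 1)) = runToken M (c m)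

lemma counter_succ (hB : 2 ≤ B) (ch : Chan K) {i : ℕ} (hi : i + 1 < 2 ^ B) :
    counter τ B ch (i + 1) = counter τ B ch i +
      match amount ch (τ (i + 1)) (decide (gen τ (i + 1))) with
      | .zero => 0
      | .one => 1
      | .two => 2
      | .neg => -1
      | .index => ((i + 1 : ℕ) : ZMod (2 ^ B)) := by
  have h := bitsVal_amountBits τ ch hi hB
  rw [amountAt, if_neg (Nat.succ_ne_zero i)] at h
  refine (Finset.sum_Ioc_succ_top (Nat.zero_le i) _).trans (congrArg _ (h.trans ?_))
  cases amount ch (τ (i + 1)) (decide (gen τ (i + 1))) <;> rfl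

lemma count_eq {ch : Chan K} {i n : ℕ} (h : counter τ B ch i = (n : ZMod (2 ^ B)))
    (hn : n < 2 ^ B) : count B τ ch i = n := by
  rw [count, h, ZMod.val_natCast_of_lt hn]

lemma head_step_le (c : Config K Q Γ) (k : Fin K) : (M.step c).head k ≤ c.head k + 1 := by
  simp only [TuringMachine.step]
  cases ((M.δ c.state fun k => c.tape k (c.head k)).2.2 k) <;> simp [Move.apply]; omega

lemma head_le {c : ℕ → Config K Q Γ} (hc : ∀ m, c (m + 1) = M.step (c m)) (k : Fin K) (m : ℕ) :
    (c m).head k ≤ (c 0).head k + m := by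
  induction m with
  | zero => rfl
  | succ m ih =>
    rw [hc]
    have := head_step_le M (c m) k
    omega

/-- Heads do not jump over cells. -/
lemma exists_head_eq {c : ℕ → Config K Q Γ} (hc : ∀ m, c (m + 1) = M.step (c m)) (k : Fin K)
    {l : ℕ} (h0 : (c 0).head k ≤ l) {m : ℕ} (h : l ≤ (c m).head k) :
    ∃ m' ≤ m, (c m').head k = l := by
  induction m with
  | zero => exact ⟨0, le_rfl, le_antisymm h0 h⟩
  | succ m ih =>
    by_cases hl : l ≤ (c m).head k
    · obtain ⟨m', hm', h'⟩ := ih hl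
      exact ⟨m', by omega, h'⟩
    · refine ⟨m + 1, le_rfl, le_antisymm ?_ h⟩
      rw [hc]
      have := head_step_le M (c m) k
      omega

namespace IsPrompt

variable {M} {e S : ℕ} {c : Config K Q Γ} (hP : IsPrompt M B τ e S c)
include hP

lemma not_gen {j : ℕ} (hj : j < e) : ¬ gen τ j := by
  rintro ⟨j', -, hj', h⟩
  simp [(hP.inner j' (by omega)).1] at h

lemma gen_of_le {j : ℕ} (hj : e ≤ j) : gen τ j := ⟨e, by have := hP.lt; omega, hj, hP.isEnd⟩

lemma writes_iff {j : ℕ} (hj : j ≤ e) : Writes τ j ↔ 0 < j ∧ j ≤ S := by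
  have hend := hP.isEnd
  have hrun : (τ j).isRun = false := by
    rcases hj.eq_or_lt with rfl | hj
    · cases h : τ j <;> simp_all [Token.isEnd, Token.isRun]
    · exact (hP.inner j hj).2
  simp only [Writes, hrun]
  constructor
  · rintro ⟨h0, h | ⟨h1, h2⟩⟩
    · simp at h
    · refine ⟨h0, not_lt.1 fun h3 => ?_⟩
      simp [hP.rest j h3 hj] at h1
  · rintro ⟨h0, h1⟩
    exact ⟨h0, .inr ⟨(hP.cell j h0 h1).1, hP.not_gen (by have := hP.lt; omega)⟩⟩

lemma writeAddr_eq {j : ℕ} (k : Fin K) (hj : j ≤ S) : writeAddr B τ k j = j := by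
  have := (hP.inner j (by have := hP.lt; omega)).2
  unfold writeAddr
  split_ifs <;> simp_all

lemma counter_inner (hB : 2 ≤ B) (he : e < 2 ^ B) {j : ℕ} (hj : j < e) :
    counter τ B .cnt j = 0 ∧ counter τ B .thr j = j ∧ counter τ B .clk j = j := by
  induction j with
  | zero => simp [counter]
  | succ j ih =>
    obtain ⟨h1, h2, h3⟩ := ih (by omega)
    obtain ⟨h4, h5⟩ := hP.inner _ hj
    have h6 := hP.not_gen hj
    simp only [counter_succ hB _ (show j + 1 < 2 ^ B by omega), h1, h2, h3, amount, h4, h5, h6]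
    simp

lemma counter_end (hB : 2 ≤ B) (he : e < 2 ^ B) :
    counter τ B .cnt e = 0 ∧ counter τ B .thr e = ((e + 1 : ℕ) : ZMod (2 ^ B)) ∧
      counter τ B .clk e = e := by
  obtain ⟨e, rfl⟩ : ∃ e', e = e' + 1 := ⟨e - 1, by have := hP.lt; omega⟩
  obtain ⟨h1, h2, h3⟩ := hP.counter_inner hB he (Nat.lt_succ_self e)
  have hend := hP.isEnd
  have h4 : (τ (e + 1)).isRun = false ∧ (τ (e + 1)).isList = false := by
    cases h : τ (e + 1) <;> simp_all [Token.isEnd, Token.isRun, Token.isList]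
  simp only [counter_succ hB _ he, h1, h2, h3, amount, h4.1, h4.2, hend, hP.gen_of_le le_rfl]
  push_cast
  simp
  ring

end IsPrompt

section Run

variable {M} {e S r : ℕ} {c : ℕ → Config K Q Γ}

/-- Run tokens carry true displacements (a left move on cell `0` appears as `stay`), so adding them
up modulo `2 ^ B` follows the heads exactly. -/
lemma counter_run (hP : IsPrompt M B τ e S (c 0)) (hR : IsRun M τ e r c) (hB : 2 ≤ B)
    (hN : e + r < 2 ^ B) {m : ℕ} (hm : m ≤ r) :
    (∀ k, counter τ B (.tape k) (e + m) = (((c m).head k + 1 : ℕ) : ZMod (2 ^ B))) ∧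
    counter τ B .cnt (e + m) = 0 ∧
    counter τ B .thr (e + m) + m = ((e + 1 : ℕ) : ZMod (2 ^ B)) ∧
    counter τ B .clk (e + m) = ((e + m : ℕ) : ZMod (2 ^ B)) := by
  induction m with
  | zero =>
    obtain ⟨h1, h2, h3⟩ := hP.counter_end hB (by omega)
    exact ⟨hP.tape, h1, by simpa using h2, h3⟩
  | succ m ih =>
    obtain ⟨h0, h1, h2, h3⟩ := ih (by omega)
    have hg := hP.gen_of_le (show e ≤ e + m + 1 by omega)
    have ht := hR.tok m (by omega)
    rw [← add_assoc] at ht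
    simp only [← add_assoc, counter_succ hB _ (show e + m + 1 < 2 ^ B by omega), h0, h1, h3, ht]
    refine ⟨fun k => ?_, ?_, ?_, ?_⟩
    · rw [hR.step]
      simp only [amount, runToken, TuringMachine.step]
      cases (M.δ (c m).state fun k => (c m).tape k ((c m).head k)).2.2 k with
      | left =>
        simp only [Move.apply]
        split_ifs with h
        · simp [h]
        · obtain ⟨n, hn⟩ := Nat.exists_eq_succ_of_ne_zero h
          simp [hn]
      | stay => simp [Move.apply]
      | right => simp [Move.apply]
    · simp [amount, runToken, Token.isList]
    · simp only [amount, runToken, Token.isRun, if_true]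
      rw [← h2]; push_cast; ring
    · simp [amount, runToken, Token.isList, hg]

lemma head_lt (hP : IsPrompt M B τ e S (c 0)) (hR : IsRun M τ e r c) (m : ℕ) (k : Fin K) :
    (c m).head k < e + m := by
  have h1 := hP.head k
  have h2 := hP.lt
  have h3 := head_le M hR.step k m
  omega

lemma count_tape_run (hP : IsPrompt M B τ e S (c 0)) (hR : IsRun M τ e r c) (hB : 2 ≤ B)
    (hN : e + r < 2 ^ B) {m : ℕ} (hm : m ≤ r) (k : Fin K) :
    count B τ (.tape k) (e + m) = (c m).head k + 1 :=
  count_eq ((counter_run hP hR hB hN hm).1 k) (by have := head_lt hP hR m k; omega)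

lemma count_thr_run (hP : IsPrompt M B τ e S (c 0)) (hR : IsRun M τ e r c) (hB : 2 ≤ B)
    (hN : e + r < 2 ^ B) {m : ℕ} (hm : m ≤ r) (hre : r ≤ e + 1) (h0 : e + 1 < 2 ^ B) :
    count B τ .thr (e + m) = e + 1 - m := by
  refine count_eq ?_ (by omega)
  rw [Nat.cast_sub (by omega)]
  exact eq_sub_of_add_eq (counter_run hP hR hB hN hm).2.2.1

/-- The cell `l` of tape `k` has been described in a prompt with `S` cells or in `m` steps. -/
def Seen (c : ℕ → Config K Q Γ) (S m : ℕ) (k : Fin K) (l : ℕ) : Prop :=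
  l < S ∨ ∃ m' < m, (c m').head k = l

lemma tape_eq_blank (hc : ∀ m, c (m + 1) = M.step (c m)) {k : Fin K}
    (h0 : ∀ l, S ≤ l → (c 0).tape k l = M.blank) {m l : ℕ} (h : ¬ Seen c S m k l) :
    (c m).tape k l = M.blank := by
  induction m with
  | zero => exact h0 l (not_lt.1 fun h' => h (.inl h'))
  | succ m ih =>
    rw [hc]
    refine (if_neg fun h' => h (.inr ⟨m, Nat.lt_succ_self m, h'.symm⟩)).trans (ih fun h' => h ?_)
    exact h'.imp id fun ⟨m', h1, h2⟩ => ⟨m', by omega, h2⟩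

/-- A run token is addressed by the head position before its move, so it supersedes the earlier
descriptions of just the cell that the step rewrites. The shift in `l + 1` is the position of cell
`l` in a prompt. -/
lemma written_run (hP : IsPrompt M B τ e S (c 0)) (hR : IsRun M τ e r c) (hB : 2 ≤ B)
    (hN : e + r < 2 ^ B) (k : Fin K) (l : ℕ) {m : ℕ} (hm : m ≤ r) :
    (τ (Nat.findGreatest (fun j => Writes τ j ∧ writeAddr B τ k j = l + 1) (e + m))).written M k =
      if Seen c S m k l then some ((c m).tape k l) else none := by
  induction m with
  | zero =>
    have hlt := hP.lt
    by_cases hl : l < S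
    · have h1 : Nat.findGreatest (fun j => Writes τ j ∧ writeAddr B τ k j = l + 1) (e + 0) =
          l + 1 := by
        rw [add_zero, Nat.findGreatest_eq_iff]
        refine ⟨by omega, fun _ => ⟨(hP.writes_iff (by omega)).2 ⟨by omega, hl⟩,
          hP.writeAddr_eq k hl⟩, fun n h1 h2 h3 => ?_⟩
        have h4 := ((hP.writes_iff h2).1 h3.1).2
        have h5 := h3.2
        rw [hP.writeAddr_eq k h4] at h5
        omega
      rw [h1, (hP.cell (l + 1) (by omega) hl).2, if_pos (.inl hl)]
      simp
    · have h1 : Nat.findGreatest (fun j => Writes τ j ∧ writeAddr B τ k j = l + 1) (e + 0) = 0 := by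
        rw [add_zero, Nat.findGreatest_eq_zero_iff]
        intro n h1 h2 h3
        have h4 := ((hP.writes_iff h2).1 h3.1).2
        have h5 := h3.2
        rw [hP.writeAddr_eq k h4] at h5
        omega
      rw [h1, hP.start, if_neg]
      rintro (h | ⟨m', h, -⟩)
      · exact hl h
      · omega
  | succ m ih =>
    have h1 := ih (by omega)
    have ht := hR.tok m (by omega)
    have hw : Writes τ (e + m + 1) ∧ writeAddr B τ k (e + m + 1) = l + 1 ↔ (c m).head k = l := by
      have h3 : (τ (e + m + 1)).isRun = true := by rw [add_assoc, ht]; rfl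
      have h4 := count_tape_run hP hR hB hN (show m ≤ r by omega) k
      simp only [Writes, writeAddr, h3, if_true, Nat.add_sub_cancel, h4]
      simp
    have hs : Seen c S (m + 1) k l ↔ (c m).head k = l ∨ Seen c S m k l := by
      simp only [Seen, Nat.lt_succ_iff_lt_or_eq, or_and_right, exists_or, exists_eq_left]
      rw [← or_assoc, or_comm]
    have ht2 : (c (m + 1)).tape k l = if l = (c m).head k then
        (M.δ (c m).state fun k => (c m).tape k ((c m).head k)).2.1 k else (c m).tape k l := by
      rw [hR.step]; rfl
    rw [← add_assoc, Nat.findGreatest_succ, ht2]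
    by_cases h : (c m).head k = l
    · rw [if_pos (hw.2 h), if_pos (hs.2 (.inl h)), if_pos h.symm, add_assoc, ht]
      rfl
    · rw [if_neg (mt hw.1 h), if_neg (Ne.symm h), h1]
      simp only [hs, h, false_or]

lemma getD_written_run (hP : IsPrompt M B τ e S (c 0)) (hR : IsRun M τ e r c) (hB : 2 ≤ B)
    (hN : e + r < 2 ^ B) (k : Fin K) (l : ℕ) {m : ℕ} (hm : m ≤ r) :
    ((τ (Nat.findGreatest (fun j => Writes τ j ∧ writeAddr B τ k j = l + 1) (e + m))).written
      M k).getD M.blank = (c m).tape k l := by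
  rw [written_run hP hR hB hN k l hm]
  split_ifs with h
  · rfl
  · exact (tape_eq_blank hR.step (hP.blank k) h).symm

lemma stateAt_run (hP : IsPrompt M B τ e S (c 0)) (hR : IsRun M τ e r c) {m : ℕ} (hm : m ≤ r) :
    stateAt M τ (e + m) = some (c m).state := by
  cases m with
  | zero => exact hP.state
  | succ m =>
    rw [stateAt, hR.tok m hm, hR.step]
    simp [runToken, Token.current, TuringMachine.step]

lemma isEnd_or_isRun (hP : IsPrompt M B τ e S (c 0)) (hR : IsRun M τ e r c) {m : ℕ}
    (hm : m ≤ r) : (τ (e + m)).isEnd = true ∨ (τ (e + m)).isRun = true := by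
  cases m with
  | zero => exact .inl hP.isEnd
  | succ m => right; rw [hR.tok m hm]; rfl

lemma nextToken_eq [NeZero K] {t : Token K Q A Γ} (ht : t.isEnd = true ∨ t.isRun = true)
    (thr : Bool) (at0 mk : Fin K → Bool) (g : Fin K → Option Γ) (lq : Option Q) :
    nextToken M t thr at0 mk g lq = if lq = some M.qHalt then .outp
      else if thr = true then .summ
      else
        let r := M.δ (lq.getD M.qInit) fun k => (g k).getD M.blank
        .runTok r.1 r.2.1 fun k => match r.2.2 k with
          | .left => if at0 k = true then .stay else .left
          | m => m := by
  cases t <;> simp [Token.isEnd, Token.isRun] at ht <;> rfl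

/-- The token generated after a run token or the end of a prompt. -/
lemma generated_run [NeZero K] (hP : IsPrompt M B τ e S (c 0)) (hR : IsRun M τ e r c) (hB : 2 ≤ B)
    (hN : e + r < 2 ^ B) (h0 : e + 1 < 2 ^ B) (hre : r ≤ e + 1) {m : ℕ} (hm : m ≤ r) :
    generated M B τ (e + m) = if (c m).state = M.qHalt then .outp
      else if m = e + 1 then .summ else runToken M (c m) := by
  have hE := isEnd_or_isRun hP hR hm
  have hclk : count B τ .clk (e + m) = e + m :=
    count_eq (counter_run hP hR hB hN hm).2.2.2 (by omega)
  have hl : (τ (e + m)).isList = false := by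
    cases h : τ (e + m) <;> simp_all [Token.isEnd, Token.isRun, Token.isList]
  -- The counter is `e + 1 - m`: a summary is due after as many steps as the prompt has tokens.
  have hthr : ((τ (e + m)).isRun = true ∧ count B τ .thr (e + m) = 0) ↔ m = e + 1 := by
    rw [count_thr_run hP hR hB hN hm hre h0]
    constructor
    · rintro ⟨-, h⟩; omega
    · rintro rfl
      exact ⟨by rw [hR.tok e (by omega)]; rfl, by omega⟩
  have hg : ∀ k, ((τ (lastWrite B τ k (e + m))).written M k).getD M.blank =
      (c m).tape k ((c m).head k) := fun k => by
    have : readAddr B τ k (e + m) = (c m).head k + 1 := by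
      simp [readAddr, hl, count_tape_run hP hR hB hN hm]
    rw [lastWrite, this, getD_written_run hP hR hB hN k _ hm]
  rw [generated, nextToken_eq hE, hclk, stateAt_run hP hR hm]
  simp only [Option.some.injEq, decide_eq_true_eq, hthr, hg, Option.getD_some, runToken,
    count_tape_run hP hR hB hN hm, Nat.add_eq_right]

section Tail

variable {n : ℕ}

/-- List tokens keep the head counters and the clock and advance only the cell counter. The opening
delimiter counts too, so the counter is `1`, the address of cell `0`, when the first cell is due. -/
lemma counter_tail (hP : IsPrompt M B τ e S (c 0)) (hR : IsRun M τ e r c) (hB : 2 ≤ B)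
    (hT : ∀ j < n, (τ (e + r + (j + 1))).isList = true) (hN : e + r + n < 2 ^ B) {l : ℕ}
    (hl : l ≤ n) :
    (∀ k, counter τ B (.tape k) (e + r + l) = (((c r).head k + 1 : ℕ) : ZMod (2 ^ B))) ∧
    counter τ B .cnt (e + r + l) = (l : ZMod (2 ^ B)) ∧
    counter τ B .clk (e + r + l) = ((e + r : ℕ) : ZMod (2 ^ B)) := by
  induction l with
  | zero =>
    obtain ⟨h0, h1, -, h3⟩ := counter_run hP hR hB (by omega) le_rfl
    exact ⟨h0, by simpa using h1, h3⟩
  | succ l ih =>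
    obtain ⟨h0, h1, h2⟩ := ih (by omega)
    have hg := hP.gen_of_le (show e ≤ e + r + l + 1 by omega)
    have ht := hT l (by omega)
    rw [← add_assoc] at ht
    simp only [← add_assoc, counter_succ hB _ (show e + r + l + 1 < 2 ^ B by omega), h0, h1, h2]
    refine ⟨fun k => ?_, ?_, ?_⟩
    · cases h : τ (e + r + l + 1) <;> simp_all [amount, Token.isList]
    · simp [amount, ht, hg]
    · simp [amount, ht, hg]

/-- After the prompt only run tokens count as descriptions. The list being generated is thus
invisible to the search. -/
lemma findGreatest_tail (hP : IsPrompt M B τ e S (c 0))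
    (hT : ∀ j < n, (τ (e + r + (j + 1))).isList = true) (P : ℕ → Prop) [DecidablePred P] {l : ℕ}
    (hl : l ≤ n) : Nat.findGreatest (fun j => Writes τ j ∧ P j) (e + r + l) =
      Nat.findGreatest (fun j => Writes τ j ∧ P j) (e + r) := by
  induction l with
  | zero => rfl
  | succ l ih =>
    rw [← add_assoc, Nat.findGreatest_succ, ih (by omega), if_neg]
    rintro ⟨⟨-, h | h⟩, -⟩
    · have ht := hT l (by omega)
      rw [← add_assoc] at ht
      cases h2 : τ (e + r + l + 1) <;> simp_all [Token.isRun, Token.isList]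
    · exact h.2 (hP.gen_of_le (by omega))

/-- The token generated while a list of cells is generated. -/
lemma generated_tail [NeZero K] (hP : IsPrompt M B τ e S (c 0)) (hR : IsRun M τ e r c) (hB : 2 ≤ B)
    (hT : ∀ j < n, (τ (e + r + (j + 1))).isList = true) (hN : e + r + n < 2 ^ B) {l : ℕ}
    (hl : l < n) : ∃ thr at0, generated M B τ (e + r + (l + 1)) =
      nextToken M (τ (e + r + (l + 1))) thr at0 (fun k => decide ((c r).head k = l))
        (fun k => if Seen c S r k l then some ((c r).tape k l) else none)
        (some (c r).state) := by
  obtain ⟨h0, h1, h2⟩ := counter_tail hP hR hB hT hN (show l + 1 ≤ n by omega)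
  have h3 : ∀ k, count B τ (.tape k) (e + r + (l + 1)) = (c r).head k + 1 := fun k =>
    count_eq (h0 k) (by have := head_lt hP hR r k; omega)
  have h4 : count B τ .cnt (e + r + (l + 1)) = l + 1 := count_eq h1 (by omega)
  have h5 : count B τ .clk (e + r + (l + 1)) = e + r := count_eq h2 (by omega)
  refine ⟨decide ((τ (e + r + (l + 1))).isRun = true ∧ count B τ .thr (e + r + (l + 1)) = 0),
    fun k => decide (count B τ (.tape k) (e + r + (l + 1)) = 1), ?_⟩
  rw [generated, h5, stateAt_run hP hR le_rfl]
  congr 1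
  · funext k
    simp [h3, h4]
  · funext k
    have : readAddr B τ k (e + r + (l + 1)) = l + 1 := by
      rw [readAddr, if_pos ⟨hT l hl, hP.gen_of_le (by omega)⟩, h4]
    rw [lastWrite, this, findGreatest_tail hP hT _ (show l + 1 ≤ n by omega)]
    exact written_run hP hR hB (by omega) k l le_rfl

end Tail

end Run

end Segments

end SCoT

namespace SCoT

open Classical

/-! ### The input and every summary describe a configuration. -/

section Prompts

variable {K : ℕ} {Q A Γ : Type*} (M : TuringMachine K Q A Γ) {B : ℕ} {τ : ℕ → Token K Q A Γ}

lemma isPrompt_initConfig (hB : 2 ≤ B) {w : List A} (h0 : τ 0 = .inp)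
    (hw : ∀ j (h : j < w.length), τ (j + 1) = .sym w[j]) (he : τ (w.length + 1) = .endInp)
    (hN : w.length + 1 < 2 ^ B) :
    IsPrompt M B τ (w.length + 1) w.length (M.initConfig w) := by
  have hw2 : ∀ j, 0 < j → j ≤ w.length → ∃ (i : ℕ) (h : i < w.length), j = i + 1 ∧
      τ j = .sym w[i] := fun j h1 h2 =>
    ⟨j - 1, by omega, by omega, by rw [← hw (j - 1) (by omega)]; congr 1; omega⟩
  have hcount : ∀ k, ∀ j ≤ w.length, counter τ B (.tape k) j = 0 := by
    intro k j hj
    induction j with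
    | zero => simp [counter]
    | succ j ih =>
      rw [counter_succ hB _ (by omega), ih (by omega), hw j (by omega)]
      simp [amount]
  refine ⟨by omega, by omega, fun k => by rw [h0]; rfl, by rw [he]; rfl, fun j hj => ?_,
    fun j h1 h2 => ?_, fun j h1 h2 => ?_, fun k => ?_, fun k => Nat.zero_le _, fun k l hl => ?_, ?_⟩
  · rcases Nat.eq_zero_or_pos j with rfl | h1
    · rw [h0]; exact ⟨rfl, rfl⟩
    · obtain ⟨i, hi, -, h⟩ := hw2 j h1 (by omega)
      rw [h]; exact ⟨rfl, rfl⟩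
  · obtain ⟨i, hi, rfl, h⟩ := hw2 j h1 h2
    rw [h]
    refine ⟨rfl, fun k => ?_⟩
    simp [Token.written, TuringMachine.initConfig, hi]
  · obtain rfl : j = w.length + 1 := by omega
    rw [he]; rfl
  · rw [counter_succ hB _ hN, hcount k _ le_rfl, he]
    simp [amount, TuringMachine.initConfig]
  · simp [TuringMachine.initConfig, hl]
  · simp [stateAt, he, Token.current, TuringMachine.initConfig]

lemma isPrompt_summary (hB : 2 ≤ B) {S : ℕ} {c : Config K Q Γ} (h0 : τ 0 = .summ)
    (hc : ∀ l < S, τ (l + 1) = cellToken c l) (hq : τ (S + 1) = .stateTok c.state)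
    (he : τ (S + 2) = .endSumm) (hhead : ∀ k, c.head k < S)
    (hblank : ∀ k l, S ≤ l → c.tape k l = M.blank) (hN : S + 2 < 2 ^ B) :
    IsPrompt M B τ (S + 2) S c := by
  have hc2 : ∀ j, 0 < j → j ≤ S → ∃ l < S, j = l + 1 ∧ τ j = cellToken c l := fun j h1 h2 =>
    ⟨j - 1, by omega, by omega, by rw [← hc (j - 1) (by omega)]; congr 1; omega⟩
  have hend : ∀ j < S + 2, (τ j).isEnd = false ∧ (τ j).isRun = false := by
    intro j hj
    rcases Nat.eq_zero_or_pos j with rfl | h1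
    · rw [h0]; exact ⟨rfl, rfl⟩
    · rcases (show j ≤ S ∨ j = S + 1 by omega) with h2 | rfl
      · obtain ⟨i, hi, -, h⟩ := hc2 j h1 h2
        rw [h]; exact ⟨rfl, rfl⟩
      · rw [hq]; exact ⟨rfl, rfl⟩
  -- The only contribution for tape `k` comes from the cell with the head mark, at position `c.head
  -- k + 1`.
  have hcount : ∀ k, ∀ j ≤ S, counter τ B (.tape k) j =
      if c.head k < j then ((c.head k + 1 : ℕ) : ZMod (2 ^ B)) else 0 := by
    intro k j hj
    induction j with
    | zero => simp [counter]
    | succ j ih =>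
      have hg : ¬ gen τ (j + 1) := by
        rintro ⟨j', h1, h2, h3⟩
        simp [(hend j' (by omega)).1] at h3
      rw [counter_succ hB _ (by omega), ih (by omega), hc j (by omega)]
      simp only [amount, cellToken, hg]
      by_cases h : c.head k = j
      · simp [h]
      · have : c.head k < j ↔ c.head k < j + 1 := by omega
        simp [h, this]
  refine ⟨by omega, by omega, fun k => by rw [h0]; rfl, by rw [he]; rfl, hend,
    fun j h1 h2 => ?_, fun j h1 h2 => ?_, fun k => ?_, fun k => (hhead k).le, hblank, ?_⟩
  · obtain ⟨i, hi, rfl, h⟩ := hc2 j h1 h2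
    rw [h]
    exact ⟨rfl, fun k => rfl⟩
  · rcases (show j = S + 1 ∨ j = S + 2 by omega) with rfl | rfl
    · rw [hq]; rfl
    · rw [he]; rfl
  · rw [counter_succ hB _ hN, counter_succ hB _ (by omega), hcount k _ le_rfl, he, hq,
      if_pos (hhead k)]
    simp [amount]
  · rw [stateAt, he, if_pos rfl, show S + 2 - 1 = S + 1 from rfl, hq]; rfl

end Prompts

/-! ### One segment of the simulation. -/

section Simulation

variable {K : ℕ} {Q A Γ : Type*} (M : TuringMachine K Q A Γ) (B : ℕ)
  {d dff dk dv H L : ℕ} (T : Transformer d dff dk dv H L (Token K Q A Γ))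

/-- The transformer generates the tokens of the simulation on sequences of length at most
`2 ^ B`. -/
def Simulates [NeZero K] : Prop :=
  ∀ τ : ℕ → Token K Q A Γ, (τ 0).isEnd = false → ∀ n ≤ 2 ^ B,
    T.TernaryActivations ((List.range n).map τ) ∧
    (0 < n → T.Outputs ((List.range n).map τ) (generated M B τ (n - 1)))

lemma take_eq_map_range {V : Type*} (g : List V) (v : V) {n : ℕ} (hn : n ≤ g.length) :
    g.take n = (List.range n).map fun j => g.getD j v := by
  refine List.ext_getElem (by simpa using hn) fun j h1 h2 => ?_
  have : j < g.length := by simp at h1; omega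
  simp [this]

variable {M B T}

/-- Extending the finite sequence by an arbitrary token is harmless because only its prefixes are
read. Generation thus becomes a condition on consecutive tokens. -/
lemma Simulates.outputs [NeZero K] (hT : Simulates M B T) {g : List (Token K Q A Γ)}
    (hg : g.length ≤ 2 ^ B) (h0 : (g.getD 0 .inp).isEnd = false) {p : ℕ} (hp : 0 < p)
    (hgen : ∀ i, p ≤ i + 1 → i + 1 < g.length →
      generated M B (fun j => g.getD j .inp) i = g.getD (i + 1) .inp) :
    (∀ n (hn : n < g.length), p ≤ n → T.Outputs (g.take n) g[n]) ∧
      ∀ c, c <+: g → T.TernaryActivations c := by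
  refine ⟨fun n hn hpn => ?_, fun c hc => ?_⟩
  · have h1 := (hT (fun j => g.getD j .inp) h0 n (by omega)).2 (by omega)
    rw [hgen (n - 1) (by omega) (by omega), ← take_eq_map_range g _ hn.le, Nat.sub_add_cancel
      (by omega), List.getD_eq_getElem _ _ hn] at h1
    exact h1
  · have hl := hc.length_le
    rw [List.prefix_iff_eq_take.1 hc, take_eq_map_range g .inp hl]
    exact (hT (fun j => g.getD j .inp) h0 _ (by omega)).1

variable {c : ℕ → Config K Q Γ} {S r n : ℕ} {P X : List (Token K Q A Γ)}

/-- A prompt, followed by the tokens of some steps of the machine and by further tokens, of which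
the first ones form a list of cells. -/
lemma Simulates.segment [NeZero K] (hT : Simulates M B T) (hB : 2 ≤ B)
    (hP : ∀ τ : ℕ → Token K Q A Γ, (∀ j (h : j < P.length), τ j = P[j]) →
      IsPrompt M B τ (P.length - 1) S (c 0))
    (hc : ∀ m, c (m + 1) = M.step (c m)) (hr : r ≤ P.length)
    (hh : ∀ m < r, (c m).state ≠ M.qHalt) (hN : P.length + r + X.length ≤ 2 ^ B)
    (hn : n < X.length) (hX0 : X.getD 0 .inp = if (c r).state = M.qHalt then .outp else .summ)
    (hfin : (c r).state = M.qHalt ∨ r = P.length) (hlist : ∀ j < n, (X.getD j .inp).isList = true)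
    (hX : ∀ l < n, ∀ thr at0, nextToken M (X.getD l .inp) thr at0
      (fun k => decide ((c r).head k = l))
      (fun k => if Seen c S r k l then some ((c r).tape k l) else none) (some (c r).state) =
        X.getD (l + 1) .inp)
    (hend : ∀ l, n ≤ l → l + 1 < X.length →
      (∃ q, X.getD l .inp = .stateTok q) ∧ X.getD (l + 1) .inp = .endSumm)
    {g : List (Token K Q A Γ)} (hg : g = P ++ (List.range r).map (fun m => runToken M (c m)) ++ X) :
    (∀ n (hn : n < g.length), P.length ≤ n → T.Outputs (g.take n) g[n]) ∧
      ∀ c, c <+: g → T.TernaryActivations c := by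
  have hlen : g.length = P.length + r + X.length := by simp [hg, add_assoc]
  have hgP : ∀ j (h : j < P.length), g.getD j .inp = P[j] := by
    intro j h
    rw [hg, List.append_assoc, List.getD_append _ _ _ _ h, List.getD_eq_getElem _ _ h]
  have hP' := hP _ hgP
  have hlt := hP'.lt
  obtain ⟨e, he⟩ : ∃ e, P.length = e + 1 := ⟨P.length - 1, by omega⟩
  rw [he, Nat.add_sub_cancel] at hP' hlt
  have hR : IsRun M (fun j => g.getD j .inp) e r c := by
    refine ⟨hc, fun m hm => ?_⟩
    have h2 : m < ((List.range r).map fun m => runToken M (c m)).length := by simpa using hm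
    change g.getD _ _ = _
    rw [hg, List.append_assoc, List.getD_append_right _ _ _ _ (by omega), he,
      show e + (m + 1) - (e + 1) = m by omega, List.getD_append _ _ _ _ h2,
      List.getD_eq_getElem _ _ h2]
    simp
  have hgX : ∀ l, g.getD (e + r + (l + 1)) .inp = X.getD l .inp := by
    intro l
    rw [hg, List.getD_append_right _ _ _ _ (by simp; omega)]
    congr 1
    simp; omega
  have hT' : ∀ j < n, (g.getD (e + r + (j + 1)) .inp).isList = true := fun j hj => by
    rw [hgX]; exact hlist j hj
  refine hT.outputs (by omega) (hP'.inner 0 (by omega)).1 (by omega) fun i h1 h2 => ?_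
  rcases le_or_gt i (e + r) with h3 | h3
  · obtain ⟨m, rfl⟩ : ∃ m, i = e + m := ⟨i - e, by omega⟩
    rw [generated_run hP' hR hB (by omega) (by omega) (by omega) (by omega)]
    rcases (show m < r ∨ m = r by omega) with h4 | rfl
    · rw [if_neg (hh m h4), if_neg (by omega)]
      exact (hR.tok m h4).symm
    · have := hgX 0
      rw [zero_add] at this
      rw [this, hX0]
      split_ifs with h5 h6
      · rfl
      · rfl
      -- Without halting the run has the length of the prompt, so the threshold test cannot fail.
      · exact absurd (hfin.resolve_left h5) (by omega)
  · obtain ⟨l, rfl⟩ : ∃ l, i = e + r + (l + 1) := ⟨i - (e + r + 1), by omega⟩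
    rw [show e + r + (l + 1) + 1 = e + r + (l + 1 + 1) by omega, hgX]
    rcases lt_or_ge l n with h4 | h4
    · obtain ⟨thr, at0, h⟩ := generated_tail hP' hR hB hT' (by omega) h4
      rw [h, hgX, hX l h4]
    · obtain ⟨⟨q, h5⟩, h6⟩ := hend l h4 (by omega)
      rw [h6, generated, hgX, h5]
      rfl

/-- The number of cells seen after `r` steps, from a prompt with `S` cells. -/
def cellCount (c : ℕ → Config K Q Γ) (S r : ℕ) : ℕ :=
  max S ((Finset.range (r + 1)).sup fun m => Finset.univ.sup fun k => 1 + (c m).head k)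

lemma lt_cellCount_iff {l : ℕ} :
    l < cellCount c S r ↔ l < S ∨ ∃ m ≤ r, ∃ k, l ≤ (c m).head k := by
  simp [cellCount, Finset.lt_sup_iff, Nat.lt_one_add_iff]

/-- Heads start at `S` or below and do not jump, so every cell from `S` up to the farthest head
position is visited. No run token describes the final head position, hence the second alternative.
This justifies the stopping rule of the list. -/
lemma lt_cellCount_iff_seen [NeZero K] (hc : ∀ m, c (m + 1) = M.step (c m))
    (h0 : ∀ k, (c 0).head k ≤ S) {l : ℕ} :
    l < cellCount c S r ↔ ∃ k, Seen c S r k l ∨ (c r).head k = l := by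
  rw [lt_cellCount_iff]
  constructor
  · rintro (h | ⟨m, hm, k, h⟩)
    · exact ⟨0, .inl (.inl h)⟩
    · by_cases hl : l < S
      · exact ⟨0, .inl (.inl hl)⟩
      · have := h0 k
        obtain ⟨m', hm', h'⟩ := exists_head_eq M hc k (by omega) h
        rcases (show m' < r ∨ m' = r by omega) with h2 | rfl
        · exact ⟨k, .inl (.inr ⟨m', h2, h'⟩)⟩
        · exact ⟨k, .inr h'⟩
  · rintro ⟨k, (h | ⟨m, hm, h⟩) | h⟩
    · exact .inl h
    · exact .inr ⟨m, hm.le, k, h.ge⟩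
    · exact .inr ⟨r, le_rfl, k, h.ge⟩

lemma cellCount_le (hc : ∀ m, c (m + 1) = M.step (c m)) (h0 : ∀ k, (c 0).head k ≤ S) :
    cellCount c S r ≤ S + r + 1 := by
  refine max_le (by omega) (Finset.sup_le fun m hm => Finset.sup_le fun k _ => ?_)
  have h1 := head_le M hc k m
  have h2 := h0 k
  simp only [Finset.mem_range] at hm
  omega

lemma nextToken_of_list [NeZero K] {t : Token K Q A Γ} (ht : t = .summ ∨ ∃ x, t = .tapeTok x)
    (thr : Bool) (at0 mk : Fin K → Bool) (g : Fin K → Option Γ) (lq : Option Q) :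
    nextToken M t thr at0 mk g lq = if (∃ k, g k ≠ none ∨ mk k = true) then
      .tapeTok fun k => ((g k).getD M.blank, mk k) else .stateTok (lq.getD M.qInit) := by
  rcases ht with rfl | ⟨x, rfl⟩ <;> rfl

/-- Injectivity of `M.incl` makes the chosen letter the right one, and the blank after the last
letter is not a letter, which closes the output. -/
lemma nextToken_of_output [NeZero K] {t : Token K Q A Γ} (ht : t = .outp ∨ ∃ a, t = .sym a)
    (thr : Bool) (at0 mk : Fin K → Bool) (g : Fin K → Option Γ) (lq : Option Q) {u : List A}
    {l : ℕ} (hl : l ≤ u.length) (h : (g 0).getD M.blank = (u.map M.incl).getD l M.blank) :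
    nextToken M t thr at0 mk g lq = (u.map Token.sym ++ [Token.endOutp]).getD l .inp := by
  have h1 : nextToken M t thr at0 mk g lq =
      if h : ∃ a, M.incl a = (g 0).getD M.blank then .sym h.choose else .endOutp := by
    rcases ht with rfl | ⟨x, rfl⟩ <;> rfl
  rw [h1]
  rcases hl.lt_or_eq with hl | rfl
  · have h2 : (g 0).getD M.blank = M.incl u[l] := by simpa [hl] using h
    have h3 : ∃ a, M.incl a = (g 0).getD M.blank := ⟨_, h2.symm⟩
    rw [dif_pos h3, M.incl.injective (h3.choose_spec.trans h2)]
    rw [List.getD_append _ _ _ _ (by simpa using hl)]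
    simp [hl]
  · rw [dif_neg, List.getD_append_right _ _ _ _ (by simp)]
    · simp
    · rintro ⟨a, ha⟩
      rw [h] at ha
      exact M.incl_ne_blank a (by simpa using ha)

/-- The last segment of a simulation. -/
lemma Simulates.output_segment [NeZero K] (hT : Simulates M B T) (hB : 2 ≤ B)
    (hP : ∀ τ : ℕ → Token K Q A Γ, (∀ j (h : j < P.length), τ j = P[j]) →
      IsPrompt M B τ (P.length - 1) S (c 0))
    (hc : ∀ m, c (m + 1) = M.step (c m)) (hr : r ≤ P.length)
    (hh : ∀ m < r, (c m).state ≠ M.qHalt) (hhr : (c r).state = M.qHalt) {u : List A}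
    (hu : ∀ i, (c r).tape 0 i = (u.map M.incl).getD i M.blank)
    (hN : P.length + r + (u.length + 2) ≤ 2 ^ B) :
    ∃ g, T.ComputesFrom P [g] u ∧ g.length = P.length + r + (u.length + 2) ∧
      ∀ c, c <+: g → T.TernaryActivations c := by
  set X : List (Token K Q A Γ) := .outp :: (u.map Token.sym ++ [.endOutp])
  have hXsucc : ∀ l, X.getD (l + 1) .inp = (u.map Token.sym ++ [Token.endOutp]).getD l .inp :=
    fun l => by simp [X]
  have hsym : ∀ l < u.length + 1, X.getD l .inp = .outp ∨ ∃ a, X.getD l .inp = .sym a := by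
    rintro (_ | l) hl
    · exact .inl rfl
    · right
      rw [hXsucc, List.getD_append _ _ _ _ (by simpa using hl)]
      exact ⟨u[l], by simp [show l < u.length by omega]⟩
  have hblank : ∀ k l, S ≤ l → (c 0).tape k l = M.blank :=
    (hP (fun j => P.getD j .inp) fun j h => by simp [h]).blank
  obtain ⟨h1, h2⟩ := hT.segment (X := X) (n := u.length + 1) hB hP hc hr hh (by simpa [X] using hN)
    (by simp [X]) (by simp [X, hhr]) (.inl hhr)
    (fun j hj => by rcases hsym j hj with h | ⟨a, h⟩ <;> rw [h] <;> rfl)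
    (fun l hl thr at0 => by
      rw [hXsucc]
      refine nextToken_of_output (hsym l hl) _ _ _ _ _ (by omega) ?_
      rw [← hu]
      split_ifs with hs
      · rfl
      · exact (tape_eq_blank hc (hblank 0) hs).symm)
    (fun l hl hl2 => by simp [X] at hl2; omega) rfl
  refine ⟨_, .output _ _ ((List.range r).map fun m => runToken M (c m)) _ ⟨⟨(List.range r).map
    (fun m => runToken M (c m)) ++ .outp :: u.map Token.sym, .endOutp, by simp [X], by simp, ?_⟩,
    h1⟩ (by simp [X]) ?_, by simp [X]; omega, h2⟩
  · simp only [List.mem_append, List.mem_map, List.mem_cons]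
    rintro v (⟨m, -, rfl⟩ | rfl | ⟨a, -, rfl⟩) <;> simp [runToken]
  · simp [runToken]

/-- A segment of a simulation that ends in a summary. -/
lemma Simulates.summary_segment [NeZero K] (hT : Simulates M B T) (hB : 2 ≤ B)
    (hP : ∀ τ : ℕ → Token K Q A Γ, (∀ j (h : j < P.length), τ j = P[j]) →
      IsPrompt M B τ (P.length - 1) S (c 0))
    (hc : ∀ m, c (m + 1) = M.step (c m)) (hr : r = P.length)
    (hh : ∀ m ≤ r, (c m).state ≠ M.qHalt)
    (hN : P.length + r + (cellCount c S r + 3) ≤ 2 ^ B) :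
    ∃ g P' : List (Token K Q A Γ), (∀ segs u, T.ComputesFrom P' segs u →
      T.ComputesFrom P (g :: segs) u) ∧
      P'.length = cellCount c S r + 3 ∧ g.length = P.length + r + P'.length ∧
      (∀ c, c <+: g → T.TernaryActivations c) ∧
      ∀ τ : ℕ → Token K Q A Γ, (∀ j (h : j < P'.length), τ j = P'[j]) →
        IsPrompt M B τ (P'.length - 1) (cellCount c S r) (c r) := by
  set S' := cellCount c S r
  set s : List (Token K Q A Γ) := (List.range S').map (cellToken (c r)) ++ [.stateTok (c r).state]
  set X : List (Token K Q A Γ) := .summ :: (s ++ [.endSumm])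
  have hP0 := hP (fun j => P.getD j .inp) fun j h => by simp [h]
  have hXsucc : ∀ l < S', X.getD (l + 1) .inp = cellToken (c r) l := fun l hl => by
    have h : l < ((List.range S').map (cellToken (A := A) (Q := Q) (c r))).length := by simpa using hl
    rw [List.getD_cons_succ, List.append_assoc, List.getD_append _ _ _ _ h,
      List.getD_eq_getElem _ _ h]
    simp
  have hXq : X.getD (S' + 1) .inp = .stateTok (c r).state := by simp [X, s]
  have hXe : X.getD (S' + 2) .inp = .endSumm := by simp [X, s]
  have hlist : ∀ l < S' + 1, X.getD l .inp = .summ ∨ ∃ x, X.getD l .inp = .tapeTok x := by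
    rintro (_ | l) hl
    · exact .inl rfl
    · exact .inr ⟨_, hXsucc l (by omega)⟩
  have hXl : X.length = S' + 3 := by simp [X, s]
  obtain ⟨h1, h2⟩ := hT.segment (X := X) (n := S' + 1) hB hP hc hr.le
    (fun m hm => hh m hm.le) (by omega) (by omega) (by simp [X, hh r le_rfl]) (.inr hr)
    (fun j hj => by rcases hlist j hj with h | ⟨a, h⟩ <;> rw [h] <;> rfl)
    (fun l hl thr at0 => by
      rw [nextToken_of_list (hlist l hl)]
      have hiff : (∃ k, (if Seen c S r k l then some ((c r).tape k l) else none) ≠ none ∨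
          decide ((c r).head k = l) = true) ↔ l < S' := by
        simp [S', lt_cellCount_iff_seen hc hP0.head]
      rw [if_congr hiff rfl rfl]
      split_ifs with hl2
      · rw [hXsucc l hl2, cellToken]
        congr 1
        funext k
        congr 1
        split_ifs with hs
        · rfl
        · exact (tape_eq_blank hc (hP0.blank k) hs).symm
      · obtain rfl : l = S' := by omega
        rw [hXq]; rfl)
    (fun l hl hl2 => by
      obtain rfl : l = S' + 1 := by omega
      exact ⟨⟨_, hXq⟩, hXe⟩) rfl
  refine ⟨_, X, fun segs u h => .summary _ _ ((List.range r).map fun m => runToken M (c m)) s _ _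
    ⟨⟨(List.range r).map (fun m => runToken M (c m)) ++ .summ :: s, .endSumm, by simp [X],
      by simp, ?_⟩, h1⟩ (by simp [X]) (by simp [s]) ?_ (by simpa [X] using h), hXl,
      by simp [add_assoc], h2, fun τ hτ => ?_⟩
  · simp only [s, List.mem_append, List.mem_map, List.mem_cons]
    rintro v (⟨m, -, rfl⟩ | rfl | ⟨a, -, rfl⟩ | rfl | h) <;> simp_all [runToken, cellToken]
  · simp [s, runToken, cellToken]
  · have hτ2 : ∀ j < S' + 3, τ j = X.getD j .inp := fun j hj => by
      rw [hτ j (by omega), List.getD_eq_getElem]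
    rw [hXl]
    refine isPrompt_summary M hB (by rw [hτ2 0 (by omega)]; rfl)
      (fun l hl => by rw [hτ2 _ (by omega), hXsucc l hl]) (by rw [hτ2 _ (by omega), hXq])
      (by rw [hτ2 _ (by omega), hXe]) (fun k => lt_cellCount_iff.2 (.inr ⟨r, le_rfl, k, le_rfl⟩))
      (fun k l hl => tape_eq_blank hc (hP0.blank k) fun hs =>
        not_lt.2 hl ((lt_cellCount_iff_seen hc hP0.head).2 ⟨k, .inl hs⟩)) (by omega)

end Simulation

end SCoT

namespace SCoT

/-! ### The total length of the segments, and the constants. -/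

section Main

variable {K : ℕ} {Q A Γ : Type*} {M : TuringMachine K Q A Γ} {B : ℕ}
  {d dff dk dv H L : ℕ} {T : Transformer d dff dk dv H L (Token K Q A Γ)}

lemma head_lt_space {w : List A} {t i : ℕ} (hi : i ≤ t) (k : Fin K) :
    (M.run w i).head k < M.space w t := by
  have h1 := Finset.le_sup (f := fun k => 1 + (M.run w i).head k) (Finset.mem_univ k)
  have h2 := Finset.le_sup (f := fun i => Finset.univ.sup fun k => 1 + (M.run w i).head k)
    (Finset.mem_range.2 (show i < t + 1 by omega))
  have h3 := le_max_right w.length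
    ((Finset.range (t + 1)).sup fun i => Finset.univ.sup fun k => 1 + (M.run w i).head k)
  rw [← TuringMachine.space] at h3
  omega

/-- From a prompt for a configuration before the halting time, the output is computed. -/
theorem Simulates.computesFrom [NeZero K] (hT : Simulates M B T) (hB : 2 ≤ B) {w u : List A}
    {t : ℕ} (hu : M.HaltsWithOutput w t u) (hN : 8 * (M.space w t + 3) ≤ 2 ^ B) (n : ℕ) :
    ∀ t₀, 0 < n → t₀ + n = t → ∀ (P : List (Token K Q A Γ)) (S : ℕ),
      (∀ τ : ℕ → Token K Q A Γ, (∀ j (h : j < P.length), τ j = P[j]) →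
        IsPrompt M B τ (P.length - 1) S (M.run w t₀)) → S ≤ M.space w t →
      ∃ segs : List (List (Token K Q A Γ)), T.ComputesFrom P segs u ∧
        (∀ g ∈ segs, g.length ≤ 8 * (M.space w t + 3)) ∧
        (segs.map List.length).sum ≤ 2 * P.length + 8 * n ∧
        (3 ≤ P.length → (segs.map List.length).sum + 2 ≤ 2 * P.length + 8 * n) ∧
        ∀ g ∈ segs, ∀ c, c <+: g → T.TernaryActivations c := by
  induction n using Nat.strong_induction_on with
  | _ n ih =>
  intro t₀ hn ht P S hP hS
  have hc : ∀ m, M.run w (t₀ + (m + 1)) = M.step (M.run w (t₀ + m)) := fun m => rfl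
  have hh : ∀ m < n, (M.run w (t₀ + m)).state ≠ M.qHalt := fun m hm h => by
    have := hu.1.2 h; omega
  have hP0 := hP (fun j => P.getD j .inp) fun j h => by simp [h]
  have hlt := hP0.lt
  have hle := hP0.le
  -- Halting is tested before the threshold, so `n = P.length` still belongs to the output case.
  rcases le_or_gt n P.length with hnp | hnp
  · have hfin : (M.run w (t₀ + n)).state = M.qHalt := by rw [ht]; exact hu.1.1
    have htape : ∀ i, (M.run w (t₀ + n)).tape 0 i = (u.map M.incl).getD i M.blank := by
      rw [ht]; exact hu.2
    -- Letters of the output are not blank, so their cells were described or visited. This bounds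
    -- the output by `S + n` and by the space.
    have hseen : ∀ l < u.length, l < S ∨ ∃ m < n, (M.run w (t₀ + m)).head 0 = l := by
      intro l hl
      by_contra hs
      have h1 := tape_eq_blank (c := fun m => M.run w (t₀ + m)) hc (hP0.blank 0) hs
      simp only [htape] at h1
      exact M.incl_ne_blank u[l] (by simpa [hl] using h1)
    have hu1 : u.length ≤ S + n := by
      by_contra hcon
      rcases hseen (S + n) (by omega) with h | ⟨m, hm, h⟩
      · omega
      · have h1 := head_le M (c := fun m => M.run w (t₀ + m)) hc 0 m
        have h2 := hP0.head 0
        simp only [add_zero] at h1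
        omega
    have hu2 : u.length ≤ M.space w t := by
      by_contra hcon
      rcases hseen (M.space w t) (by omega) with h | ⟨m, hm, h⟩
      · omega
      · have h1 : (M.run w (t₀ + m)).head 0 < M.space w t := head_lt_space (by omega) 0
        omega
    obtain ⟨g, h1, h2, h3⟩ := hT.output_segment (c := fun m => M.run w (t₀ + m)) hB hP hc hnp hh
      hfin htape (by omega)
    refine ⟨[g], h1, ?_, ?_, ?_, ?_⟩
    · simp only [List.mem_singleton, forall_eq]; omega
    · simp only [List.map_cons, List.map_nil, List.sum_singleton]; omega
    · simp only [List.map_cons, List.map_nil, List.sum_singleton]; omega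
    · simpa using h3
  · set c := fun m => M.run w (t₀ + m)
    have hS1 := cellCount_le (c := c) (r := P.length) hc hP0.head
    have hS2 : cellCount c S P.length ≤ M.space w t :=
      max_le hS (Finset.sup_le fun m hm => Finset.sup_le fun k _ => by
        have h1 : (c m).head k < M.space w t :=
          head_lt_space (by simp only [Finset.mem_range] at hm; omega) k
        omega)
    obtain ⟨g, P', h1, h2, h3, h4, h5⟩ := hT.summary_segment (c := c) hB hP hc rfl
      (fun m hm => hh m (by omega)) (by omega)
    obtain ⟨segs, h6, h7, -, h8, h9⟩ := ih (n - P.length) (by omega) (t₀ + P.length) (by omega)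
      (by omega) P' _ h5 hS2
    -- Write `p` and `p'` for the prompt lengths. Then `p' ≤ 2 * p + 2`, and the segment (of length
    -- `2 * p + p'`) and the rest sum to at most `2 * p + 3 * p' + 8 * (n - p) - 2 ≤ 8 * n + 4`.
    -- This is at most `2 * p + 8 * n` as `p ≥ 2`, with `2` to spare if `p ≥ 3`. Summaries have at
    -- least three tokens, so the spare `2` is available in the induction.
    have h10 := h8 (by omega)
    refine ⟨g :: segs, h1 _ _ h6, ?_, ?_, ?_, ?_⟩
    · simp only [List.mem_cons, forall_eq_or_imp]
      exact ⟨by omega, h7⟩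
    · simp only [List.map_cons, List.sum_cons]; omega
    · simp only [List.map_cons, List.sum_cons]; omega
    · simp only [List.mem_cons, forall_eq_or_imp]
      exact ⟨h4, h9⟩

theorem Simulates.computesSCoT [NeZero K] (hT : Simulates M B T) (hB : 2 ≤ B) {w u : List A}
    {t : ℕ} (hu : M.HaltsWithOutput w t u) (hN : 8 * (M.space w t + 3) ≤ 2 ^ B) :
    ∃ segs : List (List (Token K Q A Γ)), T.ComputesSCoT w segs u ∧
      (∀ g ∈ segs, g.length ≤ 8 * (M.space w t + 3)) ∧
      (segs.map List.length).sum ≤ 8 * t + 2 * w.length + 4 ∧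
      ∀ g ∈ segs, ∀ c, c <+: g → T.TernaryActivations c := by
  have hw : w.length ≤ M.space w t := le_max_left _ _
  have ht : 0 < t := Nat.pos_of_ne_zero fun h => by
    have := hu.1.1
    rw [h] at this
    exact M.qHalt_ne_qInit this.symm
  have hlen : ([Token.inp] ++ w.map Token.sym ++ [Token.endInp] : List (Token K Q A Γ)).length =
      w.length + 2 := by simp
  obtain ⟨segs, h1, h2, h3, -, h4⟩ := hT.computesFrom hB hu hN t 0 ht (zero_add t)
    ([.inp] ++ w.map .sym ++ [.endInp]) w.length (fun τ hτ => by
      rw [hlen]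
      refine isPrompt_initConfig M hB (by rw [hτ 0 (by omega)]; rfl) (fun j hj => ?_) ?_ (by omega)
      · rw [hτ _ (by omega)]
        simp [hj]
      · rw [hτ _ (by omega)]
        simp) hw
  exact ⟨segs, h1, h2, by omega, h4⟩

end Main

/-- One has `2 ^ B < 16 * (s + 3) ≤ 2 ^ 5 * (s + 2) ≤ (s + 2) ^ 6`, and `log 2 > 2 / 3` turns the
exponent `6` into `9`. -/
lemma clog_le (s : ℕ) : (Nat.clog 2 (8 * (s + 3)) : ℝ) ≤ 9 * Real.log (s + 2) := by
  set B := Nat.clog 2 (8 * (s + 3))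
  have h1 : 2 ^ (B - 1) < 8 * (s + 3) := by
    have h := Nat.pow_pred_clog_lt_self (b := 2) (by norm_num) (show 1 < 8 * (s + 3) by omega)
    exact h
  have hB : 0 < B := Nat.clog_pos (by norm_num) (by omega)
  have h2 : 2 ^ B ≤ (s + 2) ^ 6 := by
    have h3 : 2 ^ B = 2 * 2 ^ (B - 1) := by rw [← pow_succ', Nat.sub_add_cancel hB]
    have h4 : 2 ^ 5 ≤ (s + 2) ^ 5 := Nat.pow_le_pow_left (by omega) 5
    have h5 : (s + 2) ^ 6 = (s + 2) ^ 5 * (s + 2) := pow_succ _ _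
    have h6 : 2 ^ 5 * (s + 2) ≤ (s + 2) ^ 5 * (s + 2) := Nat.mul_le_mul_right _ h4
    omega
  have h3 : (B : ℝ) * Real.log 2 ≤ 6 * Real.log (s + 2) := by
    have h4 : ((2 : ℝ) ^ B) ≤ ((s : ℝ) + 2) ^ 6 := by exact_mod_cast h2
    have h5 := Real.log_le_log (by positivity) h4
    rw [Real.log_pow, Real.log_pow] at h5
    exact_mod_cast h5
  have h4 := Real.log_two_gt_d9
  have h5 : (B : ℝ) * (2 / 3) ≤ B * Real.log 2 := by
    gcongr; linarith
  linarith

end SCoT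

theorem theorem3p3 :
    ∃ C : ℝ, ∀ (K : ℕ) [NeZero K] (Q A Γ : Type*) [Finite Q] [Finite A] [Finite Γ]
      (M : SCoT.TuringMachine K Q A Γ), ∃ CM : ℝ, ∀ s : ℕ,
      ∃ (d dff dk dv H L : ℕ) (T : SCoT.Transformer d dff dk dv H L (SCoT.Token K Q A Γ)),
        T.TernaryWeights ∧
        (L : ℝ) ≤ C * Real.log (s + 2) ∧
        (dk : ℝ) ≤ C * Real.log (s + 2) ∧
        (d : ℝ) ≤ CM * Real.log (s + 2) ∧
        (dv : ℝ) ≤ CM * Real.log (s + 2) ∧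
        (dff : ℝ) ≤ CM * Real.log (s + 2) ∧
        (H : ℝ) ≤ CM ∧
        8 * (s + 3) ≤ 2 ^ T.posDim ∧
        ∀ (w u : List A) (t : ℕ), M.HaltsWithOutput w t u → M.space w t ≤ s →
          ∃ segs : List (List (SCoT.Token K Q A Γ)),
            T.ComputesSCoT w segs u ∧
            (∀ g ∈ segs, g.length ≤ 8 * (M.space w t + 3)) ∧
            (segs.map List.length).sum ≤ 8 * t + 2 * w.length + 4 ∧
            (∀ g ∈ segs, ∀ c, c <+: g → c ≠ g → T.TernaryActivations c) := by
  -- With `2 ≤ B` and `B ≤ 9 * log (s + 2)`, both `4 * B + 3` and `8 * B + 9` are at most `12.5 *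
  -- B`, which leaves ample room.
  refine ⟨200, fun K _ Q A Γ _ _ _ M => ?_⟩
  obtain ⟨c, hc⟩ := SCoT.exists_simulator M
  -- The dimensions are at most `c * B`; the summand `K + 1` is the number of heads.
  refine ⟨9 * c + (K + 1), fun s => ?_⟩
  have hlog := SCoT.clog_le s
  have hpow : 8 * (s + 3) ≤ 2 ^ Nat.clog 2 (8 * (s + 3)) := Nat.le_pow_clog (by norm_num) _
  set B := Nat.clog 2 (8 * (s + 3))
  have hB : 2 ≤ B := by
    by_contra hB
    have : 2 ^ B ≤ 2 ^ 1 := Nat.pow_le_pow_right (by norm_num) (by omega)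
    omega
  have hB' : (2 : ℝ) ≤ B := by exact_mod_cast hB
  have hlog0 : 0 ≤ Real.log (s + 2) := by linarith
  obtain ⟨d, dff, L, T, hd, hdff, hL, h1, h2, h3⟩ := hc B hB
  have hbound : ∀ n ≤ c * B, (n : ℝ) ≤ (9 * c + (K + 1)) * Real.log (s + 2) := fun n hn => by
    have h4 : (n : ℝ) ≤ c * B := by exact_mod_cast hn
    have h5 : (c : ℝ) * B ≤ c * (9 * Real.log (s + 2)) := by gcongr
    have h6 : 0 ≤ ((K : ℝ) + 1) * Real.log (s + 2) := by positivity
    linarith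
  refine ⟨d, dff, 8 * B + 9, d, K + 1, L, T, h1, ?_, ?_, hbound d hd, hbound d hd, hbound dff hdff,
    ?_, by rwa [h2], fun w u t hu hs => ?_⟩
  · rw [hL]; push_cast; linarith
  · push_cast; linarith
  · push_cast
    have : (0 : ℝ) ≤ c := by positivity
    linarith
  · obtain ⟨segs, h4, h5, h6, h7⟩ := SCoT.Simulates.computesSCoT h3 hB hu (by omega)
    exact ⟨segs, h4, h5, h6, fun g hg p hp _ => h7 g hg p hp⟩
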